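/- Let $p\ge 7$ be a safe prime, i.e. $p$ and $n:=(p-1)/2$ are both prime. Let $V$ be the $n$-dimensional complex vector space of odd functions $f:\mathbb F_p\to\mathbb C$, with the $\ell^2$ hermitian norm, let $\mathbb P(V)$ be its projective space, and let $$T=\{[f]\in\mathbb P(V)\;:\; |f|\text{ is constant on }\mathbb F_p\smallsetminus\{0\}\}$$ be its Clifford torus. Let $F$ be the unitary transformation of $V$ given by the Fourier transform $(Ff)(k)=\frac1{\sqrt p}\sum_{\ell\in\mathbb F_p}e^{2i\pi k\ell/p}f(\ell)$, and let $\chi_0(k)=\left(\frac kp\right)$ be the Legendre character, which belongs to $V$. For $S,S'\subset\mathbb P(V)$ real analytic submanifolds and $x\in S\cap S'$: $S$ and $S'$ are tangent at $x$ if $T_xS=T_xS'$; they are transverse at $x$ if $T_xS\cap T_xS'=\{0\}$; and the algebraic multiplicity of $S\cap S'$ at $x$ is $\dim_{\mathbb C}\mathcal A_x/(\mathcal I_x+\mathcal I'_x)$, where $\mathcal A_x$ is the local ring of germs at $x$ of complex valued real analytic functions on $\mathbb P(V)$ (seen as a real analytic variety), and $\mathcal I_x$, $\mathcal I'_x$ are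 the ideals of the germs vanishing on $S$, respectively on $S'$. (a) The point $[\chi_0]$ lies on $T\cap F^{-1}T$, the tori $T$ and $F^{-1}T$ are tangent at $[\chi_0]$, and the algebraic multiplicity at $[\chi_0]$ of the intersection $T\cap F^{-1}T$ is $2^{n-1}$. (b) There exist a neighborhood $\Omega$ of $[\chi_0]$ in $\mathbb P(V)$ and a continuous family $(F_t)_{t\in\mathbb R}$ of unitary maps of $V$ with $F_0=F$ such that, for all $t\in(0,1)$, the tori $T$ and $F_t^{-1}T$ are transverse at every point of $T\cap F_t^{-1}T\cap\Omega$, and $T\cap F_t^{-1}T\cap\Omega$ contains at most $2^{n-2}$ points. -/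

import Mathlib

open scoped LinearAlgebra.Projectivization ContDiff Topology

noncomputable section

/-! ## Complex projective spaces as real analytic varieties -/

namespace ProjGeom

variable {E : Type*} [NormedAddCommGroup E] [NormedSpace ℂ E]

/-- The quotient topology on the projective space of a complex normed space. -/
instance projTopology : TopologicalSpace (ℙ ℂ E) :=
  inferInstanceAs (TopologicalSpace (Quotient (projectivizationSetoid ℂ E)))

/-- The pull-back of a function on the projective space to the punctured vector space
(extended by `0` at the origin, a value that plays no role). -/
def pullback (g : ℙ ℂ E → ℂ) (w : E) : ℂ := by
  classical exact if h : w = 0 then 0 else g (Projectivization.mk ℂ w h)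

lemma pullback_of_ne (g : ℙ ℂ E → ℂ) {w : E} (h : w ≠ 0) :
    pullback g w = g (Projectivization.mk ℂ w h) := by
  simp [pullback, h]

lemma pullback_add (g h : ℙ ℂ E → ℂ) : pullback (g + h) = pullback g + pullback h := by
  funext w
  by_cases hw : w = 0 <;> simp [pullback, hw]

lemma pullback_mul (g h : ℙ ℂ E → ℂ) : pullback (g * h) = pullback g * pullback h := by
  funext w
  by_cases hw : w = 0 <;> simp [pullback, hw]

/-- A complex valued function on the projective space is real analytic at `x` (hence near `x`)
when its pull-back by the analytic submersion `E ∖ {0} → ℙ(E)` is real analytic at the vectors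
spanning `x`.  This submersion has analytic local sections (the affine charts `α ↦ [v + α]`,
with `α` in a complement of `ℂ v`), so that this is analyticity in the affine charts. -/
def RealAnalyticAt (g : ℙ ℂ E → ℂ) (x : ℙ ℂ E) : Prop :=
  ∀ (v : E) (hv : v ≠ 0), Projectivization.mk ℂ v hv = x → AnalyticAt ℝ (pullback g) v

lemma RealAnalyticAt.add {g h : ℙ ℂ E → ℂ} {x : ℙ ℂ E} (hg : RealAnalyticAt g x)
    (hh : RealAnalyticAt h x) : RealAnalyticAt (g + h) x := fun v hv hx => by
  rw [pullback_add]; exact (hg v hv hx).add (hh v hv hx)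

lemma RealAnalyticAt.mul {g h : ℙ ℂ E → ℂ} {x : ℙ ℂ E} (hg : RealAnalyticAt g x)
    (hh : RealAnalyticAt h x) : RealAnalyticAt (g * h) x := fun v hv hx => by
  rw [pullback_mul]; exact (hg v hv hx).mul (hh v hv hx)

lemma realAnalyticAt_const (c : ℂ) (x : ℙ ℂ E) : RealAnalyticAt (fun _ => c) x :=
  fun v hv _ => by
    refine (analyticAt_const (v := c)).congr ?_
    filter_upwards [isOpen_ne.mem_nhds hv] with w hw
    rw [pullback_of_ne _ hw]

/-- The pointwise `ℂ`-algebra structure on germs of complex valued functions. -/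
instance germAlgebra {X : Type*} (l : Filter X) : Algebra ℂ (Filter.Germ l ℂ) :=
  Algebra.ofModule
    (fun r a b => by
      induction a using Filter.Germ.inductionOn
      induction b using Filter.Germ.inductionOn
      norm_cast
      rw [smul_mul_assoc])
    (fun r a b => by
      induction a using Filter.Germ.inductionOn
      induction b using Filter.Germ.inductionOn
      norm_cast
      rw [mul_smul_comm])

/-- The local ring at `x` of germs of complex valued real analytic functions on `ℙ(E)`. -/
def analyticGerms (x : ℙ ℂ E) : Subalgebra ℂ (Filter.Germ (𝓝 x) ℂ) where
  carrier := {φ | ∃ g : ℙ ℂ E → ℂ, RealAnalyticAt g x ∧ (g : Filter.Germ (𝓝 x) ℂ) = φ}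
  mul_mem' := by
    rintro _ _ ⟨g, hg, rfl⟩ ⟨h, hh, rfl⟩
    exact ⟨g * h, hg.mul hh, rfl⟩
  add_mem' := by
    rintro _ _ ⟨g, hg, rfl⟩ ⟨h, hh, rfl⟩
    exact ⟨g + h, hg.add hh, rfl⟩
  algebraMap_mem' := fun c => by
    refine ⟨fun _ => c, realAnalyticAt_const c x, ?_⟩
    rw [Algebra.algebraMap_eq_smul_one]
    change _ = ((c • (1 : ℙ ℂ E → ℂ) : ℙ ℂ E → ℂ) : Filter.Germ (𝓝 x) ℂ)
    congr 1
    funext y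
    simp

/-- The ideal of the germs at `x` of real analytic functions that vanish on `S` (near `x`). -/
def vanishingIdeal (S : Set (ℙ ℂ E)) (x : ℙ ℂ E) : Ideal (analyticGerms x) where
  carrier := {φ | ∃ g : ℙ ℂ E → ℂ, (g : Filter.Germ (𝓝 x) ℂ) = φ ∧ ∀ᶠ y in 𝓝 x, y ∈ S → g y = 0}
  zero_mem' := ⟨0, rfl, by simp⟩
  add_mem' := by
    rintro φ ψ ⟨g, hg, hgS⟩ ⟨h, hh, hhS⟩
    refine ⟨g + h, by rw [Filter.Germ.coe_add, hg, hh]; rfl, ?_⟩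
    filter_upwards [hgS, hhS] with y h1 h2 hy
    simp [h1 hy, h2 hy]
  smul_mem' := by
    rintro ⟨_, k, hk, rfl⟩ φ ⟨g, hg, hgS⟩
    refine ⟨k * g, by rw [Filter.Germ.coe_mul, hg]; rfl, ?_⟩
    filter_upwards [hgS] with y h1 hy
    simp [h1 hy]

/-- The algebraic multiplicity at `x` of the intersection of two real analytic subvarieties
`S`, `S'` of `ℙ(E)`: the complex dimension (as a cardinal) of the local ring at `x` of the
schematic intersection, i.e. of the ring of germs of complex valued real analytic functions
modulo the sum of the ideals of `S` and of `S'`. -/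
def intersectionMultiplicity (S S' : Set (ℙ ℂ E)) (x : ℙ ℂ E) : Cardinal :=
  Module.rank ℂ (analyticGerms x ⧸ (vanishingIdeal S x ⊔ vanishingIdeal S' x))

/-- The tangent space at `[v]` of a submanifold `S` of `ℙ(E)`, as a subset of
`T_[v] ℙ(E) = E / ℂ v` (identified by the differential at `v` of `E ∖ {0} → ℙ(E)`): the set of
velocity vectors at `[v]` of smooth curves drawn on `S`. -/
def tangentVectors (S : Set (ℙ ℂ E)) (v : E) : Set (E ⧸ Submodule.span ℂ {v}) :=
  {u | ∃ γ : ℝ → E, ContDiffAt ℝ ∞ γ 0 ∧ γ 0 = v ∧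
    (∀ᶠ t in 𝓝 (0 : ℝ), ∃ h : γ t ≠ 0, Projectivization.mk ℂ (γ t) h ∈ S) ∧
    Submodule.Quotient.mk (deriv γ 0) = u}

/-- `S` and `S'` meet at `x` and have the same tangent space there. -/
def TangentAt (S S' : Set (ℙ ℂ E)) (x : ℙ ℂ E) : Prop :=
  x ∈ S ∩ S' ∧ ∀ (v : E) (hv : v ≠ 0), Projectivization.mk ℂ v hv = x →
    tangentVectors S v = tangentVectors S' v

/-- The tangent spaces of `S` and `S'` at `x` meet only in the zero vector. -/
def TransverseAt (S S' : Set (ℙ ℂ E)) (x : ℙ ℂ E) : Prop :=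
  ∀ (v : E) (hv : v ≠ 0), Projectivization.mk ℂ v hv = x →
    tangentVectors S v ∩ tangentVectors S' v = {0}

/-- The inverse image `u⁻¹ S` of a subset of `ℙ(E)` by a unitary map `u` of `E`. -/
def unitaryPreimage (u : E ≃ₗᵢ[ℂ] E) (S : Set (ℙ ℂ E)) : Set (ℙ ℂ E) :=
  Projectivization.map u.toLinearEquiv.toLinearMap u.injective ⁻¹' S

end ProjGeom

/-! ## Odd functions on `ℤ/p`, the Clifford torus and the Fourier transform -/

namespace OddFun

variable (p : ℕ) [Fact p.Prime]

/-- The hermitian space `V` of odd functions `ℤ/p → ℂ`, with its `ℓ²` norm. -/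
def oddSpace : Submodule ℂ (EuclideanSpace ℂ (ZMod p)) where
  carrier := {f | ∀ k, f (-k) = - f k}
  zero_mem' := fun k => by simp
  add_mem' := fun {f g} hf hg k => by simp [hf k, hg k]; ring
  smul_mem' := fun c f hf k => by simp [hf k]

/-- The Clifford torus `T` of `ℙ(V)`: the lines spanned by the odd functions whose modulus is
constant on `(ℤ/p) ∖ {0}`. -/
def cliffordTorus : Set (ℙ ℂ (oddSpace p)) :=
  {x | ∀ k : ZMod p, k ≠ 0 → ‖x.rep.1 k‖ = ‖x.rep.1 1‖}

/-- Membership in the torus can be tested on any spanning vector. -/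
lemma mk_mem_cliffordTorus (f : oddSpace p) (hf : f ≠ 0) :
    Projectivization.mk ℂ f hf ∈ cliffordTorus p ↔ ∀ k : ZMod p, k ≠ 0 → ‖f.1 k‖ = ‖f.1 1‖ := by
  obtain ⟨a, ha⟩ := Projectivization.exists_smul_eq_mk_rep ℂ f hf
  have h : ∀ k, ‖(Projectivization.mk ℂ f hf).rep.1 k‖ = ‖(a : ℂ)‖ * ‖f.1 k‖ := fun k => by
    rw [← ha, ← norm_mul]; rfl
  have ha0 : ‖(a : ℂ)‖ ≠ 0 := by simp
  simp only [cliffordTorus, Set.mem_ofPred_eq, h, mul_right_inj' ha0]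

/-- The Fourier transform
`(F f)(k) = p^(-1/2) ∑_ℓ exp(2 i π k ℓ / p) f(ℓ)` of a function on `ℤ/p`. -/
def fourierFun (f : ZMod p → ℂ) (k : ZMod p) : ℂ :=
  ((Real.sqrt p : ℝ) : ℂ)⁻¹ * ∑ l : ZMod p, ZMod.stdAddChar (k * l) * f l

lemma fourierFun_odd {f : ZMod p → ℂ} (hf : ∀ k, f (-k) = - f k) (k : ZMod p) :
    fourierFun p f (-k) = - fourierFun p f k := by
  unfold fourierFun
  rw [← mul_neg, ← Finset.sum_neg_distrib, ← Equiv.sum_comp (Equiv.neg (ZMod p))]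
  congr 1
  refine Finset.sum_congr rfl fun l _ => ?_
  simp [hf l]

lemma fourierFun_parseval (f : ZMod p → ℂ) :
    ∑ k, ‖fourierFun p f k‖ ^ 2 = ∑ k, ‖f k‖ ^ 2 := by
  have hp0 : (p : ℂ) ≠ 0 := Nat.cast_ne_zero.mpr (Fact.out : p.Prime).ne_zero
  have hsq : ((Real.sqrt p : ℝ) : ℂ)⁻¹ * ((Real.sqrt p : ℝ) : ℂ)⁻¹ = (p : ℂ)⁻¹ := by
    rw [← mul_inv, ← Complex.ofReal_mul, Real.mul_self_sqrt (Nat.cast_nonneg p)]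
    simp
  have horth : ∀ l m : ZMod p, ∑ k : ZMod p, (ZMod.stdAddChar (k * l) : ℂ) *
      (starRingEnd ℂ) (ZMod.stdAddChar (k * m)) = if l = m then (p : ℂ) else 0 := fun l m => by
    have h := AddChar.sum_mulShift (l - m) (ZMod.isPrimitive_stdAddChar p)
    rw [ZMod.card] at h
    simp only [sub_eq_zero] at h
    push_cast at h
    rw [← h]
    refine Finset.sum_congr rfl fun k _ => ?_
    rw [← AddChar.map_neg_eq_conj, ← AddChar.map_add_eq_mul]
    congr 1
    ring
  have key : ∑ k, fourierFun p f k * (starRingEnd ℂ) (fourierFun p f k) =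
      ∑ k, f k * (starRingEnd ℂ) (f k) := by
    calc ∑ k, fourierFun p f k * (starRingEnd ℂ) (fourierFun p f k)
        = ∑ k : ZMod p, ∑ l : ZMod p, ∑ m : ZMod p, (p : ℂ)⁻¹ * (f l * (starRingEnd ℂ) (f m)) *
            ((ZMod.stdAddChar (k * l) : ℂ) * (starRingEnd ℂ) (ZMod.stdAddChar (k * m))) := by
          refine Finset.sum_congr rfl fun k _ => ?_
          simp only [fourierFun, map_mul, map_sum, map_inv₀, Complex.conj_ofReal]
          rw [mul_mul_mul_comm, hsq, Finset.sum_mul_sum, Finset.mul_sum]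
          refine Finset.sum_congr rfl fun l _ => ?_
          rw [Finset.mul_sum]
          refine Finset.sum_congr rfl fun m _ => ?_
          ring
      _ = ∑ l : ZMod p, ∑ m : ZMod p, (p : ℂ)⁻¹ * (f l * (starRingEnd ℂ) (f m)) *
            (if l = m then (p : ℂ) else 0) := by
          rw [Finset.sum_comm]
          refine Finset.sum_congr rfl fun l _ => ?_
          rw [Finset.sum_comm]
          refine Finset.sum_congr rfl fun m _ => ?_
          rw [← Finset.mul_sum, horth]
      _ = ∑ k, f k * (starRingEnd ℂ) (f k) := by
          refine Finset.sum_congr rfl fun l _ => ?_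
          simp only [mul_ite, mul_zero, Finset.sum_ite_eq, Finset.mem_univ, if_true]
          field_simp
  simp only [Complex.mul_conj, Complex.normSq_eq_norm_sq] at key
  exact_mod_cast key

/-- The Fourier transform as a linear endomorphism of `V`. -/
def fourierLinear : oddSpace p →ₗ[ℂ] oddSpace p where
  toFun f := ⟨WithLp.toLp 2 (fourierFun p fun k => f.1 k), fourierFun_odd p f.2⟩
  map_add' f g := by
    ext k
    simp [fourierFun, mul_add, Finset.sum_add_distrib]
  map_smul' c f := by
    ext k
    simp only [fourierFun, Finset.mul_sum, SetLike.val_smul, PiLp.smul_apply, smul_eq_mul,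
      RingHom.id_apply]
    refine Finset.sum_congr rfl fun l _ => ?_
    ring

lemma norm_fourierLinear (f : oddSpace p) : ‖fourierLinear p f‖ = ‖f‖ := by
  rw [← Submodule.norm_coe, ← Submodule.norm_coe, EuclideanSpace.norm_eq, EuclideanSpace.norm_eq]
  exact congrArg Real.sqrt (fourierFun_parseval p fun k => f.1 k)

/-- The Fourier transform as a unitary transformation `F` of `V`. -/
def fourierV : oddSpace p ≃ₗᵢ[ℂ] oddSpace p :=
  LinearIsometry.toLinearIsometryEquiv ⟨fourierLinear p, norm_fourierLinear p⟩ rfl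

lemma fourierV_apply (f : oddSpace p) (k : ZMod p) :
    (fourierV p f).1 k = ((Real.sqrt p : ℝ) : ℂ)⁻¹ *
      ∑ l : ZMod p, ZMod.stdAddChar (k * l) * f.1 l := rfl

variable {p}

/-- The Legendre character `χ₀`, an element of `V` when `p ≡ 3` modulo `4`. -/
def legendre (h : p % 4 = 3) : oddSpace p :=
  ⟨WithLp.toLp 2 fun k => (quadraticChar (ZMod p) k : ℂ), fun k => by
    have hp : ringChar (ZMod p) ≠ 2 := by
      rw [ZMod.ringChar_zmod_n]; omega
    have h1 : quadraticChar (ZMod p) (-1) = -1 := by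
      rw [quadraticChar_neg_one hp, ZMod.card]
      exact ZMod.χ₄_nat_three_mod_four h
    have h2 : quadraticChar (ZMod p) (-k) = - quadraticChar (ZMod p) k := by
      rw [← neg_one_mul, map_mul, h1, neg_one_mul]
    simp [h2]⟩

lemma legendre_ne_zero (h : p % 4 = 3) : legendre h ≠ 0 := fun h0 => by
  have : (legendre h).1 1 = (0 : oddSpace p).1 1 := by rw [h0]
  simp [legendre] at this

/-- A safe prime `p ≥ 7` is congruent to `3` modulo `4`. -/
lemma safe_mod_four (h7 : 7 ≤ p) (hsafe : ((p - 1) / 2).Prime) : p % 4 = 3 := by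
  have hp : p.Prime := Fact.out
  have h1 := hp.eq_two_or_odd
  have h2 := hsafe.eq_two_or_odd
  omega

/-- The point `[χ₀]` of `ℙ(V)`. -/
def legendrePoint (h : p % 4 = 3) : ℙ ℂ (oddSpace p) :=
  Projectivization.mk ℂ (legendre h) (legendre_ne_zero h)

end OddFun

end

open ProjGeom OddFun

set_option linter.unusedSectionVars false

/-! ## Deformations of the ideal of squares over a local ring -/


namespace SquareDeformation

open MvPolynomial IsLocalRing

variable {O : Type*} [CommRing O] [IsLocalRing O] {σ : Type*}

/-! Since `-1` is not a square modulo `p`, an odd function is the same thing as a function on the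
`n` nonzero squares. In these coordinates `χ₀` is the constant vector `1`, `T` is the set of lines
spanned by vectors with all moduli equal, and the Fourier transform is `ζ K` with `|ζ| = 1` and `K`
a real matrix with `K ^ 2 = 1` and `K 1 = 1` (`restrictCLE_fourierV`, `sum_sinMatrix`,
`sinMatrix_involutive`). Tangency follows: the tangent space of either torus at `[χ₀]` consists of
the vectors with constant real part, a condition which `K` preserves.

The Cayley transform parametrizes `T` near `[χ₀]` by `m = n - 1` real coordinates `x_k`, with `x =
0` at the distinguished index `o`. On `T` the equations of `F⁻¹ T` have no linear part, and their
quadratic parts are the differences `q_k` of the forms `(K x)_k ^ 2 - K (x ^ 2)_k` at `k` and at `o`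
(`isBigO_sq_sub_quad`). These are `m` quadrics in `m` variables, and the multiplicity is `2 ^ m` as
soon as they behave like the squares `X_i ^ 2`.

This is seen by reduction modulo two. Over a valuation ring `O` of `ℂ` in which `2` is not a unit,
the entries of `K` are integral, and modulo the maximal ideal the `q_k` become linear combinations
of the `X_l ^ 2`, with matrix `residualMatrix`. Squaring an entry of `K` amounts modulo two to
multiplying its index by `±2`; a vector in the residual kernel is therefore invariant under
multiplication by the one of `2`, `-2` which is a square. As `n` is prime, that element generates
the group of squares, and the vector vanishes (`isUnit_det_residualMatrix`). Thus the `q_k` generate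
over `O` a deformation of the ideal of squares, for which the square-free monomials remain a basis
of the quotient by Nakayama's lemma. A rescaling of the variables takes care of terms of higher
order (`finrank_quotient_eq`) and of constants (`card_fibre_le`). The passage from quadrics to the
local ring of analytic germs is `LocalMultiplicity.rank_quotient_eq`.

For (b), `F` is composed with a rank one unitary Cayley transform of parameter `τ = σ ^ 2`. Putting
`x = σ η` and dividing by `σ ^ 2`, the equations tend to `q(η) = c` when `σ → 0`, where `c` can be
prescribed. By Sard's lemma `c` and `-c` may be taken regular. The real points over `c` and `i`
times the real points over `-c` lie in the same complex fibre, of at most `2 ^ m` points, so one of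
`±c` has at most `2 ^ (m - 1)` real preimages (`exists_regular_value`). Regular zeros persist for
small `σ`, and the estimate `‖q(x)‖ ≥ μ ‖x‖ ^ 2` keeps all solutions `η` near the origin in a fixed
ball (`exists_bound`, `exists_perturbation`). -/

lemma maximalIdeal_le_jacobson_bot : maximalIdeal O ≤ Ideal.jacobson ⊥ :=
  (IsLocalRing.jacobson_eq_maximalIdeal ⊥ bot_ne_top).ge

lemma apply_mem_of_forall_monomial {M : Type*} [AddCommGroup M] [Module O M]
    (φ : MvPolynomial σ O →ₗ[O] M) (N : Submodule O M) (g : MvPolynomial σ O)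
    (h : ∀ δ ∈ g.support, φ (monomial δ 1) ∈ N) : φ g ∈ N := by
  rw [g.as_sum, map_sum]
  refine Submodule.sum_mem _ fun δ hδ => ?_
  have : monomial δ (coeff δ g) = coeff δ g • monomial δ (1 : O) := by simp [smul_monomial]
  rw [this, map_smul]
  exact N.smul_mem _ (h δ hδ)

/-- All coefficients of `g` lie in the maximal ideal; this is the source of the factor `maximalIdeal
O` in each use of Nakayama's lemma below. -/
lemma apply_mem_of_map_residue_eq_zero {M : Type*} [AddCommGroup M] [Module O M]
    (φ : MvPolynomial σ O →ₗ[O] M) (N Z : Submodule O M) (g : MvPolynomial σ O)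
    (hg : map (residue O) g = 0) (h : ∀ δ ∈ g.support, φ (monomial δ 1) ∈ N ⊔ Z) :
    φ g ∈ N ⊔ maximalIdeal O • Z := by
  rw [g.as_sum, map_sum]
  refine Submodule.sum_mem _ fun δ hδ => ?_
  have : monomial δ (coeff δ g) = coeff δ g • monomial δ (1 : O) := by simp [smul_monomial]
  rw [this, map_smul]
  obtain ⟨x, hx, z, hz, e⟩ := Submodule.mem_sup.1 (h δ hδ)
  have hc : coeff δ g ∈ maximalIdeal O := by
    rw [← residue_eq_zero_iff, ← coeff_map, hg, coeff_zero]
  rw [← e, smul_add]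
  exact Submodule.add_mem_sup (N.smul_mem _ hx) (Submodule.smul_mem_smul hc hz)

/-- The exponents of square-free monomials. -/
def SqFree (α : σ →₀ ℕ) : Prop := ∀ i, α i ≤ 1

lemma not_sqFree_iff {α : σ →₀ ℕ} : ¬ SqFree α ↔ ∃ i, 2 ≤ α i := by
  simp only [SqFree, not_forall, not_le]; rfl

lemma SqFree.degree_le [Fintype σ] {α : σ →₀ ℕ} (h : SqFree α) :
    α.degree ≤ Fintype.card σ := by
  rw [Finsupp.degree_eq_sum]
  calc ∑ i, α i ≤ ∑ _i : σ, 1 := Finset.sum_le_sum fun i _ => h i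
    _ = _ := by simp

variable [LinearOrder σ] [Finite σ]

lemma exists_least (α : σ →₀ ℕ) (h : ¬ SqFree α) : ∃ i, 2 ≤ α i ∧ ∀ j < i, α j ≤ 1 := by
  obtain ⟨i, hi, hm⟩ := WellFounded.has_min (wellFounded_lt (α := σ)) {i | 2 ≤ α i}
    (not_sqFree_iff.1 h)
  refine ⟨i, hi, fun j hj => ?_⟩
  by_contra hc
  exact hm j (by simp only [Set.mem_ofPred_eq]; omega) hj

open Classical in
/-- The polynomial with leading monomial `X ^ α` in the family formed by the square-free monomials
and by multiples of the `Φ i`. -/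
noncomputable def leadPoly (Φ : σ → MvPolynomial σ O) (α : σ →₀ ℕ) : MvPolynomial σ O :=
  if h : SqFree α then monomial α 1 else
    monomial (α - Finsupp.single (exists_least α h).choose 2) 1 * Φ (exists_least α h).choose

lemma leadPoly_of_sqFree (Φ : σ → MvPolynomial σ O) {α : σ →₀ ℕ} (h : SqFree α) :
    leadPoly Φ α = monomial α 1 := by simp [leadPoly, h]

lemma leadPoly_of_not (Φ : σ → MvPolynomial σ O) {α : σ →₀ ℕ} (h : ¬ SqFree α) :
    ∃ i, 2 ≤ α i ∧ leadPoly Φ α = monomial (α - Finsupp.single i 2) 1 * Φ i :=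
  ⟨_, (exists_least α h).choose_spec.1, by simp [leadPoly, h]⟩

/-- The condition on `β` makes `i` the least index with exponent at least two in the sum, hence the
index selected by `leadPoly`. These are the products which need no rewriting. -/
lemma leadPoly_add_single (Φ : σ → MvPolynomial σ O) (β : σ →₀ ℕ) (i : σ)
    (h : ∀ j < i, β j ≤ 1) :
    ¬ SqFree (β + Finsupp.single i 2) ∧
      leadPoly Φ (β + Finsupp.single i 2) = monomial β 1 * Φ i := by
  have hn : ¬ SqFree (β + Finsupp.single i 2) := not_sqFree_iff.2 ⟨i, by simp⟩
  refine ⟨hn, ?_⟩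
  obtain ⟨h1, h2⟩ := (exists_least _ hn).choose_spec
  have hi : (exists_least _ hn).choose = i := by
    rcases lt_trichotomy (exists_least _ hn).choose i with hlt | he | hgt
    · have := h _ hlt
      rw [Finsupp.add_apply, Finsupp.single_apply, if_neg hlt.ne'] at h1
      omega
    · exact he
    · have := h2 i hgt
      simp at this
  rw [leadPoly, dif_neg hn, hi, add_tsub_cancel_right]

lemma monomial_sub_single_mul_sq {R : Type*} [CommRing R] {α : σ →₀ ℕ} {i : σ} (h : 2 ≤ α i) :
    (monomial (α - Finsupp.single i 2) 1 * X i ^ 2 : MvPolynomial σ R) = monomial α 1 := by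
  rw [X_pow_eq_monomial, monomial_mul, mul_one, tsub_add_cancel_of_le]
  simpa using h

/-- The family `leadPoly Φ` reduces to the monomial basis; generation and independence are lifted
from this fact by Nakayama's lemma. -/
lemma map_residue_leadPoly {Φ : σ → MvPolynomial σ O} (hΦ : ∀ i, map (residue O) (Φ i) = X i ^ 2)
    (α : σ →₀ ℕ) : map (residue O) (leadPoly Φ α) = monomial α 1 := by
  by_cases h : SqFree α
  · simp [leadPoly_of_sqFree Φ h]
  · obtain ⟨i, hi, e⟩ := leadPoly_of_not Φ h
    rw [e, map_mul, hΦ, map_monomial, map_one, monomial_sub_single_mul_sq hi]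

lemma degree_sub_single {α : σ →₀ ℕ} {i : σ} (h : 2 ≤ α i) :
    (α - Finsupp.single i 2).degree + 2 = α.degree := by
  have : α - Finsupp.single i 2 + Finsupp.single i 2 = α := by
    apply tsub_add_cancel_of_le; simpa using h
  conv_rhs => rw [← this]
  simp

lemma monomial_mem_pow {N : ℕ} {α : σ →₀ ℕ} (h : N ≤ α.degree) (c : O) :
    monomial α c ∈ idealOfVars σ O ^ N := by
  classical
  rw [mem_pow_idealOfVars_iff']
  intro x hx
  rw [coeff_monomial, if_neg]
  rintro rfl
  omega

lemma leadPoly_mem_pow {Φ : σ → MvPolynomial σ O} (hΦ2 : ∀ i, Φ i ∈ idealOfVars σ O ^ 2)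
    {α : σ →₀ ℕ} {N : ℕ} (hN : N ≤ α.degree) : leadPoly Φ α ∈ idealOfVars σ O ^ N := by
  by_cases h : SqFree α
  · rw [leadPoly_of_sqFree Φ h]; exact monomial_mem_pow hN 1
  · obtain ⟨i, hi, e⟩ := leadPoly_of_not Φ h
    rw [e]
    have := Ideal.mul_mem_mul (monomial_mem_pow (σ := σ) (O := O) le_rfl 1
      (α := α - Finsupp.single i 2)) (hΦ2 i)
    rw [← pow_add, degree_sub_single hi] at this
    exact Ideal.pow_le_pow_right hN this

lemma finite_degree_lt (N : ℕ) : {α : σ →₀ ℕ | α.degree < N}.Finite := by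
  have := Fintype.ofFinite σ
  have h : Set.Finite {f : σ → ℕ | ∀ i, f i < N} := by
    have := Set.Finite.pi (t := fun _ : σ => {k : ℕ | k < N}) fun _ => Set.finite_lt_nat N
    simpa [Set.pi] using this
  refine (h.preimage (f := fun α : σ →₀ ℕ => (α : σ → ℕ)) DFunLike.coe_injective.injOn).subset ?_
  intro α hα i
  exact lt_of_le_of_lt (Finsupp.le_degree i α) hα

/-- The ideal is spanned over `O` by the products `X ^ β * Φ i`. Those which are not lead
polynomials are rewritten with the Koszul relation between `Φ i` and some `Φ j`, `j < i`, up to an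
error with coefficients in the maximal ideal. -/
lemma ideal_le_span_leadPoly {Φ : σ → MvPolynomial σ O}
    (hΦ : ∀ i, map (residue O) (Φ i) = X i ^ 2) (N : ℕ) :
    (Ideal.span (Set.range Φ) ⊔ idealOfVars σ O ^ N).restrictScalars O ≤
      Submodule.span O (leadPoly Φ '' {α | ¬ SqFree α}) ⊔
        (idealOfVars σ O ^ N).restrictScalars O := by
  set 𝔫 := (idealOfVars σ O ^ N).restrictScalars O with h𝔫
  set L := Submodule.span O (leadPoly Φ '' {α | ¬ SqFree α}) with hL
  -- Only finitely many products are kept, so that Nakayama's lemma applies to `Z`; the others lie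
  -- in `𝔫`.
  set Z := Submodule.span O ((fun x : (σ →₀ ℕ) × σ => monomial x.1 (1 : O) * Φ x.2) ''
    {x | x.1.degree < N}) with hZ
  have hfin : {x : (σ →₀ ℕ) × σ | x.1.degree < N}.Finite := by
    have := (finite_degree_lt (σ := σ) N).prod (Set.finite_univ (α := σ))
    refine this.subset fun x hx => ⟨hx, trivial⟩
  have hZfg : Z.FG := Submodule.fg_span (hfin.image _)
  have hmem : ∀ (β : σ →₀ ℕ) (i : σ), monomial β (1 : O) * Φ i ∈ 𝔫 ⊔ Z := fun β i => by
    by_cases h : β.degree < N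
    · exact Submodule.mem_sup_right (Submodule.subset_span ⟨(β, i), h, rfl⟩)
    · exact Submodule.mem_sup_left (Ideal.mul_mem_right _ _ (monomial_mem_pow (not_lt.1 h) 1))
  have key : ∀ (i : σ) (β : σ →₀ ℕ),
      monomial β (1 : O) * Φ i ∈ (L ⊔ 𝔫) ⊔ maximalIdeal O • Z := fun i => by
    induction i using WellFoundedLT.induction with
    | ind i ih =>
    intro β
    by_cases h : ∀ j < i, β j ≤ 1
    · obtain ⟨h1, h2⟩ := leadPoly_add_single Φ β i h
      rw [← h2]
      exact Submodule.mem_sup_left (Submodule.mem_sup_left (Submodule.subset_span ⟨_, h1, rfl⟩))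
    · push Not at h
      obtain ⟨j, hji, hj⟩ := h
      set γ := β - Finsupp.single j 2 with hγ
      have e : monomial β (1 : O) = monomial γ 1 * X j ^ 2 :=
        (monomial_sub_single_mul_sq hj).symm
      -- Koszul relation: the first term only involves `Φ j` with `j < i`, which is covered by
      -- induction, and `Φ j - X j ^ 2` is zero in the residue field.
      have e2 : monomial β (1 : O) * Φ i = Φ i * (monomial γ 1 * Φ j) -
          (Φ j - X j ^ 2) * (monomial γ 1 * Φ i) := by rw [e]; ring
      rw [e2]
      refine Submodule.sub_mem _ ?_ ?_
      · refine apply_mem_of_forall_monomial (LinearMap.mulRight O (monomial γ 1 * Φ j)) _ (Φ i)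
          fun δ _ => ?_
        rw [LinearMap.mulRight_apply, ← mul_assoc, monomial_mul, one_mul]
        exact ih j hji _
      · have := apply_mem_of_map_residue_eq_zero (LinearMap.mulRight O (monomial γ 1 * Φ i))
          𝔫 Z (Φ j - X j ^ 2) (by simp [hΦ]) fun δ _ => by
            rw [LinearMap.mulRight_apply, ← mul_assoc, monomial_mul, one_mul]
            exact hmem _ _
        exact (sup_le_sup_right le_sup_right (maximalIdeal O • Z) :
          𝔫 ⊔ maximalIdeal O • Z ≤ (L ⊔ 𝔫) ⊔ maximalIdeal O • Z) this
  have hZL : Z ≤ L ⊔ 𝔫 := by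
    refine Submodule.le_of_le_smul_of_le_jacobson_bot hZfg maximalIdeal_le_jacobson_bot ?_
    rw [hZ, Submodule.span_le]
    rintro _ ⟨x, _, rfl⟩
    exact key _ _
  have hIZ : (Ideal.span (Set.range Φ)).restrictScalars O ≤ 𝔫 ⊔ Z := by
    intro x hx
    refine Submodule.span_induction (p := fun x _ => x ∈ 𝔫 ⊔ Z) ?_ (Submodule.zero_mem _)
      (fun _ _ _ _ => Submodule.add_mem _) ?_ (show x ∈ Ideal.span (Set.range Φ) from hx)
    · rintro _ ⟨i, rfl⟩
      simpa using hmem 0 i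
    · intro a x _ hx
      rw [smul_eq_mul, mul_comm]
      refine apply_mem_of_forall_monomial (LinearMap.mulLeft O x) _ a fun δ _ => ?_
      rw [LinearMap.mulLeft_apply]
      obtain ⟨y, hy, z, hz, rfl⟩ := Submodule.mem_sup.1 hx
      rw [add_mul]
      refine Submodule.add_mem _ (Submodule.mem_sup_left (Ideal.mul_mem_right _ _ hy)) ?_
      refine Submodule.span_induction (p := fun z _ => z * monomial δ (1 : O) ∈ 𝔫 ⊔ Z) ?_
        (by simp) (fun _ _ _ _ h1 h2 => ?_) (fun c x _ h => ?_) hz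
      · rintro _ ⟨x, _, rfl⟩
        dsimp only
        rw [mul_right_comm, monomial_mul, one_mul]
        exact hmem _ _
      · rw [add_mul]; exact Submodule.add_mem _ h1 h2
      · rw [smul_mul_assoc]; exact Submodule.smul_mem _ _ h
  rw [show (Ideal.span (Set.range Φ) ⊔ idealOfVars σ O ^ N).restrictScalars O =
    (Ideal.span (Set.range Φ)).restrictScalars O ⊔ 𝔫 from Submodule.restrictScalars_sup ..]
  exact sup_le (hIZ.trans (sup_le le_sup_right hZL)) le_sup_right

/-- In degrees less than `N`, the matrix of the lead polynomials in the monomial basis is the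
identity modulo the maximal ideal, so that the ideal `𝔞` of the low degree coefficients of a
relation satisfies `𝔞 ≤ 𝔪 𝔞` and vanishes. The hypothesis `hΦ2` ensures that the exponents of degree
at least `N` do not interfere. -/
lemma coeff_eq_zero_of_linearCombination_mem {Φ : σ → MvPolynomial σ O}
    (hΦ : ∀ i, map (residue O) (Φ i) = X i ^ 2) (hΦ2 : ∀ i, Φ i ∈ idealOfVars σ O ^ 2) (N : ℕ)
    (l : (σ →₀ ℕ) →₀ O) (hl : Finsupp.linearCombination O (leadPoly Φ) l ∈ idealOfVars σ O ^ N)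
    (α : σ →₀ ℕ) (hα : α.degree < N) : l α = 0 := by
  classical
  set 𝔞 : Ideal O := Ideal.span (l '' {α | α.degree < N}) with h𝔞
  have hfg : 𝔞.FG := Submodule.fg_span ((finite_degree_lt N).image _)
  have hmem : ∀ β : σ →₀ ℕ, β.degree < N → l β ∈ 𝔞 := fun β hβ =>
    Ideal.subset_span ⟨β, hβ, rfl⟩
  have hle : 𝔞 ≤ maximalIdeal O • 𝔞 := by
    rw [h𝔞, Ideal.span_le, ← h𝔞]
    rintro _ ⟨α, hα, rfl⟩
    have h0 := (mem_pow_idealOfVars_iff' N _).1 hl α hα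
    rw [Finsupp.linearCombination_apply, Finsupp.sum, coeff_sum] at h0
    have h1 : l α = -∑ β ∈ l.support, l β * (coeff α (leadPoly Φ β) - coeff α (monomial β 1)) := by
      simp only [mul_sub, Finset.sum_sub_distrib]
      simp only [coeff_smul, smul_eq_mul] at h0
      rw [h0, zero_sub, neg_neg]
      simp only [coeff_monomial, mul_ite, mul_one, mul_zero]
      rw [Finset.sum_ite_eq']
      split_ifs with h
      · rfl
      · simpa using h
    rw [SetLike.mem_coe, h1]
    refine Submodule.neg_mem _ (Submodule.sum_mem _ fun β _ => ?_)
    rcases lt_or_ge β.degree N with hβ | hβ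
    · rw [mul_comm]
      refine Submodule.smul_mem_smul ?_ (hmem β hβ)
      rw [← residue_eq_zero_iff, ← coeff_sub, ← coeff_map, map_sub, map_residue_leadPoly hΦ]
      simp
    · have h2 : coeff α (leadPoly Φ β) = 0 :=
        (mem_pow_idealOfVars_iff' N _).1 (leadPoly_mem_pow hΦ2 hβ) α hα
      have h3 : coeff α (monomial β (1 : O)) = 0 := by
        rw [coeff_monomial, if_neg]; rintro rfl; exact absurd hα (not_lt.2 hβ)
      rw [h2, h3, sub_zero, mul_zero]
      exact Submodule.zero_mem _
  have h0 : 𝔞 = ⊥ := Submodule.eq_bot_of_le_smul_of_le_jacobson_bot _ 𝔞 hfg hle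
    maximalIdeal_le_jacobson_bot
  have := hmem α hα
  rw [h0] at this
  simpa using this

/-- No nontrivial combination of square-free monomials lies in the deformed ideal. -/
lemma eq_zero_of_mem_ideal {Φ : σ → MvPolynomial σ O}
    (hΦ : ∀ i, map (residue O) (Φ i) = X i ^ 2) (hΦ2 : ∀ i, Φ i ∈ idealOfVars σ O ^ 2) {N : ℕ}
    (hN : Nat.card σ < N) (p : MvPolynomial σ O) (hp : ∀ α ∈ p.support, SqFree α)
    (hI : p ∈ Ideal.span (Set.range Φ) ⊔ idealOfVars σ O ^ N) : p = 0 := by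
  have := Fintype.ofFinite σ
  obtain ⟨x, hx, y, hy, e⟩ := Submodule.mem_sup.1 (ideal_le_span_leadPoly hΦ N
    (show p ∈ Submodule.restrictScalars O _ from hI))
  obtain ⟨l, hl, rfl⟩ := (Finsupp.mem_span_image_iff_linearCombination O).1 hx
  rw [Finsupp.mem_supported] at hl
  let l' : (σ →₀ ℕ) →₀ O := Finsupp.ofSupportFinite (fun α => coeff α p)
    (p.support.finite_toSet.subset fun α hα => by simpa using hα)
  have hla : ∀ α, l' α = coeff α p := fun _ => rfl
  have hl' : Finsupp.linearCombination O (leadPoly Φ) l' = p := by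
    have hs : l'.support ⊆ p.support := fun α hα => by
      rw [mem_support_iff, ← hla]; exact Finsupp.mem_support_iff.1 hα
    rw [Finsupp.linearCombination_apply, Finsupp.sum_of_support_subset _ hs _ (by simp)]
    conv_rhs => rw [p.as_sum]
    refine Finset.sum_congr rfl fun α hα => ?_
    rw [leadPoly_of_sqFree Φ (hp α hα), smul_monomial, hla, smul_eq_mul, mul_one]
  -- Two expressions of `p`, one on square-free exponents and one on the others, agree to order `N`.
  -- Square-free exponents have degree at most `card σ < N`, so their coefficients are all seen by
  -- the preceding lemma.
  have hmem : Finsupp.linearCombination O (leadPoly Φ) (l' - l) ∈ idealOfVars σ O ^ N := by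
    rw [map_sub, hl', ← e, add_sub_cancel_left]; exact hy
  ext α
  rw [coeff_zero]
  by_contra hne
  have hα : SqFree α := hp α (mem_support_iff.2 hne)
  have h0 := coeff_eq_zero_of_linearCombination_mem hΦ hΦ2 N _ hmem α
    (hα.degree_le.trans_lt (by simpa using hN))
  have h1 : l α = 0 := by
    by_contra h
    exact hl (Finsupp.mem_support_iff.2 h) hα
  rw [Finsupp.sub_apply, h1, sub_zero] at h0
  exact hne h0

/-- The square-free monomials span modulo a deformed ideal (Nakayama). -/
lemma monomial_mem_of_finite {Φ : σ → MvPolynomial σ O}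
    (hΦ : ∀ i, map (residue O) (Φ i) = X i ^ 2) (D : Set (σ →₀ ℕ)) (hD : D.Finite)
    (N : Submodule O (MvPolynomial σ O)) (hN : ∀ α ∈ D, leadPoly Φ α ∈ N)
    (hs : ∀ α ∈ D, ∀ δ ∈ (leadPoly Φ α - monomial α 1).support, δ ∈ D ∨ monomial δ 1 ∈ N) :
    ∀ α ∈ D, monomial α (1 : O) ∈ N := by
  set Z := Submodule.span O ((fun α => monomial α (1 : O)) '' D) with hZ
  suffices h : Z ≤ N from fun α hα => h (Submodule.subset_span ⟨α, hα, rfl⟩)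
  refine Submodule.le_of_le_smul_of_le_jacobson_bot (Submodule.fg_span (hD.image _))
    maximalIdeal_le_jacobson_bot ?_
  rw [hZ, Submodule.span_le, ← hZ]
  rintro _ ⟨α, hα, rfl⟩
  have e : monomial α (1 : O) = leadPoly Φ α - (leadPoly Φ α - monomial α 1) := by ring
  simp only [SetLike.mem_coe]
  rw [e]
  refine Submodule.sub_mem _ (Submodule.mem_sup_left (hN α hα)) ?_
  refine apply_mem_of_map_residue_eq_zero LinearMap.id N Z _ ?_ fun δ hδ => ?_
  · change map (residue O) (leadPoly Φ α - monomial α 1) = 0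
    rw [map_sub, map_residue_leadPoly hΦ]; simp
  · rcases hs α hα δ hδ with h | h
    · exact Submodule.mem_sup_right (Submodule.subset_span ⟨δ, h, rfl⟩)
    · exact Submodule.mem_sup_left h

/-- The span of the square-free monomials. -/
noncomputable def sqFreeSpan (σ R : Type*) [CommRing R] : Submodule R (MvPolynomial σ R) :=
  Submodule.span R ((fun α => monomial α (1 : R)) '' {α | SqFree α})

lemma leadPoly_mem_sup (Φ : σ → MvPolynomial σ O) (α : σ →₀ ℕ) :
    leadPoly Φ α ∈ sqFreeSpan σ O ⊔ (Ideal.span (Set.range Φ)).restrictScalars O := by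
  by_cases h : SqFree α
  · rw [leadPoly_of_sqFree Φ h]
    exact Submodule.mem_sup_left (Submodule.subset_span ⟨α, h, rfl⟩)
  · obtain ⟨i, _, e⟩ := leadPoly_of_not Φ h
    rw [e]
    exact Submodule.mem_sup_right (Ideal.mul_mem_left _ _ (Ideal.subset_span ⟨i, rfl⟩))

/-- Nakayama's lemma on the monomials of degree less than `N`, the others being in the ideal by
truncation. -/
lemma monomial_mem_truncated {Φ : σ → MvPolynomial σ O}
    (hΦ : ∀ i, map (residue O) (Φ i) = X i ^ 2) (N : ℕ) (α : σ →₀ ℕ) :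
    monomial α (1 : O) ∈ sqFreeSpan σ O ⊔
      (Ideal.span (Set.range Φ) ⊔ idealOfVars σ O ^ N).restrictScalars O := by
  by_cases hα : α.degree < N
  · refine monomial_mem_of_finite hΦ _ (finite_degree_lt N) _ (fun α _ => ?_)
      (fun α _ δ _ => ?_) α hα
    · have hle : (Ideal.span (Set.range Φ)).restrictScalars O ≤
          (Ideal.span (Set.range Φ) ⊔ idealOfVars σ O ^ N).restrictScalars O := fun x hx =>
        Submodule.mem_sup_left (show x ∈ Ideal.span (Set.range Φ) from hx)
      exact (sup_le_sup_left hle (sqFreeSpan σ O)) (leadPoly_mem_sup Φ α)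
    · rcases lt_or_ge δ.degree N with h | h
      · exact Or.inl h
      · exact Or.inr (Submodule.mem_sup_right (Submodule.mem_sup_right (monomial_mem_pow h 1)))
  · exact Submodule.mem_sup_right (Submodule.mem_sup_right (monomial_mem_pow (not_lt.1 hα) 1))

/-- No truncation is needed here: since the `Φ i` have degree at most two, replacing a monomial by
its lead polynomial does not raise the degree, and the finite set of monomials of bounded degree is
stable. -/
lemma monomial_mem_of_totalDegree_le {Φ : σ → MvPolynomial σ O}
    (hΦ : ∀ i, map (residue O) (Φ i) = X i ^ 2) (hd : ∀ i, (Φ i).totalDegree ≤ 2)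
    (α : σ →₀ ℕ) :
    monomial α (1 : O) ∈ sqFreeSpan σ O ⊔ (Ideal.span (Set.range Φ)).restrictScalars O := by
  refine monomial_mem_of_finite hΦ _ (finite_degree_lt (α.degree + 1)) _
    (fun β _ => leadPoly_mem_sup Φ β) (fun β hβ δ hδ => Or.inl ?_) α (Nat.lt_succ_self _)
  have h1 : (monomial β (1 : O)).totalDegree ≤ β.degree := totalDegree_monomial_le _ _
  have h2 : (leadPoly Φ β).totalDegree ≤ β.degree := by
    by_cases h : SqFree β
    · rw [leadPoly_of_sqFree Φ h]; exact h1
    · obtain ⟨i, hi, e⟩ := leadPoly_of_not Φ h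
      rw [e, ← degree_sub_single hi]
      exact (totalDegree_mul _ _).trans (add_le_add (totalDegree_monomial_le _ _) (hd i))
  have h3 : δ.degree ≤ (leadPoly Φ β - monomial β 1).totalDegree := le_totalDegree hδ
  have h4 := totalDegree_sub (leadPoly Φ β) (monomial β 1)
  simp only [Set.mem_ofPred_eq] at hβ ⊢
  have := max_le h2 h1
  omega

end SquareDeformation

/-! ### Dimensions and Bézout bounds over the fraction field -/

namespace SquareDeformation

open MvPolynomial IsLocalRing

section Field

variable {σ k : Type*} [Field k]

lemma mem_sqFreeSpan_iff {R : Type*} [CommRing R] {p : MvPolynomial σ R} :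
    p ∈ sqFreeSpan σ R ↔ ∀ α ∈ p.support, SqFree α := by
  have h : sqFreeSpan σ R = restrictSupport R {α | SqFree α} := by
    rw [sqFreeSpan, restrictSupport_eq_span]
  rw [h, mem_restrictSupport_iff]
  exact Iff.rfl

/-- Square-free exponents are indicator functions. -/
noncomputable def sqFreeEquiv [Finite σ] : {α : σ →₀ ℕ // SqFree α} ≃ (σ → Fin 2) where
  toFun α i := ⟨α.1 i, Nat.lt_succ_of_le (α.2 i)⟩
  invFun f := ⟨Finsupp.equivFunOnFinite.symm fun i => (f i : ℕ), fun i => Nat.le_of_lt_succ (f i).2⟩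
  left_inv α := by ext i; simp
  right_inv f := by ext i; simp

lemma finrank_sqFreeSpan [Finite σ] :
    Module.finrank k (sqFreeSpan σ k) = 2 ^ Nat.card σ := by
  have : Finite {α : σ →₀ ℕ // SqFree α} := Finite.of_equiv _ (sqFreeEquiv (σ := σ)).symm
  have := Fintype.ofFinite {α : σ →₀ ℕ // SqFree α}
  have hli : LinearIndependent k (fun α : {α : σ →₀ ℕ // SqFree α} => monomial α.1 (1 : k)) := by
    have := (basisMonomials σ k).linearIndependent.comp
      (fun α : {α : σ →₀ ℕ // SqFree α} => α.1) Subtype.val_injective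
    simpa [Function.comp_def] using this
  have h := finrank_span_eq_card hli
  have hr : Set.range (fun α : {α : σ →₀ ℕ // SqFree α} => monomial α.1 (1 : k)) =
      (fun α => monomial α (1 : k)) '' {α | SqFree α} := by
    ext x; simp [Set.mem_image]
  rw [hr] at h
  rw [sqFreeSpan, h, ← Nat.card_eq_fintype_card, Nat.card_congr sqFreeEquiv, Nat.card_fun]
  simp

instance [Finite σ] : FiniteDimensional k (sqFreeSpan σ k) :=
  Module.finite_of_finrank_pos (by rw [finrank_sqFreeSpan]; positivity)

/-- Evaluation on `Z` is surjective by interpolation and kills `I`, so it is already surjective on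
the span of the square-free monomials. -/
lemma card_le_of_sqFreeSpan_sup_eq_top [Finite σ] (I : Ideal (MvPolynomial σ k))
    (h : sqFreeSpan σ k ⊔ I.restrictScalars k = ⊤) (Z : Finset (σ → k))
    (hZ : ∀ z ∈ Z, ∀ p ∈ I, eval z p = 0) : Z.card ≤ 2 ^ Nat.card σ := by
  classical
  let ev : MvPolynomial σ k →ₗ[k] (Z → k) := LinearMap.pi fun z => (aeval z.1).toLinearMap
  have hev : ∀ p (z : Z), ev p z = eval z.1 p := fun p z => by simp [ev, aeval_eq_eval]
  have hsep : ∀ z z' : σ → k, ∃ p : MvPolynomial σ k, z' ≠ z →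
      eval z p ≠ 0 ∧ eval z' p = 0 := fun z z' => by
    by_cases h : z' = z
    · exact ⟨0, fun h' => absurd h h'⟩
    · obtain ⟨i, hi⟩ := Function.ne_iff.1 h
      exact ⟨X i - C (z' i), fun _ => ⟨by simpa [sub_eq_zero] using hi.symm, by simp⟩⟩
  choose p hp using hsep
  let P : (σ → k) → MvPolynomial σ k := fun z => ∏ z' ∈ Z.erase z, p z z'
  have hP1 : ∀ z, eval z (P z) ≠ 0 := fun z => by
    rw [map_prod, Finset.prod_ne_zero_iff]
    exact fun z' hz' => (hp z z' (Finset.ne_of_mem_erase hz')).1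
  have hP2 : ∀ z, ∀ z' ∈ Z, z' ≠ z → eval z' (P z) = 0 := fun z z' hz' hne => by
    rw [map_prod]
    exact Finset.prod_eq_zero (Finset.mem_erase.2 ⟨hne, hz'⟩) (hp z z' hne).2
  have hsurj : Function.Surjective ev := fun f => by
    refine ⟨∑ z : Z, C (f z / eval z.1 (P z.1)) * P z.1, ?_⟩
    funext z
    rw [hev, map_sum, Finset.sum_eq_single z]
    · simp [hP1 z.1]
    · intro z' _ hne
      rw [map_mul, hP2 z'.1 z.1 z.2 (fun h => hne (Subtype.ext h.symm)), mul_zero]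
    · simp
  have hW : (sqFreeSpan σ k).map ev = ⊤ := by
    rw [eq_top_iff, ← LinearMap.range_eq_top.2 hsurj, LinearMap.range_eq_map, ← h,
      Submodule.map_sup, sup_le_iff]
    refine ⟨le_rfl, ?_⟩
    rintro _ ⟨q, hq, rfl⟩
    have : ev q = 0 := funext fun z => by rw [hev]; exact hZ z.1 z.2 q hq
    rw [this]
    exact Submodule.zero_mem _
  calc Z.card = Module.finrank k (Z → k) := by simp
    _ = Module.finrank k ((sqFreeSpan σ k).map ev) := by rw [hW, finrank_top]
    _ ≤ Module.finrank k (sqFreeSpan σ k) := Submodule.finrank_map_le _ _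
    _ = _ := finrank_sqFreeSpan

/-- The rescaling `X i ↦ ε X i`. -/
noncomputable def rescale (ε : kˣ) : MvPolynomial σ k ≃ₐ[k] MvPolynomial σ k :=
  AlgEquiv.ofAlgHom (aeval fun i => C (ε : k) * X i) (aeval fun i => C (↑ε⁻¹ : k) * X i)
    (by ext i : 1; simp [← mul_assoc, ← C_mul]) (by ext i : 1; simp [← mul_assoc, ← C_mul])

lemma rescale_X (ε : kˣ) (i : σ) : rescale ε (X i : MvPolynomial σ k) = C (ε : k) * X i := by
  simp [rescale]

lemma rescale_monomial (ε : kˣ) (α : σ →₀ ℕ) (c : k) :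
    rescale ε (monomial α c) = monomial α ((ε : k) ^ α.degree * c) := by
  change aeval (fun i => C (ε : k) * X i) (monomial α c) = _
  rw [aeval_monomial, algebraMap_eq, mul_comm, monomial_eq (s := α), mul_comm _ c, C_mul, mul_assoc,
    mul_comm]
  congr 1
  simp only [mul_pow, Finsupp.prod, Finset.prod_mul_distrib, ← C_pow, ← map_prod,
    Finset.prod_pow_eq_pow_sum]
  rfl

lemma coeff_rescale (ε : kˣ) (p : MvPolynomial σ k) (α : σ →₀ ℕ) :
    coeff α (rescale ε p) = (ε : k) ^ α.degree * coeff α p := by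
  classical
  induction p using MvPolynomial.induction_on' with
  | monomial β c =>
    rw [rescale_monomial, coeff_monomial, coeff_monomial]
    split_ifs with h
    · rw [h]
    · simp
  | add p q hp hq => rw [map_add, coeff_add, hp, hq, coeff_add, mul_add]

lemma eval_rescale (ε : kˣ) (p : MvPolynomial σ k) (w : σ → k) :
    eval w (rescale ε p) = eval ((ε : k) • w) p := by
  induction p using MvPolynomial.induction_on with
  | C a => rw [← algebraMap_eq, AlgEquiv.commutes]; simp
  | add p q hp hq => simp only [map_add, hp, hq]
  | mul_X p i hp => rw [map_mul, map_mul, hp, rescale_X]; simp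

lemma rescale_of_isHomogeneous (ε : kˣ) {p : MvPolynomial σ k} {d : ℕ} (hp : p.IsHomogeneous d) :
    rescale ε p = C ((ε : k) ^ d) * p := by
  ext α
  rw [coeff_rescale, coeff_C_mul]
  by_cases h : α.degree = d
  · rw [h]
  · rw [hp.coeff_eq_zero h, mul_zero, mul_zero]

lemma map_rescale_pow (ε : kˣ) (N : ℕ) :
    (idealOfVars σ k ^ N).map (rescale ε) = idealOfVars σ k ^ N := by
  have hle : ∀ ε : kˣ, (idealOfVars σ k ^ N).map (rescale ε) ≤ idealOfVars σ k ^ N := fun ε => by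
    rw [Ideal.map_le_iff_le_comap]
    intro p hp
    rw [Ideal.mem_comap, mem_pow_idealOfVars_iff']
    intro x hx
    rw [coeff_rescale, (mem_pow_idealOfVars_iff' N p).1 hp x hx, mul_zero]
  refine le_antisymm (hle ε) fun p hp => ?_
  have h1 : rescale ε⁻¹ p ∈ idealOfVars σ k ^ N :=
    hle ε⁻¹ (Ideal.mem_map_of_mem _ hp)
  have h2 := Ideal.mem_map_of_mem (rescale ε) h1
  have h3 : rescale ε (rescale ε⁻¹ p) = p := by
    ext α
    rw [coeff_rescale, coeff_rescale, ← mul_assoc, ← mul_pow]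
    simp
  rwa [h3] at h2

end Field

section FractionField

variable {O k : Type*} [CommRing O] [IsDomain O] [IsLocalRing O] [Field k] [Algebra O k]
  [IsFractionRing O k] {σ : Type*} [Finite σ]

lemma sqFreeSpan_sup_eq_top (I : Ideal (MvPolynomial σ O)) (I' : Ideal (MvPolynomial σ k))
    (hI : I.map (map (algebraMap O k)) ≤ I')
    (h : ∀ α : σ →₀ ℕ, monomial α (1 : O) ∈ sqFreeSpan σ O ⊔ I.restrictScalars O) :
    sqFreeSpan σ k ⊔ I'.restrictScalars k = ⊤ := by
  rw [eq_top_iff]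
  intro p _
  rw [p.as_sum]
  refine Submodule.sum_mem _ fun α _ => ?_
  have e : monomial α (coeff α p) = coeff α p • monomial α (1 : k) := by simp [smul_monomial]
  rw [e]
  refine Submodule.smul_mem _ _ ?_
  obtain ⟨x, hx, y, hy, hxy⟩ := Submodule.mem_sup.1 (h α)
  have e2 : monomial α (1 : k) = map (algebraMap O k) x + map (algebraMap O k) y := by
    rw [← map_add, hxy, map_monomial, (algebraMap O k).map_one]
  rw [e2]
  refine Submodule.add_mem_sup ?_ (hI (Ideal.mem_map_of_mem _ hy))
  rw [mem_sqFreeSpan_iff] at hx ⊢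
  exact fun β hβ => hx β (support_map_subset _ _ hβ)

/-- The square-free monomials span a complement of the ideal: they generate by extension of scalars
from `O`, and they are independent after clearing denominators. -/
lemma finrank_quotient_of_map_residue {Φ : σ → MvPolynomial σ O}
    (hΦ : ∀ i, map (residue O) (Φ i) = X i ^ 2) (hΦ2 : ∀ i, Φ i ∈ idealOfVars σ O ^ 2) {N : ℕ}
    (hN : Nat.card σ < N) :
    Module.finrank k (MvPolynomial σ k ⧸ (Ideal.span (Set.range fun i =>
      map (algebraMap O k) (Φ i)) ⊔ idealOfVars σ k ^ N)) = 2 ^ Nat.card σ := by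
  have := Fintype.ofFinite σ
  let _ : LinearOrder σ := LinearOrder.lift' (Fintype.equivFin σ) (Fintype.equivFin σ).injective
  set I := Ideal.span (Set.range Φ) ⊔ idealOfVars σ O ^ N
  set I' := Ideal.span (Set.range fun i => map (algebraMap O k) (Φ i)) ⊔ idealOfVars σ k ^ N
  have hI : I.map (map (algebraMap O k)) = I' := by
    rw [Ideal.map_sup, Ideal.map_span, ← Set.range_comp, Ideal.map_pow, Ideal.map_span,
      ← Set.range_comp]
    have : (⇑(map (algebraMap O k)) ∘ X : σ → MvPolynomial σ k) = X := by
      funext i; simp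
    rw [this]
    rfl
  have hc : IsCompl (I'.restrictScalars k) (sqFreeSpan σ k) := by
    constructor
    · rw [Submodule.disjoint_def]
      intro p hp hW
      have hp' : p ∈ I' := hp
      let _ := algebraMvPolynomial (σ := σ) (R := O) (S := k)
      rw [← hI] at hp'
      -- A nonzero multiple of `p` comes from an element `y` of the ideal over `O`, which is again a
      -- combination of square-free monomials.
      obtain ⟨⟨⟨y, hy⟩, ⟨s, hs⟩⟩, e⟩ := (IsLocalization.mem_map_algebraMap_iff
        ((nonZeroDivisors O).map (C (σ := σ))) (MvPolynomial σ k)).1 hp'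
      obtain ⟨d, hd, rfl⟩ := hs
      simp only [algebraMap_def, map_C] at e
      have hy0 : y = 0 := by
        refine eq_zero_of_mem_ideal hΦ hΦ2 hN y (fun α hα => ?_) hy
        refine mem_sqFreeSpan_iff.1 hW α ?_
        rw [mem_support_iff] at hα ⊢
        intro h0
        apply hα
        apply IsFractionRing.injective O k
        rw [← coeff_map, ← e, mul_comm, coeff_C_mul, h0, mul_zero, map_zero]
      rw [hy0, map_zero] at e
      rcases mul_eq_zero.1 e with h | h
      · exact h
      · rw [C_eq_zero] at h
        exact absurd ((IsFractionRing.injective O k) (h.trans (map_zero _).symm))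
          (nonZeroDivisors.ne_zero hd)
    · rw [codisjoint_iff, sup_comm]
      exact sqFreeSpan_sup_eq_top I I' hI.le (monomial_mem_truncated hΦ N)
  have e := Submodule.quotientEquivOfIsCompl _ _ hc
  rw [← finrank_sqFreeSpan (k := k), ← e.finrank_eq]
  rfl

lemma card_zeros_le_of_map_residue {Φ : σ → MvPolynomial σ O}
    (hΦ : ∀ i, map (residue O) (Φ i) = X i ^ 2) (hd : ∀ i, (Φ i).totalDegree ≤ 2)
    (Z : Finset (σ → k)) (hZ : ∀ z ∈ Z, ∀ i, eval z (map (algebraMap O k) (Φ i)) = 0) :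
    Z.card ≤ 2 ^ Nat.card σ := by
  have := Fintype.ofFinite σ
  let _ : LinearOrder σ := LinearOrder.lift' (Fintype.equivFin σ) (Fintype.equivFin σ).injective
  refine card_le_of_sqFreeSpan_sup_eq_top _ (sqFreeSpan_sup_eq_top (Ideal.span (Set.range Φ)) _
    le_rfl (monomial_mem_of_totalDegree_le hΦ hd)) Z fun z hz p hp => ?_
  have hle : (Ideal.span (Set.range Φ)).map (map (algebraMap O k)) ≤
      RingHom.ker (eval z) := by
    rw [Ideal.map_span, Ideal.span_le]
    rintro _ ⟨_, ⟨i, rfl⟩, rfl⟩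
    exact hZ z hz i
  exact hle hp

lemma exists_lift_of_coeff_mem (p : MvPolynomial σ k)
    (h : ∀ α, ∃ a ∈ maximalIdeal O, algebraMap O k a = coeff α p) :
    ∃ r : MvPolynomial σ O, map (algebraMap O k) r = p ∧ map (residue O) r = 0 := by
  choose a ha e using h
  refine ⟨∑ α ∈ p.support, monomial α (a α), ?_, ?_⟩
  · rw [map_sum]
    conv_rhs => rw [p.as_sum]
    exact Finset.sum_congr rfl fun α _ => by rw [map_monomial, e]
  · rw [map_sum]
    exact Finset.sum_eq_zero fun α _ => by
      rw [map_monomial, (residue_eq_zero_iff _).2 (ha α), monomial_zero]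

/-- A common small denominator. -/
lemma exists_denominator {π : O} (hπ : π ∈ maximalIdeal O) (hπ0 : π ≠ 0) (s : Finset k) :
    ∃ ε : O, ε ≠ 0 ∧ ∀ x ∈ s, ∃ a ∈ maximalIdeal O, algebraMap O k a = algebraMap O k ε * x := by
  obtain ⟨d, hd⟩ := IsLocalization.exist_integer_multiples_of_finset (nonZeroDivisors O) s
  refine ⟨d * π, mul_ne_zero (nonZeroDivisors.ne_zero d.2) hπ0, fun x hx => ?_⟩
  obtain ⟨a, ha⟩ := hd x hx
  refine ⟨π * a, Ideal.mul_mem_right _ _ hπ, ?_⟩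
  rw [map_mul, ha, Algebra.smul_def, map_mul]
  ring

lemma span_range_unit_mul {R : Type*} [CommRing R] {ι : Type*} (u : ι → R) (hu : ∀ i, IsUnit (u i))
    (f : ι → R) : Ideal.span (Set.range fun i => u i * f i) = Ideal.span (Set.range f) := by
  apply le_antisymm <;> rw [Ideal.span_le]
  · rintro _ ⟨i, rfl⟩
    exact Ideal.mul_mem_left _ _ (Ideal.subset_span ⟨i, rfl⟩)
  · rintro _ ⟨i, rfl⟩
    exact (Ideal.unit_mul_mem_iff_mem _ (hu i)).1 (Ideal.subset_span ⟨i, rfl⟩)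

lemma span_range_matrix_mul {R : Type*} [CommRing R] {ι : Type*} [Fintype ι] [DecidableEq ι]
    (M N : Matrix ι ι R) (h : M * N = 1) (f : ι → R) :
    Ideal.span (Set.range fun i => ∑ j, N i j * f j) = Ideal.span (Set.range f) := by
  have hle : ∀ (N : Matrix ι ι R) (f : ι → R),
      Ideal.span (Set.range fun i => ∑ j, N i j * f j) ≤ Ideal.span (Set.range f) := fun N f => by
    rw [Ideal.span_le]
    rintro _ ⟨i, rfl⟩
    exact Ideal.sum_mem _ fun j _ => Ideal.mul_mem_left _ _ (Ideal.subset_span ⟨j, rfl⟩)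
  refine le_antisymm (hle N f) ?_
  refine le_trans (le_of_eq ?_) (hle M _)
  congr 2
  have : f = M.mulVec (N.mulVec f) := by rw [Matrix.mulVec_mulVec, h, Matrix.one_mulVec]
  exact this

section Quadrics

variable [Fintype σ] [DecidableEq σ] {q : σ → MvPolynomial σ O} (hq : ∀ i, (q i).IsHomogeneous 2)
  {M : Matrix σ σ O} (hM : IsUnit M.det)
  (hres : ∀ i, map (residue O) (q i) = ∑ j, C (residue O (M i j)) * X j ^ 2)

-- Inverting `M` over `O` turns the residual diagonal forms into the squares themselves, which is
-- the situation of the preceding lemmas.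
include hM hres in
lemma map_residue_inv_mul (i : σ) :
    map (residue O) (∑ j, C (M⁻¹ i j) * q j) = X i ^ 2 := by
  have h1 : ∀ l, ∑ j, residue O (M⁻¹ i j) * residue O (M j l) = if i = l then 1 else 0 := fun l => by
    simp only [← map_mul, ← map_sum]
    rw [← Matrix.mul_apply, Matrix.nonsing_inv_mul _ hM, Matrix.one_apply]
    split_ifs <;> simp
  simp only [map_sum, map_mul, map_C, hres, Finset.mul_sum]
  rw [Finset.sum_comm]
  simp only [← mul_assoc, ← C_mul, ← Finset.sum_mul, ← map_sum, h1]
  simp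

include hq in
lemma isHomogeneous_inv_mul (i : σ) : (∑ j, C (M⁻¹ i j) * q j).IsHomogeneous 2 :=
  IsHomogeneous.sum _ _ _ fun j _ => by simpa using (isHomogeneous_C σ (M⁻¹ i j)).mul (hq j)

include hM in
lemma map_C_mul_map_C_inv : (M.map fun a => (C (algebraMap O k a) : MvPolynomial σ k)) *
    (M⁻¹.map fun a => (C (algebraMap O k a) : MvPolynomial σ k)) = 1 := by
  have := congrArg (fun A : Matrix σ σ O => A.map ((C : k →+* MvPolynomial σ k).comp
    (algebraMap O k))) (Matrix.mul_nonsing_inv _ hM)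
  simp only [Matrix.map_mul] at this
  rw [Matrix.map_one _ (map_zero _) (map_one _)] at this
  exact this

include hq hM hres in
/-- The dimension of the truncated local algebra of a system with initial forms `q`. -/
theorem finrank_quotient_eq {π : O} (hπ : π ∈ maximalIdeal O) (hπ0 : π ≠ 0)
    {Φ : σ → MvPolynomial σ k}
    (hΦ : ∀ i, Φ i - map (algebraMap O k) (q i) ∈ idealOfVars σ k ^ 3) {N : ℕ}
    (hN : Nat.card σ < N) :
    Module.finrank k (MvPolynomial σ k ⧸ (Ideal.span (Set.range Φ) ⊔ idealOfVars σ k ^ N)) =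
      2 ^ Nat.card σ := by
  set q' : σ → MvPolynomial σ O := fun i => ∑ j, C (M⁻¹ i j) * q j with hq'
  set Φ' : σ → MvPolynomial σ k := fun i => ∑ j, C (algebraMap O k (M⁻¹ i j)) * Φ j with hΦ'
  have hspan : Ideal.span (Set.range Φ') = Ideal.span (Set.range Φ) :=
    span_range_matrix_mul _ _ (map_C_mul_map_C_inv hM) Φ
  set r : σ → MvPolynomial σ k := fun i => Φ' i - map (algebraMap O k) (q' i) with hr
  have hr3 : ∀ i, r i ∈ idealOfVars σ k ^ 3 := fun i => by
    have : r i = ∑ j, C (algebraMap O k (M⁻¹ i j)) * (Φ j - map (algebraMap O k) (q j)) := by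
      simp [hr, hΦ', hq', mul_sub, Finset.sum_sub_distrib]
    rw [this]
    exact Ideal.sum_mem _ fun j _ => Ideal.mul_mem_left _ _ (hΦ j)
  classical
  -- Substituting `ε X` for `X` and dividing by `ε ^ 2` preserves the quadratic part and multiplies
  -- a coefficient of degree `d ≥ 3` by `ε ^ (d - 2)`. With `ε` a small common denominator, the
  -- whole remainder then has coefficients in the maximal ideal.
  obtain ⟨ε, hε0, hε⟩ := exists_denominator (k := k) hπ hπ0
    (Finset.univ.biUnion fun i => (r i).support.image fun α => coeff α (r i))
  have hεk : algebraMap O k ε ≠ 0 := fun h =>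
    hε0 ((IsFractionRing.injective O k) (h.trans (map_zero _).symm))
  set u : kˣ := Units.mk0 _ hεk with hu
  have hlift : ∀ i, ∃ s : MvPolynomial σ O,
      map (algebraMap O k) s = C ((algebraMap O k ε)⁻¹ ^ 2) * rescale u (r i) ∧
      map (residue O) s = 0 := fun i => by
    refine exists_lift_of_coeff_mem _ fun α => ?_
    rw [coeff_C_mul, coeff_rescale]
    by_cases hα : α ∈ (r i).support
    · obtain ⟨a, ha, e⟩ := hε (coeff α (r i)) (Finset.mem_biUnion.2
        ⟨i, Finset.mem_univ _, Finset.mem_image_of_mem _ hα⟩)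
      have h3 : 3 ≤ α.degree := (mem_pow_idealOfVars_iff 3 _).1 (hr3 i) α hα
      obtain ⟨t, ht⟩ := Nat.exists_eq_add_of_le h3
      refine ⟨ε ^ t * a, Ideal.mul_mem_left _ _ ha, ?_⟩
      rw [map_mul, map_pow, e, ht, hu, Units.val_mk0, pow_add]
      field_simp
    · rw [notMem_support_iff.1 hα]
      exact ⟨0, Ideal.zero_mem _, by simp⟩
  choose s hs1 hs2 using hlift
  have hs3 : ∀ i, s i ∈ idealOfVars σ O ^ 3 := fun i => by
    rw [mem_pow_idealOfVars_iff']
    intro x hx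
    apply IsFractionRing.injective O k
    rw [← coeff_map, hs1, coeff_C_mul, coeff_rescale, (mem_pow_idealOfVars_iff' 3 _).1 (hr3 i) x hx]
    simp
  have hhom : ∀ i, (q' i).IsHomogeneous 2 := isHomogeneous_inv_mul hq
  have hfin := finrank_quotient_of_map_residue (k := k) (Φ := fun i => q' i + s i) (N := N)
    (fun i => by rw [map_add, hs2, add_zero]; exact map_residue_inv_mul hM hres i)
    (fun i => Ideal.add_mem _ ((mem_pow_idealOfVars_iff 2 _).2 fun x hx =>
      ((hhom i).degree_eq_sum_deg_support hx).le) (Ideal.pow_le_pow_right (by norm_num) (hs3 i))) hN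
  rw [← hfin, ← hspan]
  refine (Ideal.quotientEquivAlg _ _ (rescale u) ?_).toLinearEquiv.finrank_eq
  change _ = Ideal.map (rescale u) _
  rw [Ideal.map_sup, map_rescale_pow, Ideal.map_span, ← Set.range_comp]
  congr 1
  rw [← span_range_unit_mul (fun _ => C ((algebraMap O k ε) ^ 2))
    (fun _ => (IsUnit.mk0 _ (pow_ne_zero 2 hεk)).map C)]
  congr 2
  funext i
  have e1 : Φ' i = map (algebraMap O k) (q' i) + r i := by simp [hr]
  rw [Function.comp_apply, e1, map_add, map_add, hs1,
    rescale_of_isHomogeneous u ((hhom i).map (algebraMap O k)), mul_add, ← mul_assoc, ← C_mul, hu,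
    Units.val_mk0, ← mul_pow, mul_inv_cancel₀ hεk, one_pow, C_1, one_mul]

include hq hM hres in
/-- A Bézout bound for the number of points in the fibres of the quadratic map. -/
theorem card_fibre_le {π : O} (hπ : π ∈ maximalIdeal O) (hπ0 : π ≠ 0) (c : σ → k)
    (Z : Finset (σ → k)) (hZ : ∀ z ∈ Z, ∀ i, eval z (map (algebraMap O k) (q i)) = c i) :
    Z.card ≤ 2 ^ Nat.card σ := by
  classical
  set q' : σ → MvPolynomial σ O := fun i => ∑ j, C (M⁻¹ i j) * q j with hq'
  set c' : σ → k := fun i => ∑ j, algebraMap O k (M⁻¹ i j) * c j with hc'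
  -- The points `ε z` solve the system with constants `ε ^ 2 c'`, which lie in the maximal ideal;
  -- the rescaled system is a deformation of the squares of degree at most two.
  obtain ⟨ε, hε0, hε⟩ := exists_denominator (k := k) hπ hπ0 (Finset.univ.image c')
  have hεk : algebraMap O k ε ≠ 0 := fun h =>
    hε0 ((IsFractionRing.injective O k) (h.trans (map_zero _).symm))
  choose a ha hac using fun i => hε (c' i) (Finset.mem_image_of_mem _ (Finset.mem_univ i))
  have hhom : ∀ i, (q' i).IsHomogeneous 2 := isHomogeneous_inv_mul hq
  have hinj : Function.Injective fun z : σ → k => algebraMap O k ε • z := smul_right_injective _ hεk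
  rw [← Finset.card_image_of_injective Z hinj]
  refine card_zeros_le_of_map_residue (O := O) (Φ := fun i => q' i - C (ε * a i))
    (fun i => ?_) (fun i => ?_) _ fun z hz i => ?_
  · rw [map_sub, map_C, (residue_eq_zero_iff _).2 (Ideal.mul_mem_left _ _ (ha i)), C_0, sub_zero]
    exact map_residue_inv_mul hM hres i
  · refine (totalDegree_sub _ _).trans (max_le (hhom i).totalDegree_le ?_)
    rw [totalDegree_C]
    norm_num
  · obtain ⟨w, hw, rfl⟩ := Finset.mem_image.1 hz
    have h1 : eval w (map (algebraMap O k) (q' i)) = c' i := by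
      simp only [hq', hc', map_sum, map_mul, map_C, eval_C, hZ w hw]
    rw [map_sub, map_sub, ← Units.val_mk0 hεk, ← eval_rescale,
      rescale_of_isHomogeneous _ ((hhom i).map (algebraMap O k)), map_mul, h1, map_C, eval_C, eval_C,
      map_mul, hac, Units.val_mk0]
    ring

end Quadrics

end FractionField

end SquareDeformation

/-! ### Multiplicities from truncated polynomial systems -/

namespace LocalMultiplicity

open MvPolynomial

variable {A J : Type} [CommRing A] [Algebra ℂ A] [Fintype J]

lemma aeval_mem_pow {θ : J → A} {𝔪 : Ideal A} (hθ : ∀ k, θ k ∈ 𝔪) {N : ℕ} {p : MvPolynomial J ℂ}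
    (hp : p ∈ idealOfVars J ℂ ^ N) : aeval θ p ∈ 𝔪 ^ N := by
  have h : (idealOfVars J ℂ).map (aeval θ) ≤ 𝔪 := by
    rw [Ideal.map_span, Ideal.span_le]
    rintro _ ⟨_, ⟨i, rfl⟩, rfl⟩
    simpa using hθ i
  have h2 := Ideal.mem_map_of_mem (aeval θ) hp
  rw [Ideal.map_pow] at h2
  exact Ideal.pow_right_mono h N h2

/-- Taylor expansion to order `N` in the parameters `θ`, modulo the equations `ρ`: split off the
constant term and expand the coefficients of the `θ k` by induction. -/
lemma exists_aeval_sub_mem {θ ρ : J → A} {𝔪 : Ideal A}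
    (h𝔪 : 𝔪 = Ideal.span (Set.range θ) ⊔ Ideal.span (Set.range ρ))
    (hsplit : ∀ a : A, ∃ c : ℂ, a - algebraMap ℂ A c ∈ 𝔪) (N : ℕ) (a : A) :
    ∃ p : MvPolynomial J ℂ, a - aeval θ p ∈ Ideal.span (Set.range ρ) ⊔ 𝔪 ^ N := by
  induction N generalizing a with
  | zero => exact ⟨0, by simp⟩
  | succ N ih =>
    obtain ⟨c, hc⟩ := hsplit a
    rw [h𝔪] at hc
    obtain ⟨x, hx, y, hy, e⟩ := Submodule.mem_sup.1 hc
    obtain ⟨b, hb⟩ := (Ideal.mem_span_range_iff_exists_fun).1 hx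
    choose p hp using fun k => ih (b k)
    refine ⟨C c + ∑ k, X k * p k, ?_⟩
    have e2 : a - aeval θ (C c + ∑ k, X k * p k) = y + ∑ k, θ k * (b k - aeval θ (p k)) := by
      simp only [map_add, aeval_C, map_sum, map_mul, aeval_X, mul_sub, Finset.sum_sub_distrib]
      rw [← sub_sub, ← e, ← hb]
      simp only [mul_comm]
      ring
    rw [e2]
    refine Ideal.add_mem _ (Submodule.mem_sup_left hy) (Ideal.sum_mem _ fun k _ => ?_)
    obtain ⟨r, hr, s, hs, e3⟩ := Submodule.mem_sup.1 (hp k)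
    rw [← e3, mul_add, pow_succ']
    refine Submodule.add_mem_sup (Ideal.mul_mem_left _ _ hr) (Ideal.mul_mem_mul ?_ hs)
    rw [h𝔪]
    exact Submodule.mem_sup_left (Ideal.subset_span ⟨k, rfl⟩)

/-- The dimension of the local ring of an intersection whose equations, restricted to the first
variety, have the initial forms `Q`. -/
theorem rank_quotient_eq (θ ρ : J → A) (𝔪 : Ideal A)
    (h𝔪 : 𝔪 = Ideal.span (Set.range θ) ⊔ Ideal.span (Set.range ρ)) (hjac : 𝔪 ≤ Ideal.jacobson ⊥)
    (hsplit : ∀ a : A, ∃ c : ℂ, a - algebraMap ℂ A c ∈ 𝔪)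
    (I I' : Ideal A) (hρ : ∀ k, ρ k ∈ I) (𝔟 : ℕ → Ideal A) (h𝔟 : Antitone 𝔟) (hI𝔟 : ∀ N, I ≤ 𝔟 N)
    (h𝔪𝔟 : ∀ N, 𝔪 ^ N ≤ 𝔟 N)
    (hpoly : ∀ N p, aeval θ p ∈ 𝔟 N → p ∈ idealOfVars J ℂ ^ N)
    (F : A →ₐ[ℂ] A) (hF : 𝔪.map F ≤ 𝔪) (hI' : ∀ x ∈ I', ∃ y ∈ I, F y = x)
    (hρ' : ∀ k, F (ρ k) ∈ I') (a : J → A) (ha : ∀ k, IsUnit (a k))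
    (Q : J → MvPolynomial J ℂ) (hQ : ∀ k, a k * F (ρ k) - aeval θ (Q k) ∈ 𝔟 3)
    (hfin : ∀ Φ : J → MvPolynomial J ℂ, (∀ k, Φ k - Q k ∈ idealOfVars J ℂ ^ 3) →
      ∀ N, Fintype.card J < N → Module.finrank ℂ (MvPolynomial J ℂ ⧸
        (Ideal.span (Set.range Φ) ⊔ idealOfVars J ℂ ^ N)) = 2 ^ Fintype.card J) :
    Module.rank ℂ (A ⧸ (I ⊔ I')) = 2 ^ Fintype.card J := by
  set m := Fintype.card J with hm
  set R := Ideal.span (Set.range ρ) with hR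
  set R' := Ideal.span (Set.range fun k => a k * F (ρ k)) with hR'
  have hθ𝔪 : ∀ k, θ k ∈ 𝔪 := fun k => by
    rw [h𝔪]; exact Submodule.mem_sup_left (Ideal.subset_span ⟨k, rfl⟩)
  have hRI : R ≤ I := by
    rw [hR, Ideal.span_le]; rintro _ ⟨k, rfl⟩; exact hρ k
  have hRI' : R' ≤ I' := by
    rw [hR', Ideal.span_le]; rintro _ ⟨k, rfl⟩; exact Ideal.mul_mem_left _ _ (hρ' k)
  have hR𝔟 : ∀ N, R ⊔ 𝔪 ^ N ≤ 𝔟 N := fun N => sup_le (hRI.trans (hI𝔟 N)) (h𝔪𝔟 N)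
  have happrox := exists_aeval_sub_mem h𝔪 hsplit
  -- A polynomial in `θ` lying in `𝔟 N` has order at least `N`, so that `𝔟 N` equals `R + 𝔪 ^ N`.
  -- Consequently `I` is known modulo each power of `𝔪`, and it need not be shown that the `ρ k`
  -- generate it.
  have h𝔟le : ∀ N, 𝔟 N ≤ R ⊔ 𝔪 ^ N := fun N x hx => by
    obtain ⟨p, hp⟩ := happrox N x
    have h1 : aeval θ p ∈ 𝔟 N := by
      have := Ideal.sub_mem _ hx (hR𝔟 N hp)
      simpa using this
    have h2 := Submodule.mem_sup_right (S := R) (aeval_mem_pow hθ𝔪 (hpoly N p h1))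
    simpa using Ideal.add_mem _ hp h2
  have hIle : ∀ N, I ≤ R ⊔ 𝔪 ^ N := fun N => (hI𝔟 N).trans (h𝔟le N)
  have hI'le : ∀ N, I' ≤ R' ⊔ 𝔪 ^ N := fun N x hx => by
    obtain ⟨y, hy, rfl⟩ := hI' x hx
    have h1 := Ideal.mem_map_of_mem F (hIle N hy)
    rw [Ideal.map_sup, Ideal.map_pow, hR, Ideal.map_span, ← Set.range_comp] at h1
    rw [hR', SquareDeformation.span_range_unit_mul a ha]
    exact sup_le_sup_left (Ideal.pow_right_mono hF N) _ h1
  -- The precision `m + 3` suffices both for the comparison with `Q` at order three and for the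
  -- truncations at orders `m + 1` and `m + 2` used below.
  choose Φ hΦ using fun k => happrox (m + 3) (a k * F (ρ k))
  have hΦQ : ∀ k, Φ k - Q k ∈ idealOfVars J ℂ ^ 3 := fun k => by
    apply hpoly
    have h1 : a k * F (ρ k) - aeval θ (Φ k) ∈ 𝔟 3 := h𝔟 (by omega) (hR𝔟 _ (hΦ k))
    have := Ideal.sub_mem _ (hQ k) h1
    simpa using this
  have hiff : ∀ N ≤ m + 3, ∀ p, aeval θ p ∈ (I ⊔ I') ⊔ 𝔪 ^ N ↔
      p ∈ Ideal.span (Set.range Φ) ⊔ idealOfVars J ℂ ^ N := by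
    intro N hN p
    have hΦN : ∀ k, a k * F (ρ k) - aeval θ (Φ k) ∈ R ⊔ 𝔪 ^ N := fun k =>
      sup_le_sup_left (Ideal.pow_le_pow_right hN) R (hΦ k)
    constructor
    · intro h
      have h1 : aeval θ p ∈ R' ⊔ (R ⊔ 𝔪 ^ N) := by
        refine sup_le (sup_le ((hIle N).trans le_sup_right) ((hI'le N).trans ?_))
          (le_sup_right.trans le_sup_right) h
        exact sup_le_sup_left le_sup_right _
      obtain ⟨x, hx, y, hy, e⟩ := Submodule.mem_sup.1 h1
      obtain ⟨b, hb⟩ := (Ideal.mem_span_range_iff_exists_fun).1 hx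
      choose g hg using fun k => happrox N (b k)
      have h2 : aeval θ (p - ∑ k, g k * Φ k) ∈ R ⊔ 𝔪 ^ N := by
        have e2 : aeval θ (p - ∑ k, g k * Φ k) = y + ∑ k, ((b k - aeval θ (g k)) *
            (a k * F (ρ k)) + aeval θ (g k) * (a k * F (ρ k) - aeval θ (Φ k))) := by
          simp only [map_sub, map_sum, map_mul, ← e, ← hb, sub_mul, mul_sub,
            Finset.sum_add_distrib, Finset.sum_sub_distrib]
          ring
        rw [e2]
        exact Ideal.add_mem _ hy (Ideal.sum_mem _ fun k _ => Ideal.add_mem _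
          (Ideal.mul_mem_right _ _ (hg k)) (Ideal.mul_mem_left _ _ (hΦN k)))
      have h3 := hpoly N _ (hR𝔟 N h2)
      have h4 : ∑ k, g k * Φ k ∈ Ideal.span (Set.range Φ) :=
        Ideal.sum_mem _ fun k _ => Ideal.mul_mem_left _ _ (Ideal.subset_span ⟨k, rfl⟩)
      simpa using Submodule.add_mem_sup h4 h3
    · intro h
      obtain ⟨x, hx, y, hy, rfl⟩ := Submodule.mem_sup.1 h
      rw [map_add]
      refine Ideal.add_mem _ ?_ (Submodule.mem_sup_right (aeval_mem_pow hθ𝔪 hy))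
      obtain ⟨b, rfl⟩ := (Ideal.mem_span_range_iff_exists_fun).1 hx
      rw [map_sum]
      refine Ideal.sum_mem _ fun k _ => ?_
      rw [map_mul]
      refine Ideal.mul_mem_left _ _ ?_
      have h1 : a k * F (ρ k) ∈ (I ⊔ I') ⊔ 𝔪 ^ N := Submodule.mem_sup_left
        (Submodule.mem_sup_right (hRI' (Ideal.subset_span ⟨k, rfl⟩)))
      have h2 : a k * F (ρ k) - aeval θ (Φ k) ∈ (I ⊔ I') ⊔ 𝔪 ^ N :=
        sup_le_sup_right (hRI.trans le_sup_left) _ (hΦN k)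
      simpa using Ideal.sub_mem _ h1 h2
  set K : ℕ → Ideal (MvPolynomial J ℂ) := fun N =>
    Ideal.span (Set.range Φ) ⊔ idealOfVars J ℂ ^ N with hK
  have hKfin : ∀ N, m < N → Module.finrank ℂ (MvPolynomial J ℂ ⧸ K N) = 2 ^ m := hfin Φ hΦQ
  -- Both quotients have dimension `2 ^ m`, so the surjection between them is bijective: the
  -- truncations are stationary.
  have hKeq : K (m + 1) ≤ K (m + 2) := by
    have hle : K (m + 2) ≤ K (m + 1) := sup_le_sup_left (Ideal.pow_le_pow_right (by omega)) _
    have : Module.Finite ℂ (MvPolynomial J ℂ ⧸ K (m + 2)) :=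
      Module.finite_of_finrank_pos (by rw [hKfin _ (by omega)]; positivity)
    have : Module.Finite ℂ (MvPolynomial J ℂ ⧸ K (m + 1)) :=
      Module.finite_of_finrank_pos (by rw [hKfin _ (by omega)]; positivity)
    let f := (Ideal.Quotient.factorₐ ℂ hle).toLinearMap
    have hs : Function.Surjective f := Ideal.Quotient.factor_surjective hle
    have hi : Function.Injective f := (LinearMap.injective_iff_surjective_of_finrank_eq_finrank
      (by rw [hKfin _ (by omega), hKfin _ (by omega)])).2 hs
    intro x hx
    rw [← Ideal.Quotient.eq_zero_iff_mem] at hx ⊢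
    apply hi
    rw [map_zero]
    exact hx
  -- Stationarity gives `𝔪 ^ (m + 1) ≤ (I + I') + 𝔪 * 𝔪 ^ (m + 1)`, and Nakayama's lemma removes the
  -- last term. The intersection is thus defined at a finite order, where it is a quotient of the
  -- polynomial ring.
  have hpow : 𝔪 ^ (m + 1) ≤ I ⊔ I' := by
    have hfg : 𝔪.FG := by
      rw [h𝔪]
      exact Submodule.FG.sup (Submodule.fg_span (Set.finite_range _))
        (Submodule.fg_span (Set.finite_range _))
    refine Submodule.le_of_le_smul_of_le_jacobson_bot (Ideal.FG.pow hfg) hjac ?_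
    intro x hx
    obtain ⟨p, hp⟩ := happrox (m + 2) x
    have h1 : p ∈ idealOfVars J ℂ ^ (m + 1) := by
      apply hpoly
      have := Ideal.sub_mem _ (h𝔪𝔟 _ hx) (h𝔟 (by omega) (hR𝔟 _ hp))
      simpa using this
    have h2 : aeval θ p ∈ (I ⊔ I') ⊔ 𝔪 ^ (m + 2) :=
      (hiff (m + 2) (by omega) p).2 (hKeq (Submodule.mem_sup_right h1))
    have h3 : x - aeval θ p ∈ (I ⊔ I') ⊔ 𝔪 ^ (m + 2) :=
      sup_le_sup_right (hRI.trans le_sup_left) _ hp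
    have h4 := Ideal.add_mem _ h3 h2
    rw [sub_add_cancel, pow_succ' 𝔪 (m + 1)] at h4
    exact h4
  let L : MvPolynomial J ℂ →ₐ[ℂ] A ⧸ (I ⊔ I') := (Ideal.Quotient.mkₐ ℂ (I ⊔ I')).comp (aeval θ)
  have hL : Function.Surjective L := fun y => by
    obtain ⟨x, rfl⟩ := Ideal.Quotient.mk_surjective y
    obtain ⟨p, hp⟩ := happrox (m + 1) x
    refine ⟨p, ?_⟩
    change Ideal.Quotient.mk _ (aeval θ p) = _
    rw [eq_comm, Ideal.Quotient.eq]
    exact sup_le (hRI.trans le_sup_left) hpow hp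
  have hker : RingHom.ker L = K (m + 1) := by
    ext p
    rw [RingHom.mem_ker, ← hiff (m + 1) (by omega), sup_eq_left.2 hpow]
    exact Ideal.Quotient.eq_zero_iff_mem
  have e1 := (Ideal.quotientKerAlgEquivOfSurjective hL).toLinearEquiv.rank_eq
  have e2 := (Ideal.quotientEquivAlgOfEq ℂ hker).toLinearEquiv.rank_eq
  have : Module.Finite ℂ (MvPolynomial J ℂ ⧸ K (m + 1)) :=
    Module.finite_of_finrank_pos (by rw [hKfin _ (by omega)]; positivity)
  have e3 := Module.finrank_eq_rank ℂ (MvPolynomial J ℂ ⧸ K (m + 1))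
  rw [hKfin _ (by omega)] at e3
  push_cast at e3
  rw [← e1, e2, ← e3]

end LocalMultiplicity

noncomputable section

/-! ## Hadamard's lemma for analytic functions -/

/-- One variable is factored out of each homogeneous term of the power series: `G` is the sum of the
shifted series, which has the same radius of convergence. -/
lemma AnalyticAt.exists_eq_add_apply {W F : Type*} [NormedAddCommGroup W] [NormedSpace ℝ W]
    [NormedAddCommGroup F] [NormedSpace ℝ F] [CompleteSpace F] {f : W → F} (hf : AnalyticAt ℝ f 0) :
    ∃ G : W → (W →L[ℝ] F), AnalyticAt ℝ G 0 ∧ ∀ᶠ u in 𝓝 0, f u = f 0 + G u u := by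
  obtain ⟨p, r, hp⟩ := hf
  have hr : 0 < p.shift.radius := by
    rw [FormalMultilinearSeries.radius_shift]; exact hp.r_pos.trans_le hp.r_le
  have hG := p.shift.hasFPowerSeriesOnBall hr
  refine ⟨p.shift.sum, hG.analyticAt, ?_⟩
  have hs : p.shift.unshift (f 0) = p := by
    ext n : 1
    cases n with
    | zero =>
      ext v
      simp only [FormalMultilinearSeries.unshift]
      rw [hp.coeff_zero]
      simp
    | succ n =>
      simp only [FormalMultilinearSeries.unshift, FormalMultilinearSeries.shift]
      exact (continuousMultilinearCurryRightEquiv' ℝ n W F).symm_apply_apply (p n.succ)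
  have h2 := hG.unshift (z := f 0)
  rw [hs] at h2
  have h3 : HasFPowerSeriesOnBall f p 0 (min r p.shift.radius) :=
    hp.mono (lt_min hp.r_pos hr) (min_le_left _ _)
  have h4 := h2.mono (lt_min hp.r_pos hr) (min_le_right _ _)
  filter_upwards [Metric.eball_mem_nhds (0 : W) (lt_min hp.r_pos hr)] with u hu
  have := h3.unique h4 hu
  simpa using this

namespace ProjGeom

variable {E : Type*} [NormedAddCommGroup E] [NormedSpace ℂ E]

/-! ## Neighbourhoods in projective spaces -/

/-- The saturation of an open set is the union of its images by the nonzero homotheties. -/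
lemma isOpenMap_mk' : IsOpenMap (Projectivization.mk' ℂ : {v : E // v ≠ 0} → ℙ ℂ E) := by
  intro U hU
  refine (isQuotientMap_quotient_mk' (s := projectivizationSetoid ℂ E)).isOpen_preimage.1 ?_
  have : Quotient.mk (projectivizationSetoid ℂ E) ⁻¹' (Projectivization.mk' ℂ '' U) =
      ⋃ c : ℂˣ, {w | (⟨c • w.1, (smul_ne_zero_iff_ne c).2 w.2⟩ : {v : E // v ≠ 0}) ∈ U} := by
    ext w
    simp only [Set.mem_preimage, Set.mem_iUnion, Set.mem_ofPred_eq]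
    constructor
    · rintro ⟨u, hu, h⟩
      obtain ⟨c, hc⟩ := (Projectivization.mk_eq_mk_iff ℂ u.1 w.1 u.2 w.2).1 h
      exact ⟨c, by convert hu⟩
    · rintro ⟨c, hc⟩
      exact ⟨_, hc, (Projectivization.mk_eq_mk_iff ℂ _ w.1 _ w.2).2 ⟨c, rfl⟩⟩
  refine this ▸ isOpen_iUnion fun c => hU.preimage ?_
  exact Continuous.subtype_mk (continuous_subtype_val.const_smul c) _

/-- All local statements on `ℙ(E)` are transferred by this equivalence to a neighbourhood of one
spanning vector. -/
lemma eventually_nhds_mk {v : E} (hv : v ≠ 0) {P : ℙ ℂ E → Prop} :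
    (∀ᶠ y in 𝓝 (Projectivization.mk ℂ v hv), P y) ↔
      ∀ᶠ w in 𝓝 v, ∀ h : w ≠ 0, P (Projectivization.mk ℂ w h) := by
  have hcont : Continuous (Projectivization.mk' ℂ : {v : E // v ≠ 0} → ℙ ℂ E) :=
    continuous_quotient_mk' (s := projectivizationSetoid ℂ E)
  have h1 : 𝓝 (Projectivization.mk ℂ v hv) =
      Filter.map (Projectivization.mk' ℂ) (𝓝 (⟨v, hv⟩ : {v : E // v ≠ 0})) :=
    (isOpenMap_mk'.map_nhds_eq hcont.continuousAt).symm
  have h2 : Filter.map Subtype.val (𝓝 (⟨v, hv⟩ : {v : E // v ≠ 0})) = 𝓝 v :=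
    isOpen_ne.isOpenEmbedding_subtypeVal.map_nhds_eq ⟨v, hv⟩
  rw [h1, ← h2, Filter.eventually_map, Filter.eventually_map]
  exact ⟨fun h => h.mono fun a ha _ => ha, fun h => h.mono fun a ha => ha a.2⟩

lemma tendsto_mk {X : Type*} {l : Filter X} {f : X → E} {v : E} (hv : v ≠ 0)
    (hf : Filter.Tendsto f l (𝓝 v)) (hf0 : ∀ x, f x ≠ 0) :
    Filter.Tendsto (fun x => Projectivization.mk ℂ (f x) (hf0 x)) l
      (𝓝 (Projectivization.mk ℂ v hv)) := by
  intro s hs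
  have := hf.eventually ((eventually_nhds_mk hv).1 hs)
  exact this.mono fun x hx => hx (hf0 x)

/-! ## Homogeneous functions of degree zero -/

lemma apply_rep {φ : E → ℂ} (hφ : ∀ c : ℂ, c ≠ 0 → ∀ v, φ (c • v) = φ v) {v : E} (hv : v ≠ 0) :
    φ (Projectivization.mk ℂ v hv).rep = φ v := by
  obtain ⟨a, ha⟩ := Projectivization.exists_smul_eq_mk_rep ℂ v hv
  rw [← ha]
  exact hφ a a.ne_zero v

lemma pullback_rep {φ : E → ℂ} (hφ : ∀ c : ℂ, c ≠ 0 → ∀ v, φ (c • v) = φ v) {v : E} (hv : v ≠ 0) :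
    pullback (fun y : ℙ ℂ E => φ y.rep) v = φ v := by
  rw [pullback_of_ne _ hv, apply_rep hφ]

lemma realAnalyticAt_rep {φ : E → ℂ} (hφ : ∀ c : ℂ, c ≠ 0 → ∀ v, φ (c • v) = φ v) {v₀ : E}
    (hv₀ : v₀ ≠ 0) (h : AnalyticAt ℝ φ v₀) :
    RealAnalyticAt (fun y : ℙ ℂ E => φ y.rep) (Projectivization.mk ℂ v₀ hv₀) := by
  intro v hv hx
  obtain ⟨c, rfl⟩ := (Projectivization.mk_eq_mk_iff ℂ v v₀ hv hv₀).1 hx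
  have h1 : AnalyticAt ℝ (fun w : E => φ ((↑c⁻¹ : ℂ) • w)) (c • v₀) := by
    have hlin : AnalyticAt ℝ (fun w : E => (↑c⁻¹ : ℂ) • w) (c • v₀) :=
      (((↑c⁻¹ : ℂ) • ContinuousLinearMap.id ℝ E)).analyticAt _
    refine AnalyticAt.fun_comp ?_ hlin
    rwa [Units.smul_def, smul_smul, Units.inv_mul, one_smul]
  refine h1.congr ?_
  filter_upwards [isOpen_ne.mem_nhds hv] with w hw
  rw [pullback_rep hφ hw, hφ _ (Units.ne_zero _)]

end ProjGeom

end

noncomputable section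

namespace ProjGeom

section Germs

variable {E : Type*} [NormedAddCommGroup E] [NormedSpace ℂ E] {x : ℙ ℂ E}

/-! ## Germs of analytic functions -/

/-- The germ of a real analytic function. -/
def germOf (g : ℙ ℂ E → ℂ) (hg : RealAnalyticAt g x) : analyticGerms x := ⟨g, g, hg, rfl⟩

lemma exists_germOf (a : analyticGerms x) :
    ∃ (g : ℙ ℂ E → ℂ) (hg : RealAnalyticAt g x), germOf g hg = a := by
  obtain ⟨_, g, hg, rfl⟩ := a
  exact ⟨g, hg, rfl⟩

lemma germOf_eq_iff {g h : ℙ ℂ E → ℂ} {hg : RealAnalyticAt g x} {hh : RealAnalyticAt h x} :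
    germOf g hg = germOf h hh ↔ ∀ᶠ y in 𝓝 x, g y = h y := by
  rw [Subtype.ext_iff]
  exact Filter.Germ.coe_eq

lemma germOf_mul {g h : ℙ ℂ E → ℂ} (hg : RealAnalyticAt g x) (hh : RealAnalyticAt h x) :
    germOf g hg * germOf h hh = germOf (g * h) (hg.mul hh) := rfl

lemma germOf_add {g h : ℙ ℂ E → ℂ} (hg : RealAnalyticAt g x) (hh : RealAnalyticAt h x) :
    germOf g hg + germOf h hh = germOf (g + h) (hg.add hh) := rfl

lemma algebraMap_germ (c : ℂ) :
    algebraMap ℂ (analyticGerms x) c = germOf (fun _ => c) (realAnalyticAt_const c x) := by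
  apply Subtype.ext
  change algebraMap ℂ (Filter.Germ (𝓝 x) ℂ) c = _
  rw [Algebra.algebraMap_eq_smul_one]
  change ((c • (1 : ℙ ℂ E → ℂ) : ℙ ℂ E → ℂ) : Filter.Germ (𝓝 x) ℂ) = _
  congr 1
  funext y
  simp

/-- The value of a germ at the base point. -/
def germValue (x : ℙ ℂ E) : analyticGerms x →+* ℂ :=
  Filter.Germ.valueRingHom.comp (analyticGerms x).val.toRingHom

lemma germValue_germOf (g : ℙ ℂ E → ℂ) (hg : RealAnalyticAt g x) :
    germValue x (germOf g hg) = g x := rfl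

lemma isUnit_germ {a : analyticGerms x} (ha : germValue x a ≠ 0) : IsUnit a := by
  obtain ⟨g, hg, rfl⟩ := exists_germOf a
  rw [germValue_germOf] at ha
  have hp : ∀ (v : E) (hv : v ≠ 0), Projectivization.mk ℂ v hv = x → pullback g v ≠ 0 := by
    rintro v hv rfl; rwa [pullback_of_ne g hv]
  have hinv : RealAnalyticAt g⁻¹ x := fun v hv hx => by
    have : pullback g⁻¹ = (pullback g)⁻¹ := by
      funext w
      by_cases hw : w = 0 <;> simp [pullback, hw]
    rw [this]
    exact (hg v hv hx).inv (hp v hv hx)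
  refine IsUnit.of_mul_eq_one (germOf g⁻¹ hinv) ?_
  rw [germOf_mul, ← map_one (algebraMap ℂ (analyticGerms x)), algebraMap_germ, germOf_eq_iff]
  obtain ⟨v, hv, hx⟩ : ∃ (v : E) (hv : v ≠ 0), Projectivization.mk ℂ v hv = x :=
    ⟨x.rep, x.rep_nonzero, x.mk_rep⟩
  have h1 : ∀ᶠ w in 𝓝 v, pullback g w ≠ 0 :=
    (hg v hv hx).continuousAt.eventually_ne (hp v hv hx)
  rw [← hx, eventually_nhds_mk]
  filter_upwards [h1] with w hw hw0
  rw [pullback_of_ne g hw0] at hw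
  simp [hw]

/-- A germ with nonzero value is invertible; this locality is what permits Nakayama's lemma in the
ring of germs. -/
lemma ker_germValue_le_jacobson : RingHom.ker (germValue x) ≤ Ideal.jacobson ⊥ := by
  intro a ha
  rw [Ideal.mem_jacobson_bot]
  intro b
  apply isUnit_germ
  rw [RingHom.mem_ker] at ha
  simp [ha]

lemma sub_germValue_mem (a : analyticGerms x) :
    a - algebraMap ℂ _ (germValue x a) ∈ RingHom.ker (germValue x) := by
  rw [RingHom.mem_ker, map_sub, algebraMap_germ, germValue_germOf, sub_self]

/-! ## Action of unitary maps on germs -/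

variable (u : E ≃ₗᵢ[ℂ] E)

/-- The map induced by `u` on the projective space. -/
def projMap : ℙ ℂ E → ℙ ℂ E := Projectivization.map u.toLinearEquiv.toLinearMap u.injective

lemma map_ne_zero_of_ne {v : E} (hv : v ≠ 0) : u v ≠ 0 := fun h =>
  hv (u.injective (h.trans (map_zero u).symm))

lemma projMap_mk {v : E} (hv : v ≠ 0) :
    projMap u (Projectivization.mk ℂ v hv) = Projectivization.mk ℂ (u v) (map_ne_zero_of_ne u hv) :=
  rfl

lemma tendsto_projMap (x : ℙ ℂ E) : Filter.Tendsto (projMap u) (𝓝 x) (𝓝 (projMap u x)) := by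
  induction x using Projectivization.ind with
  | h v hv =>
    intro s hs
    rw [projMap_mk] at hs
    refine (eventually_nhds_mk hv).2 ?_
    filter_upwards [u.continuous.continuousAt.eventually ((eventually_nhds_mk _).1 hs)] with w hw h0
    exact hw (map_ne_zero_of_ne u h0)

lemma RealAnalyticAt.comp_projMap {g : ℙ ℂ E → ℂ} (hg : RealAnalyticAt g (projMap u x)) :
    RealAnalyticAt (g ∘ projMap u) x := by
  intro v hv hx
  have h1 : AnalyticAt ℝ (pullback g) (u v) := hg (u v) (map_ne_zero_of_ne u hv) (by rw [← hx]; rfl)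
  have hu : AnalyticAt ℝ (fun w => u w) v :=
    ((u.toContinuousLinearEquiv : E →L[ℂ] E).restrictScalars ℝ).analyticAt v
  refine (h1.fun_comp hu).congr ?_
  filter_upwards [isOpen_ne.mem_nhds hv] with w hw
  rw [pullback_of_ne _ hw, pullback_of_ne _ (map_ne_zero_of_ne u hw)]
  rfl

/-- Pull-back of germs by a unitary map fixing the base point. -/
def germPullback (hx : projMap u x = x) : analyticGerms x →ₐ[ℂ] analyticGerms x where
  toFun a := ⟨a.1.compTendsto (projMap u) (by simpa [hx] using tendsto_projMap u x), by
    obtain ⟨_, g, hg, rfl⟩ := a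
    exact ⟨g ∘ projMap u, RealAnalyticAt.comp_projMap u (by rwa [hx]), rfl⟩⟩
  map_one' := rfl
  map_zero' := rfl
  map_mul' a b := by
    obtain ⟨_, g, hg, rfl⟩ := a
    obtain ⟨_, h, hh, rfl⟩ := b
    rfl
  map_add' a b := by
    obtain ⟨_, g, hg, rfl⟩ := a
    obtain ⟨_, h, hh, rfl⟩ := b
    rfl
  commutes' c := rfl

lemma germPullback_germOf (hx : projMap u x = x) {g : ℙ ℂ E → ℂ} (hg : RealAnalyticAt g x) :
    germPullback u hx (germOf g hg) =
      germOf (g ∘ projMap u) (RealAnalyticAt.comp_projMap u (by rwa [hx])) := rfl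

lemma map_germPullback_ker_le (hx : projMap u x = x) :
    (RingHom.ker (germValue x)).map (germPullback u hx) ≤ RingHom.ker (germValue x) := by
  rw [Ideal.map_le_iff_le_comap]
  intro a ha
  obtain ⟨g, hg, rfl⟩ := exists_germOf a
  rw [Ideal.mem_comap, germPullback_germOf, RingHom.mem_ker, germValue_germOf, Function.comp_apply,
    hx]
  exact ha

lemma germOf_mem_vanishingIdeal {S : Set (ℙ ℂ E)} {g : ℙ ℂ E → ℂ} {hg : RealAnalyticAt g x} :
    germOf g hg ∈ vanishingIdeal S x ↔ ∀ᶠ y in 𝓝 x, y ∈ S → g y = 0 := by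
  constructor
  · rintro ⟨h, hh, hS⟩
    filter_upwards [Filter.Germ.coe_eq.1 hh, hS] with y h1 h2 hy
    rw [← h1, h2 hy]
  · exact fun h => ⟨g, rfl, h⟩

lemma germPullback_mem {S : Set (ℙ ℂ E)} (hx : projMap u x = x) {a : analyticGerms x}
    (ha : a ∈ vanishingIdeal S x) :
    germPullback u hx a ∈ vanishingIdeal (unitaryPreimage u S) x := by
  obtain ⟨g, hg, rfl⟩ := exists_germOf a
  rw [germPullback_germOf, germOf_mem_vanishingIdeal]
  rw [germOf_mem_vanishingIdeal, ← hx] at ha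
  filter_upwards [(tendsto_projMap u x).eventually ha] with y hy hyS
  exact hy hyS

lemma exists_germPullback_eq {S : Set (ℙ ℂ E)} (hx : projMap u x = x) {a : analyticGerms x}
    (ha : a ∈ vanishingIdeal (unitaryPreimage u S) x) :
    ∃ b ∈ vanishingIdeal S x, germPullback u hx b = a := by
  have hsymm : ∀ y, projMap u (projMap u.symm y) = y := fun y => by
    induction y using Projectivization.ind with
    | h v hv => rw [projMap_mk, projMap_mk]; congr 1; exact u.apply_symm_apply v
  have hsymm' : ∀ y, projMap u.symm (projMap u y) = y := fun y => by
    induction y using Projectivization.ind with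
    | h v hv => rw [projMap_mk, projMap_mk]; congr 1; exact u.symm_apply_apply v
  have hx' : projMap u.symm x = x := by
    conv_lhs => rw [← hx]
    exact hsymm' x
  obtain ⟨g, hg, rfl⟩ := exists_germOf a
  refine ⟨germPullback u.symm hx' (germOf g hg), ?_, ?_⟩
  · have := germPullback_mem u.symm hx' ha
    have hS : unitaryPreimage u.symm (unitaryPreimage u S) = S := by
      ext y
      change projMap u (projMap u.symm y) ∈ S ↔ _
      rw [hsymm]
    rwa [hS] at this
  · rw [germPullback_germOf, germPullback_germOf, germOf_eq_iff]
    refine Filter.Eventually.of_forall fun y => ?_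
    simp [hsymm']

end Germs

end ProjGeom

end

noncomputable section

namespace ProjGeom

/-! ## The Cayley transform -/

/-- The Cayley transform, which maps the real line to the unit circle. -/
def cayley (z : ℂ) : ℂ := (1 + Complex.I * z / 2) / (1 - Complex.I * z / 2)

lemma cayley_zero : cayley 0 = 1 := by simp [cayley]

/-- The inverse of the Cayley transform is `c ↦ -2i (c - 1) / (c + 1)`, in homogeneous form with `c
= a / b`. -/
lemma cayley_div {a b : ℂ} (hb : b ≠ 0) (hab : a + b ≠ 0) :
    cayley (-2 * Complex.I * (a - b) / (a + b)) = a / b := by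
  have h1 : 1 + Complex.I * (-2 * Complex.I * (a - b) / (a + b)) / 2 = 2 * a / (a + b) := by
    field_simp
    linear_combination (b - a) * Complex.I_sq
  have h2 : 1 - Complex.I * (-2 * Complex.I * (a - b) / (a + b)) / 2 = 2 * b / (a + b) := by
    field_simp
    linear_combination (a - b) * Complex.I_sq
  rw [cayley, h1, h2]
  field_simp

lemma one_sub_ne_zero_of_real (x : ℝ) : 1 - Complex.I * (x : ℂ) / 2 ≠ 0 := by
  intro h
  have := congrArg Complex.re h
  simp at this

/-- Expansion `1 + i x - x ^ 2 / 2 + ...` with exact remainders, separated into real and imaginary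
parts. -/
lemma cayley_ofReal (x : ℝ) : cayley x =
    ((1 - x ^ 2 / 2 * (1 + x ^ 2 / 4)⁻¹ : ℝ) : ℂ) +
      ((x - x ^ 3 / 4 * (1 + x ^ 2 / 4)⁻¹ : ℝ) : ℂ) * Complex.I := by
  have h1 := one_sub_ne_zero_of_real x
  have h2 : (4 + (x : ℂ) ^ 2) ≠ 0 := by
    have : (4 + x ^ 2 : ℝ) ≠ 0 := by positivity
    exact_mod_cast this
  have h3 : (1 + (x : ℂ) ^ 2 / 4)⁻¹ = 4 / (4 + (x : ℂ) ^ 2) := by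
    rw [inv_eq_one_div, div_eq_div_iff _ h2]
    · ring
    · intro h; exact h2 (by linear_combination 4 * h)
  rw [cayley, div_eq_iff h1]
  push_cast
  rw [h3]
  field_simp
  ring_nf
  simp only [Complex.I_sq]
  ring

lemma norm_cayley_ofReal (x : ℝ) : ‖cayley x‖ = 1 := by
  have h1 := one_sub_ne_zero_of_real x
  rw [cayley, norm_div, div_eq_one_iff_eq (norm_ne_zero_iff.2 h1)]
  have : 1 + Complex.I * (x : ℂ) / 2 = (starRingEnd ℂ) (1 - Complex.I * (x : ℂ) / 2) := by
    simp only [map_sub, map_div₀, map_mul, map_one, Complex.conj_I, Complex.conj_ofReal, map_ofNat]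
    ring
  rw [this, RCLike.norm_conj]

lemma coord_cayley {z : ℂ} (hz : 1 - Complex.I * z / 2 ≠ 0) :
    -2 * Complex.I * (cayley z - 1) / (cayley z + 1) = z := by
  have h1 : cayley z - 1 = Complex.I * z / (1 - Complex.I * z / 2) := by
    rw [cayley, div_sub_one hz]; congr 1; ring
  have h2 : cayley z + 1 = 2 / (1 - Complex.I * z / 2) := by
    rw [cayley, div_add_one hz]; congr 1; ring
  rw [h1, h2, ← mul_div_assoc, div_div_div_cancel_right₀ hz]
  linear_combination (-z) * Complex.I_sq

/-- `Im (-2i (a - b) / (a + b))` in terms of the moduli. -/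
lemma im_coord {a b : ℂ} (hb : b ≠ 0) (hab : a + b ≠ 0) :
    (((-2 * Complex.I * (a - b) / (a + b)).im : ℝ) : ℂ) =
      (a * (starRingEnd ℂ) a / (b * (starRingEnd ℂ) b) - 1) *
        (-2 * (b * (starRingEnd ℂ) b) / ((a + b) * (starRingEnd ℂ) (a + b))) := by
  have hb' : (starRingEnd ℂ) b ≠ 0 := (map_ne_zero _).2 hb
  have hab' : (starRingEnd ℂ) a + (starRingEnd ℂ) b ≠ 0 := by
    rw [← map_add]; exact (map_ne_zero _).2 hab
  rw [Complex.im_eq_sub_conj]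
  simp only [map_div₀, map_mul, map_sub, map_add, map_neg, Complex.conj_I, map_ofNat]
  field_simp
  ring

/-! ## Extension by zero -/

section Extend

variable {ι : Type*} (o : ι)

/-- Extension by zero at `o`. -/
def extend {R : Type*} [Zero R] (s : {k // k ≠ o} → R) (k : ι) : R := by
  classical exact if h : k ≠ o then s ⟨k, h⟩ else 0

variable {o}

lemma extend_self {R : Type*} [Zero R] (s : {k // k ≠ o} → R) : extend o s o = 0 := by
  simp [extend]

lemma extend_coe {R : Type*} [Zero R] (s : {k // k ≠ o} → R) (k : {k // k ≠ o}) :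
    extend o s k = s k := by
  simp [extend, k.2]

lemma extend_zero {R : Type*} [Zero R] : extend o (0 : {k // k ≠ o} → R) = 0 := by
  funext k
  by_cases h : k = o <;> simp [extend, h]

lemma eq_extend {R : Type*} [Zero R] {f : ι → R} {s : {k // k ≠ o} → R} (h0 : f o = 0)
    (h : ∀ k : {k // k ≠ o}, f k = s k) : f = extend o s := by
  funext k
  by_cases hk : k = o
  · rw [hk, h0, extend_self]
  · exact (h ⟨k, hk⟩).trans (extend_coe s ⟨k, hk⟩).symm

lemma ofReal_extend (s : {k // k ≠ o} → ℝ) (k : ι) :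
    ((extend o s k : ℝ) : ℂ) = extend o (fun j => (s j : ℂ)) k := by
  by_cases h : k = o <;> simp [extend, h]

lemma sum_mul_extend [Fintype ι] [Fintype {k // k ≠ o}] {R : Type*} [CommSemiring R] (f : ι → R)
    (s : {k // k ≠ o} → R) : ∑ k, f k * extend o s k = ∑ k : {k // k ≠ o}, f k * s k := by
  classical
  have h : ∑ k ∈ Finset.univ.filter (fun k => k ≠ o), f k * extend o s k =
      ∑ k, f k * extend o s k := by
    refine Finset.sum_subset (Finset.filter_subset _ _) fun k _ hk => ?_
    have : k = o := by simpa using hk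
    rw [this, extend_self, mul_zero]
  rw [← h, ← Finset.sum_subtype_eq_sum_filter]
  have h2 : (Finset.univ.subtype fun k => k ≠ o) = Finset.univ := by ext; simp
  rw [h2]
  exact Finset.sum_congr (by ext; simp) fun k _ => by rw [extend_coe]

lemma norm_extend_le [Fintype {k // k ≠ o}] (s : {k // k ≠ o} → ℝ) (k : ι) :
    ‖extend o s k‖ ≤ ‖s‖ := by
  by_cases h : k = o
  · rw [h, extend_self, norm_zero]; exact norm_nonneg _
  · have := extend_coe s ⟨k, h⟩
    rw [this]
    exact norm_le_pi_norm s _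

end Extend

/-! ## Clifford tori in coordinates -/

section Torus

variable {E : Type*} [NormedAddCommGroup E] [NormedSpace ℂ E] {ι : Type*} [Fintype ι] (o : ι)
  (e : E ≃L[ℂ] (ι → ℂ))

/-- The lines spanned by the vectors whose coordinates have the same modulus. -/
def torus : Set (ℙ ℂ E) := {x | ∀ k, ‖e x.rep k‖ = ‖e x.rep o‖}

variable {o e}

lemma mk_mem_torus {v : E} (hv : v ≠ 0) :
    Projectivization.mk ℂ v hv ∈ torus o e ↔ ∀ k, ‖e v k‖ = ‖e v o‖ := by
  obtain ⟨a, ha⟩ := Projectivization.exists_smul_eq_mk_rep ℂ v hv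
  have h : ∀ k, ‖e (Projectivization.mk ℂ v hv).rep k‖ = ‖(a : ℂ)‖ * ‖e v k‖ := fun k => by
    rw [← ha, Units.smul_def, map_smul, Pi.smul_apply, smul_eq_mul, norm_mul]
  have ha0 : ‖(a : ℂ)‖ ≠ 0 := by simp
  simp only [torus, Set.mem_ofPred_eq, h, mul_right_inj' ha0]

lemma apply_ne_zero_of_mem_torus {v : E} (hv : v ≠ 0) (h : ∀ k, ‖e v k‖ = ‖e v o‖) (k : ι) :
    e v k ≠ 0 := by
  intro h0
  apply hv
  apply e.injective
  rw [map_zero]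
  funext l
  have h1 := h k
  rw [h0, norm_zero] at h1
  have h2 := h l
  rw [← h1] at h2
  exact norm_eq_zero.1 h2

variable (o e)

/-- The Cayley chart. -/
def chart (z : {k // k ≠ o} → ℂ) : E := e.symm fun k => cayley (extend o z k)

/-- The coordinates of the Cayley chart. -/
def coord (v : E) (k : ι) : ℂ := -2 * Complex.I * (e v k - e v o) / (e v k + e v o)

variable {o e}

lemma chart_apply (z : {k // k ≠ o} → ℂ) (k : ι) : e (chart o e z) k = cayley (extend o z k) := by
  simp [chart]

lemma chart_apply_self (z : {k // k ≠ o} → ℂ) : e (chart o e z) o = 1 := by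
  rw [chart_apply, extend_self, cayley_zero]

lemma chart_ne_zero (z : {k // k ≠ o} → ℂ) : chart o e z ≠ 0 := fun h => by
  have := chart_apply_self (e := e) z
  rw [h, map_zero] at this
  simp at this

lemma coord_smul {c : ℂ} (hc : c ≠ 0) (v : E) (k : ι) : coord o e (c • v) k = coord o e v k := by
  simp only [coord, map_smul, Pi.smul_apply, smul_eq_mul, ← mul_sub, ← mul_add]
  rw [mul_left_comm, mul_div_mul_left _ _ hc]

lemma chart_coord {v : E} (h0 : e v o ≠ 0) (h : ∀ k, e v k + e v o ≠ 0) :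
    e v o • chart o e (fun k => coord o e v k) = v := by
  apply e.injective
  funext k
  rw [map_smul, Pi.smul_apply, chart_apply, smul_eq_mul]
  have : extend o (fun k : {k // k ≠ o} => coord o e v k) = coord o e v :=
    (eq_extend (by simp [coord]) fun _ => rfl).symm
  rw [this, coord, cayley_div h0 (h k), mul_div_cancel₀ _ h0]

lemma mk_chart_coord {v : E} (hv : v ≠ 0) (h0 : e v o ≠ 0) (h : ∀ k, e v k + e v o ≠ 0) :
    Projectivization.mk ℂ (chart o e fun k => coord o e v k) (chart_ne_zero _) =
      Projectivization.mk ℂ v hv :=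
  ((Projectivization.mk_eq_mk_iff' ℂ _ _ _ _).2 ⟨e v o, chart_coord h0 h⟩).symm

lemma coord_chart_ofReal (s : {k // k ≠ o} → ℝ) (k : ι) :
    coord o e (chart o e fun j => (s j : ℂ)) k = extend o (fun j => (s j : ℂ)) k := by
  rw [coord, chart_apply_self, chart_apply, ← ofReal_extend]
  exact coord_cayley (one_sub_ne_zero_of_real _)

lemma chart_ofReal_mem_torus (s : {k // k ≠ o} → ℝ) :
    Projectivization.mk ℂ (chart o e fun j => (s j : ℂ)) (chart_ne_zero _) ∈ torus o e := by
  rw [mk_mem_torus]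
  intro k
  rw [chart_apply, chart_apply, ← ofReal_extend, ← ofReal_extend, norm_cayley_ofReal,
    norm_cayley_ofReal]

lemma im_coord_of_mem_torus {v : E} (h : ∀ k, ‖e v k‖ = ‖e v o‖)
    (h0 : e v o ≠ 0) (k : ι) (hk : e v k + e v o ≠ 0) : (coord o e v k).im = 0 := by
  have h1 := im_coord h0 hk
  rw [Complex.mul_conj, Complex.mul_conj, Complex.normSq_eq_norm_sq, Complex.normSq_eq_norm_sq, h k,
    div_self, sub_self, zero_mul] at h1
  · exact Complex.ofReal_eq_zero.1 h1
  · simpa using h0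

/-! ### Analyticity -/

lemma analyticAt_apply (k : ι) (v : E) : AnalyticAt ℝ (fun w => e w k) v :=
  (((ContinuousLinearMap.proj (R := ℂ) (φ := fun _ : ι => ℂ) k).comp
    (e : E →L[ℂ] (ι → ℂ))).restrictScalars ℝ).analyticAt v

lemma AnalyticAt.conj {W : Type*} [NormedAddCommGroup W] [NormedSpace ℝ W] {f : W → ℂ} {w : W}
    (hf : AnalyticAt ℝ f w) : AnalyticAt ℝ (fun x => (starRingEnd ℂ) (f x)) w :=
  ((Complex.conjCLE : ℂ →L[ℝ] ℂ).analyticAt _).fun_comp hf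

lemma AnalyticAt.re_ofReal {W : Type*} [NormedAddCommGroup W] [NormedSpace ℝ W] {f : W → ℂ} {w : W}
    (hf : AnalyticAt ℝ f w) : AnalyticAt ℝ (fun x => ((f x).re : ℂ)) w :=
  ((Complex.ofRealCLM.comp Complex.reCLM).analyticAt _).fun_comp hf

lemma analyticAt_coord {v : E} (k : ι) (h : e v k + e v o ≠ 0) :
    AnalyticAt ℝ (fun w => coord o e w k) v := by
  unfold coord
  exact ((analyticAt_const.mul ((analyticAt_apply k v).sub (analyticAt_apply o v)))).div
    ((analyticAt_apply k v).add (analyticAt_apply o v)) h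

lemma analyticAt_cayley : AnalyticAt ℝ cayley 0 := by
  unfold cayley
  refine AnalyticAt.div ?_ ?_ (by simp)
  · exact analyticAt_const.add ((analyticAt_const.mul analyticAt_id).div analyticAt_const (by simp))
  · exact analyticAt_const.sub ((analyticAt_const.mul analyticAt_id).div analyticAt_const (by simp))

lemma analyticAt_chart [Fintype {k // k ≠ o}] : AnalyticAt ℝ (chart o e) 0 := by
  unfold chart
  have h1 : AnalyticAt ℝ (fun z : {k // k ≠ o} → ℂ => fun k => cayley (extend o z k)) 0 := by
    rw [analyticAt_pi_iff]
    intro k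
    by_cases hk : k = o
    · subst hk
      simp only [extend_self]
      exact analyticAt_const
    · have : ∀ z : {k // k ≠ o} → ℂ, extend o z k = z ⟨k, hk⟩ := fun z => extend_coe z ⟨k, hk⟩
      simp only [this]
      have h2 : AnalyticAt ℝ (fun z : {k // k ≠ o} → ℂ => z ⟨k, hk⟩) 0 :=
        (ContinuousLinearMap.proj (R := ℝ) (φ := fun _ : {k // k ≠ o} => ℂ) ⟨k, hk⟩).analyticAt 0
      exact AnalyticAt.fun_comp (by simpa using analyticAt_cayley) h2
  exact (((e.symm : (ι → ℂ) →L[ℂ] E).restrictScalars ℝ).analyticAt _).fun_comp h1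

end Torus

end ProjGeom

end

noncomputable section

namespace ProjGeom

open MvPolynomial Asymptotics

/-! ## Order of vanishing of polynomials at real points -/

lemma coeff_eq_zero_of_isBigO (P : Polynomial ℂ) (N : ℕ)
    (h : (fun t : ℝ => P.eval (t : ℂ)) =O[𝓝[≠] 0] fun t => t ^ N) (d : ℕ) (hd : d < N) :
    P.coeff d = 0 := by
  induction N generalizing P d with
  | zero => omega
  | succ N ih =>
    have hc : Filter.Tendsto (fun t : ℝ => P.eval (t : ℂ)) (𝓝[≠] 0) (𝓝 (P.eval 0)) := by
      have : Continuous fun t : ℝ => P.eval (t : ℂ) := P.continuous.comp Complex.continuous_ofReal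
      simpa using (this.tendsto 0).mono_left nhdsWithin_le_nhds
    have hz : Filter.Tendsto (fun t : ℝ => t ^ (N + 1)) (𝓝[≠] 0) (𝓝 0) := by
      have : Continuous fun t : ℝ => t ^ (N + 1) := by fun_prop
      simpa using (this.tendsto 0).mono_left nhdsWithin_le_nhds
    have h0 : P.eval 0 = 0 := tendsto_nhds_unique hc (h.trans_tendsto hz)
    obtain ⟨P₁, rfl⟩ : Polynomial.X ∣ P := by
      rw [Polynomial.X_dvd_iff, Polynomial.coeff_zero_eq_eval_zero, h0]
    have h1 : (fun t : ℝ => P₁.eval (t : ℂ)) =O[𝓝[≠] 0] fun t => t ^ N := by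
      obtain ⟨c, hc⟩ := h.bound
      refine IsBigO.of_bound c ?_
      filter_upwards [hc, self_mem_nhdsWithin] with t ht ht0
      have ht0' : 0 < ‖t‖ := norm_pos_iff.2 ht0
      rw [Polynomial.eval_mul, Polynomial.eval_X, norm_mul, Complex.norm_real, norm_pow, pow_succ']
        at ht
      rw [norm_pow]
      refine le_of_mul_le_mul_left ?_ ht0'
      calc _ ≤ _ := ht
        _ = _ := by ring
    cases d with
    | zero => simp
    | succ d => rw [Polynomial.coeff_X_mul]; exact ih P₁ h1 d (by omega)

lemma coeff_aeval_C_mul_X {J : Type*} (w : J → ℂ) (p : MvPolynomial J ℂ) (d : ℕ) :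
    (aeval (fun k => Polynomial.C (w k) * Polynomial.X) p : Polynomial ℂ).coeff d =
      eval w (homogeneousComponent d p) := by
  classical
  induction p using MvPolynomial.induction_on' with
  | monomial β c =>
    have h1 : (aeval (fun k => Polynomial.C (w k) * Polynomial.X) (monomial β c) : Polynomial ℂ) =
        Polynomial.C (eval w (monomial β c)) * Polynomial.X ^ β.degree := by
      rw [aeval_monomial, eval_monomial, Polynomial.C_mul, mul_assoc]
      congr 1
      simp only [Finsupp.prod, mul_pow, Finset.prod_mul_distrib, map_prod, map_pow,
        Finset.prod_pow_eq_pow_sum]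
      rfl
    have h2 : homogeneousComponent d (monomial β c) = if d = β.degree then monomial β c else 0 := by
      rw [homogeneousComponent_of_mem ((mem_homogeneousSubmodule _ _).2
        (isHomogeneous_monomial c rfl))]
    rw [h1, Polynomial.coeff_C_mul, Polynomial.coeff_X_pow, h2]
    split_ifs <;> simp
  | add p q hp hq => simp only [map_add, Polynomial.coeff_add, hp, hq]

/-- Along a real line through the origin the homogeneous components are the coefficients of a
polynomial in one variable, so those of degree less than `N` vanish at all real points. A complex
polynomial vanishing at all real points is zero. -/
lemma mem_pow_idealOfVars_of_isBigO {J : Type*} [Fintype J] (p : MvPolynomial J ℂ) (N : ℕ)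
    (h : (fun s : J → ℝ => eval (fun k => (s k : ℂ)) p) =O[𝓝 0] fun s => ‖s‖ ^ N) :
    p ∈ idealOfVars J ℂ ^ N := by
  rw [mem_pow_idealOfVars_iff']
  intro α hα
  have key : ∀ s : J → ℝ, eval (fun k => (s k : ℂ)) (homogeneousComponent α.degree p) = 0 := by
    intro s
    let P : Polynomial ℂ := aeval (fun k => Polynomial.C (s k : ℂ) * Polynomial.X) p
    have hP : ∀ t : ℂ, P.eval t = eval (fun k => (s k : ℂ) * t) p := fun t => by
      have : (Polynomial.evalRingHom t).comp (aeval (fun k => Polynomial.C (s k : ℂ) *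
          Polynomial.X) : MvPolynomial J ℂ →ₐ[ℂ] Polynomial ℂ).toRingHom =
          eval (fun k => (s k : ℂ) * t) := by
        ext i <;> simp
      exact congrArg (fun f : MvPolynomial J ℂ →+* ℂ => f p) this
    have hcoef : P.coeff α.degree = eval (fun k => (s k : ℂ)) (homogeneousComponent α.degree p) :=
      coeff_aeval_C_mul_X _ p _
    rw [← hcoef]
    refine coeff_eq_zero_of_isBigO P N ?_ _ hα
    have ht : Filter.Tendsto (fun t : ℝ => t • s) (𝓝[≠] 0) (𝓝 0) := by
      have : Continuous fun t : ℝ => t • s := by fun_prop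
      simpa using (this.tendsto 0).mono_left nhdsWithin_le_nhds
    have h1 := h.comp_tendsto ht
    have h2 : (fun t : ℝ => P.eval (t : ℂ)) =
        (fun s : J → ℝ => eval (fun k => (s k : ℂ)) p) ∘ fun t : ℝ => t • s := by
      funext t
      rw [hP]
      simp [mul_comm]
    rw [h2]
    refine h1.trans ?_
    refine IsBigO.of_bound (‖s‖ ^ N) (Filter.Eventually.of_forall fun t => ?_)
    simp only [Function.comp_apply, norm_smul, norm_pow, norm_norm, mul_pow, norm_mul]
    rw [mul_comm]
  have hz : homogeneousComponent α.degree p = 0 := by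
    refine funext_set (fun _ => Set.range ((↑) : ℝ → ℂ))
      (fun _ => Set.infinite_range_of_injective Complex.ofReal_injective) fun x hx => ?_
    choose s hs using fun k => hx k trivial
    have hxs : x = fun k => (s k : ℂ) := funext fun k => (hs k).symm
    rw [hxs, key s, map_zero]
  rw [← (coeff_homogeneousComponent α.degree p α).trans (if_pos rfl), hz, coeff_zero]

/-! ## The quadratic part of the equations -/

section Quad

variable {ι : Type*} [Fintype ι] (o : ι) [Fintype {k // k ≠ o}]

/-- The quadratic form `(K x)_k ^ 2 - K (x ^ 2)_k`, for `x` vanishing at `o`. -/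
def quadForm {R : Type*} [CommRing R] (K : ι → ι → R) (k : ι) : MvPolynomial {k // k ≠ o} R :=
  (∑ l : {k // k ≠ o}, C (K k l) * X l) ^ 2 - ∑ l : {k // k ≠ o}, C (K k l) * X l ^ 2

/-- The differences of the quadratic forms `quadForm`. -/
def quadPoly {R : Type*} [CommRing R] (K : ι → ι → R) (k : {k // k ≠ o}) :
    MvPolynomial {k // k ≠ o} R :=
  quadForm o K k - quadForm o K o

lemma map_quadPoly {R S : Type*} [CommRing R] [CommRing S] (f : R →+* S) (K : ι → ι → R)
    (k : {k // k ≠ o}) : map f (quadPoly o K k) = quadPoly o (fun k l => f (K k l)) k := by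
  simp [quadPoly, quadForm]

lemma isHomogeneous_quadPoly {R : Type*} [CommRing R] (K : ι → ι → R) (k : {k // k ≠ o}) :
    (quadPoly o K k).IsHomogeneous 2 := by
  have h : ∀ k, (quadForm o K k).IsHomogeneous 2 := fun k => by
    refine IsHomogeneous.sub ?_ ?_
    · exact (IsHomogeneous.sum _ _ 1 fun l _ => isHomogeneous_C_mul_X _ _).pow 2
    · exact IsHomogeneous.sum _ _ 2 fun l _ => isHomogeneous_C_mul_X_pow _ _ _
  exact (h k).sub (h o)

/-- The real quadratic form `(K x)_k ^ 2 - K (x ^ 2)_k`. -/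
def quad (K : ι → ι → ℝ) (s : {k // k ≠ o} → ℝ) (k : ι) : ℝ :=
  (∑ l, K k l * extend o s l) ^ 2 - ∑ l, K k l * extend o s l ^ 2

variable {o}

lemma extend_sq (s : {k // k ≠ o} → ℝ) (l : ι) :
    extend o s l ^ 2 = extend o (fun j => s j ^ 2) l := by
  by_cases h : l = o
  · subst h; simp [extend_self]
  · rw [show extend o s l = s ⟨l, h⟩ from extend_coe s ⟨l, h⟩]
    exact (extend_coe (fun j => s j ^ 2) ⟨l, h⟩).symm

lemma eval_quadPoly (K : ι → ι → ℝ) (s : {k // k ≠ o} → ℝ) (k : {k // k ≠ o}) :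
    eval (fun j => (s j : ℂ)) (quadPoly o (fun k l => (K k l : ℂ)) k) =
      ((quad o K s k - quad o K s o : ℝ) : ℂ) := by
  have h : ∀ k : ι, eval (fun j => (s j : ℂ)) (quadForm o (fun k l => (K k l : ℂ)) k) =
      (quad o K s k : ℂ) := fun k => by
    simp only [quadForm, quad, map_sub, map_pow, map_sum, map_mul, eval_C, eval_X, extend_sq,
      sum_mul_extend]
    push_cast
    rfl
  rw [quadPoly, map_sub, h, h, Complex.ofReal_sub]

lemma isBigO_extend (s : ι) : (fun x : {k // k ≠ o} → ℝ => extend o x s) =O[𝓝 0] fun x => ‖x‖ ^ 1 :=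
  IsBigO.of_bound 1 (Filter.Eventually.of_forall fun x => by
    simpa using norm_extend_le x s)

lemma isBigO_norm_pow_of_le {a b : ℕ} (h : a ≤ b) :
    (fun x : {k // k ≠ o} → ℝ => ‖x‖ ^ b) =O[𝓝 0] fun x => ‖x‖ ^ a := by
  refine IsBigO.of_bound 1 ?_
  filter_upwards [Metric.closedBall_mem_nhds (0 : {k // k ≠ o} → ℝ) one_pos] with x hx
  have hx' : ‖x‖ ≤ 1 := by simpa using hx
  simp only [norm_pow, norm_norm, one_mul]
  exact pow_le_pow_of_le_one (norm_nonneg _) hx' h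

/-- Second order expansion of the moduli of the image by `K` of a point of the torus. -/
lemma isBigO_sq_sub_quad (K : ι → ι → ℝ) (hK : ∀ k, ∑ l, K k l = 1) (k : ι) :
    (fun s : {k // k ≠ o} → ℝ =>
      ((∑ l, (K k l : ℂ) * cayley (extend o s l : ℝ)) *
        (starRingEnd ℂ) (∑ l, (K k l : ℂ) * cayley (extend o s l : ℝ)) - 1 - (quad o K s k : ℂ)))
      =O[𝓝 0] fun s => ‖s‖ ^ 3 := by
  set κ : ι → ({k // k ≠ o} → ℝ) → ℝ := fun l s => (1 + extend o s l ^ 2 / 4)⁻¹ with hκ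
  have hκ1 : ∀ l, (κ l) =O[𝓝 0] fun s => ‖s‖ ^ 0 := fun l => by
    refine IsBigO.of_bound 1 (Filter.Eventually.of_forall fun s => ?_)
    have : (1 : ℝ) ≤ 1 + extend o s l ^ 2 / 4 := by nlinarith [sq_nonneg (extend o s l)]
    rw [hκ, norm_inv, Real.norm_of_nonneg (by linarith)]
    simpa using inv_le_one_of_one_le₀ this
  have hpow : ∀ l d, (fun s => extend o s l ^ d) =O[𝓝 0] fun s : {k // k ≠ o} → ℝ => ‖s‖ ^ d :=
    fun l d => by simpa [← pow_mul] using (isBigO_extend l).pow d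
  have hterm : ∀ l d, (fun s => extend o s l ^ d * κ l s) =O[𝓝 0]
      fun s : {k // k ≠ o} → ℝ => ‖s‖ ^ d := fun l d => by
    simpa using (hpow l d).mul (hκ1 l)
  have hsum : ∀ d, (fun s => ∑ l, K k l * (extend o s l ^ d * κ l s)) =O[𝓝 0]
      fun s : {k // k ≠ o} → ℝ => ‖s‖ ^ d := fun d =>
    IsBigO.fun_sum fun l _ => (hterm l d).const_mul_left _
  set S : ℕ → ({k // k ≠ o} → ℝ) → ℝ := fun d s => ∑ l, K k l * (extend o s l ^ d * κ l s) with hS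
  set Y : ({k // k ≠ o} → ℝ) → ℝ := fun s => ∑ l, K k l * extend o s l with hY
  have hYO : Y =O[𝓝 0] fun s : {k // k ≠ o} → ℝ => ‖s‖ ^ 1 :=
    IsBigO.fun_sum fun l _ => (isBigO_extend l).const_mul_left _
  have hval : ∀ s : {k // k ≠ o} → ℝ, ∑ l, (K k l : ℂ) * cayley (extend o s l : ℝ) =
      ((1 - S 2 s / 2 : ℝ) : ℂ) + ((Y s - S 3 s / 4 : ℝ) : ℂ) * Complex.I := fun s => by
    have h1 : (1 - S 2 s / 2 : ℝ) = ∑ l, K k l * (1 - extend o s l ^ 2 / 2 * κ l s) := by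
      simp only [mul_sub, mul_one, Finset.sum_sub_distrib, hK, hS, Finset.sum_div]
      congr 1
      exact Finset.sum_congr rfl fun l _ => by ring
    have h2 : (Y s - S 3 s / 4 : ℝ) =
        ∑ l, K k l * (extend o s l - extend o s l ^ 3 / 4 * κ l s) := by
      simp only [mul_sub, Finset.sum_sub_distrib, hS, hY, Finset.sum_div]
      congr 1
      exact Finset.sum_congr rfl fun l _ => by ring
    rw [h1, h2, Complex.ofReal_sum, Complex.ofReal_sum, Finset.sum_mul, ← Finset.sum_add_distrib]
    refine Finset.sum_congr rfl fun l _ => ?_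
    rw [cayley_ofReal, Complex.ofReal_mul, Complex.ofReal_mul]
    ring
  -- With `κ = 1 / (1 + x ^ 2 / 4)` one has `x ^ 2 = κ x ^ 2 + κ x ^ 4 / 4`, whence the term `S 4 /
  -- 4`.
  have hquad : ∀ s, quad o K s k = Y s ^ 2 - (S 2 s + S 4 s / 4) := fun s => by
    rw [quad]
    congr 1
    simp only [hS, Finset.sum_div, ← Finset.sum_add_distrib]
    refine Finset.sum_congr rfl fun l _ => ?_
    have : (1 + extend o s l ^ 2 / 4) * κ l s = 1 := by
      rw [hκ]; exact mul_inv_cancel₀ (by positivity)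
    linear_combination (-K k l * extend o s l ^ 2) * this
  -- The terms of order two cancel, and each remaining one has order at least four.
  have hfun : ∀ s : {k // k ≠ o} → ℝ,
      ((∑ l, (K k l : ℂ) * cayley (extend o s l : ℝ)) *
        (starRingEnd ℂ) (∑ l, (K k l : ℂ) * cayley (extend o s l : ℝ)) - 1 - (quad o K s k : ℂ)) =
      ((S 2 s * S 2 s / 4 + S 4 s / 4 - Y s * S 3 s / 2 + S 3 s * S 3 s / 16 : ℝ) : ℂ) := fun s => by
    rw [hval, hquad]
    simp only [map_add, map_mul, Complex.conj_ofReal, Complex.conj_I]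
    push_cast
    ring_nf
    simp only [Complex.I_sq]
    ring
  simp only [hfun]
  rw [← isBigO_norm_left]
  simp only [Complex.norm_real, isBigO_norm_left]
  refine IsBigO.add (IsBigO.sub (IsBigO.add ?_ ?_) ?_) ?_
  · simp only [div_eq_inv_mul]
    refine (((hsum 2).mul (hsum 2)).congr_right fun s => (pow_add _ 2 2).symm).const_mul_left _ |>.trans
      (isBigO_norm_pow_of_le (by norm_num))
  · simp only [div_eq_inv_mul]
    exact ((hsum 4).const_mul_left _).trans (isBigO_norm_pow_of_le (by norm_num))
  · simp only [div_eq_inv_mul]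
    refine ((hYO.mul (hsum 3)).congr_right fun s => (pow_add _ 1 3).symm).const_mul_left _ |>.trans
      (isBigO_norm_pow_of_le (by norm_num))
  · simp only [div_eq_inv_mul]
    refine (((hsum 3).mul (hsum 3)).congr_right fun s => (pow_add _ 3 3).symm).const_mul_left _ |>.trans
      (isBigO_norm_pow_of_le (by norm_num))

end Quad

end ProjGeom

end

/-! ### Generators of the maximal ideal at a point of the torus -/

noncomputable section

namespace ProjGeom

open MvPolynomial Asymptotics

section Multiplicity

variable {E : Type*} [NormedAddCommGroup E] [NormedSpace ℂ E] {ι : Type*} [Fintype ι] {o : ι}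
  [Fintype {k // k ≠ o}] {e : E ≃L[ℂ] (ι → ℂ)} {v₀ : E} (hv₀ : v₀ ≠ 0) (he : ∀ k, e v₀ k = 1)

lemma germOf_sum {x : ℙ ℂ E} {α : Type*} (s : Finset α) (g : α → ℙ ℂ E → ℂ)
    (hg : ∀ i, RealAnalyticAt (g i) x) :
    ∃ h, ∑ i ∈ s, germOf (g i) (hg i) = germOf (x := x) (fun y => ∑ i ∈ s, g i y) h := by
  classical
  induction s using Finset.induction_on with
  | empty =>
    refine ⟨by simpa using realAnalyticAt_const 0 x, ?_⟩
    simp only [Finset.sum_empty]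
    rw [← map_zero (algebraMap ℂ (analyticGerms x)), algebraMap_germ]
  | insert a s ha ih =>
    obtain ⟨h, e⟩ := ih
    have h' : RealAnalyticAt (fun y => ∑ i ∈ insert a s, g i y) x := by
      simp only [Finset.sum_insert ha]
      exact (hg a).add h
    refine ⟨h', ?_⟩
    rw [Finset.sum_insert ha, e, germOf_add, germOf_eq_iff]
    exact Filter.Eventually.of_forall fun y => by simp [Finset.sum_insert ha]

lemma aeval_germOf {x : ℙ ℂ E} {α : Type*} (g : α → ℙ ℂ E → ℂ)
    (hg : ∀ i, RealAnalyticAt (g i) x) (p : MvPolynomial α ℂ) :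
    ∃ h, aeval (fun i => germOf (g i) (hg i)) p =
      germOf (x := x) (fun y => eval (fun i => g i y) p) h := by
  induction p using MvPolynomial.induction_on with
  | C c =>
    refine ⟨by simpa using realAnalyticAt_const c x, ?_⟩
    rw [aeval_C, algebraMap_germ, germOf_eq_iff]
    exact Filter.Eventually.of_forall fun y => by simp
  | add p q hp hq =>
    obtain ⟨h1, e1⟩ := hp
    obtain ⟨h2, e2⟩ := hq
    refine ⟨by simp only [map_add]; exact h1.add h2, ?_⟩
    rw [map_add, e1, e2, germOf_add, germOf_eq_iff]
    exact Filter.Eventually.of_forall fun y => by simp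
  | mul_X p i hp =>
    obtain ⟨h1, e1⟩ := hp
    refine ⟨by simp only [map_mul, eval_X]; exact h1.mul (hg i), ?_⟩
    rw [map_mul, aeval_X, e1, germOf_mul, germOf_eq_iff]
    exact Filter.Eventually.of_forall fun y => by simp

variable (o e)

/-- The function `|v_k / v_o| ^ 2 - 1`. -/
def modFun (k : ι) (v : E) : ℂ :=
  e v k * (starRingEnd ℂ) (e v k) / (e v o * (starRingEnd ℂ) (e v o)) - 1

/-- The real part of a Cayley coordinate. -/
def reFun (k : ι) (v : E) : ℂ := ((coord o e v k).re : ℂ)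

variable {o e}

lemma modFun_smul (k : ι) (c : ℂ) (hc : c ≠ 0) (v : E) :
    modFun o e k (c • v) = modFun o e k v := by
  have hc' : c * (starRingEnd ℂ) c ≠ 0 := mul_ne_zero hc ((map_ne_zero _).2 hc)
  simp only [modFun, map_smul, Pi.smul_apply, smul_eq_mul, map_mul]
  rw [mul_mul_mul_comm, mul_mul_mul_comm c (e v o), mul_div_mul_left _ _ hc']

lemma reFun_smul (k : ι) (c : ℂ) (hc : c ≠ 0) (v : E) :
    reFun o e k (c • v) = reFun o e k v := by
  rw [reFun, coord_smul hc, reFun]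

lemma analyticAt_modFun (k : ι) {v : E} (h : e v o ≠ 0) : AnalyticAt ℝ (modFun o e k) v := by
  unfold modFun
  refine AnalyticAt.sub (AnalyticAt.div ?_ ?_ ?_) analyticAt_const
  · exact (analyticAt_apply k v).mul (AnalyticAt.conj (analyticAt_apply k v))
  · exact (analyticAt_apply o v).mul (AnalyticAt.conj (analyticAt_apply o v))
  · exact mul_ne_zero h ((map_ne_zero _).2 h)

lemma analyticAt_reFun (k : ι) {v : E} (h : e v k + e v o ≠ 0) : AnalyticAt ℝ (reFun o e k) v :=
  AnalyticAt.re_ofReal (analyticAt_coord k h)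

include he in
lemma ne_zero_of_base (k : ι) : e v₀ k + e v₀ o ≠ 0 := by rw [he, he]; norm_num

include he in
lemma coord_base (k : ι) : coord o e v₀ k = 0 := by simp [coord, he]

include he in
lemma chart_base : chart o e 0 = v₀ := by
  apply e.injective
  funext k
  rw [chart_apply, he, extend_zero, Pi.zero_apply, cayley_zero]

include he in
lemma apply_self_ne_zero : e v₀ o ≠ 0 := by rw [he]; exact one_ne_zero

variable (o e)

include he in
lemma realAnalyticAt_modFun (k : ι) :
    RealAnalyticAt (fun y : ℙ ℂ E => modFun o e k y.rep) (Projectivization.mk ℂ v₀ hv₀) :=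
  realAnalyticAt_rep (modFun_smul k) hv₀ (analyticAt_modFun k (apply_self_ne_zero he))

include he in
lemma realAnalyticAt_reFun (k : ι) :
    RealAnalyticAt (fun y : ℙ ℂ E => reFun o e k y.rep) (Projectivization.mk ℂ v₀ hv₀) :=
  realAnalyticAt_rep (reFun_smul k) hv₀ (analyticAt_reFun k (ne_zero_of_base he k))

/-- The germ of `modFun`. -/
def modGerm (k : {k // k ≠ o}) : analyticGerms (Projectivization.mk ℂ v₀ hv₀) :=
  germOf _ (realAnalyticAt_modFun o e hv₀ he k)

/-- The germ of `reFun`. -/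
def reGerm (k : {k // k ≠ o}) : analyticGerms (Projectivization.mk ℂ v₀ hv₀) :=
  germOf _ (realAnalyticAt_reFun o e hv₀ he k)

lemma pi_eq_sum {J : Type*} [Fintype J] [DecidableEq J] (z : J → ℂ) :
    z = ∑ k, ((z k).re • (Pi.single k (1 : ℂ) : J → ℂ) +
      (z k).im • (Pi.single k Complex.I : J → ℂ)) := by
  funext j
  rw [Finset.sum_apply, Finset.sum_eq_single j]
  · simp
  · intro k _ hk
    simp [Pi.single_eq_of_ne hk.symm]
  · simp

/-- Hadamard's lemma in the Cayley chart writes a germ vanishing at the point as a real linear form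
in the coordinates `z_k` with analytic coefficients. The real parts of the `z_k` are the `reGerm`,
and their imaginary parts are analytic multiples of the `modGerm` by `im_coord`. -/
lemma ker_germValue_eq : RingHom.ker (germValue (Projectivization.mk ℂ v₀ hv₀)) =
    Ideal.span (Set.range (reGerm o e hv₀ he)) ⊔ Ideal.span (Set.range (modGerm o e hv₀ he)) := by
  classical
  set x₀ := Projectivization.mk ℂ v₀ hv₀ with hx₀
  have hb0 := apply_self_ne_zero (o := o) he
  have hbk := ne_zero_of_base (o := o) he
  apply le_antisymm
  · intro a ha
    obtain ⟨g, hg, rfl⟩ := exists_germOf a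
    rw [RingHom.mem_ker, germValue_germOf] at ha
    have hgt : AnalyticAt ℝ (fun z => pullback g (chart o e z)) 0 :=
      AnalyticAt.fun_comp (by rw [chart_base he]; exact hg v₀ hv₀ rfl) analyticAt_chart
    have hg0 : pullback g (chart o e 0) = 0 := by
      rw [chart_base he, pullback_of_ne g hv₀, ← ha]
    obtain ⟨G, hG, hGe⟩ := hgt.exists_eq_add_apply
    have hcoordA : AnalyticAt ℝ (fun v => fun k : {k // k ≠ o} => coord o e v k) v₀ := by
      rw [analyticAt_pi_iff]; exact fun k => analyticAt_coord k.1 (hbk k)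
    have hcoord0 : (fun k : {k // k ≠ o} => coord o e v₀ k) = 0 :=
      funext fun k => coord_base he k
    have hGA : ∀ w : {k // k ≠ o} → ℂ, AnalyticAt ℝ
        (fun v => G (fun k : {k // k ≠ o} => coord o e v k) w) v₀ := fun w => by
      have h1 : AnalyticAt ℝ (fun v => G (fun k : {k // k ≠ o} => coord o e v k)) v₀ :=
        AnalyticAt.fun_comp (by rw [hcoord0]; exact hG) hcoordA
      exact ((ContinuousLinearMap.apply ℝ ℂ w).analyticAt _).fun_comp h1
    have hGs : ∀ w : {k // k ≠ o} → ℂ, ∀ c : ℂ, c ≠ 0 → ∀ v,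
        G (fun k : {k // k ≠ o} => coord o e (c • v) k) w =
          G (fun k : {k // k ≠ o} => coord o e v k) w := fun w c hc v => by
      simp only [coord_smul hc]
    set B : {k // k ≠ o} → E → ℂ := fun k v =>
      G (fun k : {k // k ≠ o} => coord o e v k) (Pi.single k 1) with hB
    -- The first factor is the ratio of the imaginary part of `coord` to `modFun`.
    set D : {k // k ≠ o} → E → ℂ := fun k v =>
      -2 * (e v o * (starRingEnd ℂ) (e v o)) / ((e v k + e v o) * (starRingEnd ℂ) (e v k + e v o)) *
      G (fun k : {k // k ≠ o} => coord o e v k) (Pi.single k Complex.I) with hD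
    have hBs : ∀ k, ∀ c : ℂ, c ≠ 0 → ∀ v, B k (c • v) = B k v := fun k => hGs _
    have hBa : ∀ k, RealAnalyticAt (fun y : ℙ ℂ E => B k y.rep) x₀ := fun k =>
      realAnalyticAt_rep (hGs _) hv₀ (hGA _)
    have hDs : ∀ k, ∀ c : ℂ, c ≠ 0 → ∀ v, D k (c • v) = D k v := fun k c hc v => by
      have hc' : c * (starRingEnd ℂ) c ≠ 0 := mul_ne_zero hc ((map_ne_zero _).2 hc)
      simp only [hD, hGs _ c hc, map_smul, Pi.smul_apply, smul_eq_mul, ← mul_add, map_mul]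
      rw [mul_mul_mul_comm c (e v o), mul_mul_mul_comm c (e v k + e v o),
        mul_left_comm (-2 : ℂ) (c * _), mul_div_mul_left _ _ hc']
    have hDa : ∀ k, RealAnalyticAt (fun y : ℙ ℂ E => D k y.rep) x₀ := fun k => by
      refine realAnalyticAt_rep (hDs k) hv₀ (AnalyticAt.mul (AnalyticAt.div ?_ ?_ ?_) (hGA _))
      · exact analyticAt_const.mul
          ((analyticAt_apply o v₀).mul (AnalyticAt.conj (analyticAt_apply o v₀)))
      · exact ((analyticAt_apply k.1 v₀).add (analyticAt_apply o v₀)).mul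
          (AnalyticAt.conj ((analyticAt_apply k.1 v₀).add (analyticAt_apply o v₀)))
      · exact mul_ne_zero (hbk k) ((map_ne_zero _).2 (hbk k))
    have hsum : germOf g hg = ∑ k, germOf _ (hBa k) * reGerm o e hv₀ he k +
        ∑ k, germOf _ (hDa k) * modGerm o e hv₀ he k := by
      obtain ⟨h1, e1⟩ := germOf_sum Finset.univ
        (fun k y => (B k y.rep * reFun o e k y.rep : ℂ))
        (fun k => (hBa k).mul (realAnalyticAt_reFun o e hv₀ he k))
      obtain ⟨h2, e2⟩ := germOf_sum Finset.univ
        (fun k y => (D k y.rep * modFun o e k y.rep : ℂ))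
        (fun k => (hDa k).mul (realAnalyticAt_modFun o e hv₀ he k))
      refine Eq.trans ?_ (congrArg₂ (· + ·) e1.symm e2.symm)
      rw [germOf_add, germOf_eq_iff, eventually_nhds_mk]
      have t0 : ∀ᶠ v in 𝓝 v₀, e v o ≠ 0 := (analyticAt_apply o v₀).continuousAt.eventually_ne hb0
      have tk : ∀ᶠ v in 𝓝 v₀, ∀ k, e v k + e v o ≠ 0 := Filter.eventually_all.2 fun k =>
        ((analyticAt_apply k v₀).add (analyticAt_apply o v₀)).continuousAt.eventually_ne (hbk k)
      have tG := hcoordA.continuousAt.tendsto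
      rw [hcoord0] at tG
      filter_upwards [t0, tk, tG.eventually hGe] with v h0 hk hG' hv
      rw [← mk_chart_coord hv h0 hk, ← pullback_of_ne g, hG', hg0, zero_add, mk_chart_coord hv h0 hk]
      simp only [Pi.add_apply, apply_rep (reFun_smul _), apply_rep (modFun_smul _),
        apply_rep (hBs _) hv,
        apply_rep (hDs _) hv]
      simp only [hB, hD]
      generalize hL : G (fun k : {k // k ≠ o} => coord o e v k) = L
      rw [pi_eq_sum (fun k : {k // k ≠ o} => coord o e v k), map_sum, ← Finset.sum_add_distrib]
      refine Finset.sum_congr rfl fun k _ => ?_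
      rw [map_add, map_smul, map_smul, Complex.real_smul, Complex.real_smul, reFun]
      have him : (((coord o e v k).im : ℝ) : ℂ) = _ := im_coord h0 (hk k)
      rw [him, modFun]
      ring
    rw [hsum]
    exact Ideal.add_mem _
      (Submodule.mem_sup_left (Ideal.sum_mem _ fun k _ => Ideal.mul_mem_left _ _
        (Ideal.subset_span ⟨k, rfl⟩)))
      (Submodule.mem_sup_right (Ideal.sum_mem _ fun k _ => Ideal.mul_mem_left _ _
        (Ideal.subset_span ⟨k, rfl⟩)))
  · rw [sup_le_iff, Ideal.span_le, Ideal.span_le]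
    constructor
    · rintro _ ⟨k, rfl⟩
      change reFun o e k (Projectivization.mk ℂ v₀ hv₀).rep = 0
      rw [apply_rep (reFun_smul _) hv₀, reFun, coord_base he]
      simp
    · rintro _ ⟨k, rfl⟩
      change modFun o e k (Projectivization.mk ℂ v₀ hv₀).rep = 0
      rw [apply_rep (modFun_smul _) hv₀, modFun, he, he]
      simp

end Multiplicity
end ProjGeom

end

/-! ### Order of vanishing along the torus, and the multiplicity -/

noncomputable section

namespace ProjGeom

open MvPolynomial Asymptotics

section Order

variable {E : Type*} [NormedAddCommGroup E] [NormedSpace ℂ E] {ι : Type*} [Fintype ι] {o : ι}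
  [Fintype {k // k ≠ o}] {e : E ≃L[ℂ] (ι → ℂ)} {v₀ : E} (hv₀ : v₀ ≠ 0) (he : ∀ k, e v₀ k = 1)

variable (o e)

/-- The points of the torus in the Cayley chart. -/
def realPoint (s : {k // k ≠ o} → ℝ) : ℙ ℂ E :=
  Projectivization.mk ℂ (chart o e fun j => (s j : ℂ)) (chart_ne_zero _)

variable {o e}

include he in
lemma tendsto_chart_ofReal : Filter.Tendsto
    (fun s : {k // k ≠ o} → ℝ => chart o e fun j => (s j : ℂ)) (𝓝 0) (𝓝 v₀) := by
  have h1 : Filter.Tendsto (fun s : {k // k ≠ o} → ℝ => fun j => (s j : ℂ)) (𝓝 0) (𝓝 0) := by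
    have : Continuous fun s : {k // k ≠ o} → ℝ => fun j => (s j : ℂ) := by fun_prop
    convert this.tendsto 0 using 2
    funext j
    simp
  rw [← chart_base (o := o) he]
  exact analyticAt_chart.continuousAt.tendsto.comp h1

include he in
lemma tendsto_realPoint : Filter.Tendsto (realPoint o e) (𝓝 0)
    (𝓝 (Projectivization.mk ℂ v₀ hv₀)) :=
  tendsto_mk hv₀ (tendsto_chart_ofReal he) _

include he in
lemma isBigO_one_of_realAnalyticAt {g : ℙ ℂ E → ℂ}
    (hg : RealAnalyticAt g (Projectivization.mk ℂ v₀ hv₀)) :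
    (fun s : {k // k ≠ o} → ℝ => g (realPoint o e s)) =O[𝓝 0] fun s => ‖s‖ ^ 0 := by
  have h1 := (hg v₀ hv₀ rfl).continuousAt.tendsto.comp (tendsto_chart_ofReal (o := o) he)
  have h2 : (fun s : {k // k ≠ o} → ℝ => g (realPoint o e s)) =
      pullback g ∘ fun s : {k // k ≠ o} → ℝ => chart o e fun j => (s j : ℂ) := by
    funext s
    rw [Function.comp_apply, pullback_of_ne g (chart_ne_zero _)]
    rfl
  simp only [pow_zero]
  rw [h2]
  exact h1.isBigO_one ℝ

/-- The ideal of the germs which vanish to order `N` along the torus. -/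
def orderIdeal (N : ℕ) : Ideal (analyticGerms (Projectivization.mk ℂ v₀ hv₀)) where
  carrier := {a | ∃ g : ℙ ℂ E → ℂ, (g : Filter.Germ (𝓝 _) ℂ) = a.1 ∧
    (fun s : {k // k ≠ o} → ℝ => g (realPoint o e s)) =O[𝓝 0] fun s => ‖s‖ ^ N}
  zero_mem' := ⟨0, rfl, isBigO_zero _ _⟩
  add_mem' := by
    rintro a b ⟨g, hg, hgO⟩ ⟨h, hh, hhO⟩
    exact ⟨g + h, by rw [Filter.Germ.coe_add, hg, hh]; rfl, hgO.add hhO⟩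
  smul_mem' := by
    rintro ⟨_, k, hk, rfl⟩ a ⟨g, hg, hgO⟩
    refine ⟨k * g, by rw [Filter.Germ.coe_mul, hg]; rfl, ?_⟩
    have := (isBigO_one_of_realAnalyticAt (o := o) hv₀ he hk).mul hgO
    simpa using this

lemma germOf_mem_orderIdeal {N : ℕ} {g : ℙ ℂ E → ℂ}
    {hg : RealAnalyticAt g (Projectivization.mk ℂ v₀ hv₀)} :
    germOf g hg ∈ orderIdeal (o := o) hv₀ he N ↔
      (fun s : {k // k ≠ o} → ℝ => g (realPoint o e s)) =O[𝓝 0] fun s => ‖s‖ ^ N := by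
  constructor
  · rintro ⟨h, hh, hO⟩
    refine hO.congr' ?_ Filter.EventuallyEq.rfl
    exact (tendsto_realPoint hv₀ he).eventually (Filter.Germ.coe_eq.1 hh)
  · exact fun h => ⟨g, rfl, h⟩

lemma antitone_orderIdeal : Antitone (orderIdeal (o := o) hv₀ he) := by
  intro a b hab x hx
  obtain ⟨g, hg, rfl⟩ := exists_germOf x
  rw [germOf_mem_orderIdeal] at hx ⊢
  exact hx.trans (isBigO_norm_pow_of_le hab)

lemma vanishingIdeal_le_orderIdeal (N : ℕ) :
    vanishingIdeal (torus o e) (Projectivization.mk ℂ v₀ hv₀) ≤ orderIdeal (o := o) hv₀ he N := by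
  intro x hx
  obtain ⟨g, hg, rfl⟩ := exists_germOf x
  rw [germOf_mem_vanishingIdeal] at hx
  rw [germOf_mem_orderIdeal]
  refine (isBigO_zero _ _).congr' ?_ Filter.EventuallyEq.rfl
  filter_upwards [(tendsto_realPoint hv₀ he).eventually hx] with s hs
  exact (hs (chart_ofReal_mem_torus s)).symm

lemma mul_mem_orderIdeal {M N : ℕ} {a b : analyticGerms (Projectivization.mk ℂ v₀ hv₀)}
    (ha : a ∈ orderIdeal (o := o) hv₀ he M) (hb : b ∈ orderIdeal (o := o) hv₀ he N) :
    a * b ∈ orderIdeal (o := o) hv₀ he (M + N) := by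
  obtain ⟨g, hg, rfl⟩ := exists_germOf a
  obtain ⟨h, hh, rfl⟩ := exists_germOf b
  rw [germOf_mem_orderIdeal] at ha hb
  rw [germOf_mul, germOf_mem_orderIdeal]
  simp only [pow_add]
  exact ha.mul hb

lemma reFun_realPoint (k : {k // k ≠ o}) (s : {k // k ≠ o} → ℝ) :
    reFun o e k (realPoint o e s).rep = s k := by
  rw [realPoint, apply_rep (reFun_smul _) (chart_ne_zero _), reFun, coord_chart_ofReal, extend_coe,
    Complex.ofReal_re]

lemma modGerm_mem (k : {k // k ≠ o}) :
    modGerm o e hv₀ he k ∈ vanishingIdeal (torus o e) (Projectivization.mk ℂ v₀ hv₀) := by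
  refine germOf_mem_vanishingIdeal.2 (Filter.Eventually.of_forall fun y hy => ?_)
  have h0 := apply_ne_zero_of_mem_torus y.rep_nonzero hy o
  rw [modFun, Complex.mul_conj, Complex.mul_conj, Complex.normSq_eq_norm_sq,
    Complex.normSq_eq_norm_sq, hy k, div_self, sub_self]
  simpa using h0

lemma ker_germValue_pow_le_orderIdeal (N : ℕ) :
    RingHom.ker (germValue (Projectivization.mk ℂ v₀ hv₀)) ^ N ≤ orderIdeal (o := o) hv₀ he N := by
  have h1 : RingHom.ker (germValue (Projectivization.mk ℂ v₀ hv₀)) ≤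
      orderIdeal (o := o) hv₀ he 1 := by
    rw [ker_germValue_eq o e hv₀ he, sup_le_iff, Ideal.span_le, Ideal.span_le]
    constructor
    · rintro _ ⟨k, rfl⟩
      refine (germOf_mem_orderIdeal hv₀ he).2 ?_
      simp only [reFun_realPoint]
      rw [← isBigO_norm_left]
      simp only [Complex.norm_real]
      have := (isBigO_extend (o := o) k.1).norm_left
      simpa only [extend_coe] using this
    · rintro _ ⟨k, rfl⟩
      exact vanishingIdeal_le_orderIdeal hv₀ he 1 (modGerm_mem hv₀ he k)
  induction N with
  | zero =>
    rintro x -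
    obtain ⟨g, hg, rfl⟩ := exists_germOf x
    exact (germOf_mem_orderIdeal hv₀ he).2 (isBigO_one_of_realAnalyticAt hv₀ he hg)
  | succ N ih =>
    rw [pow_succ, Ideal.mul_le]
    exact fun a ha b hb => mul_mem_orderIdeal hv₀ he (ih ha) (h1 hb)

lemma mem_pow_idealOfVars_of_aeval_mem (N : ℕ) (p : MvPolynomial {k // k ≠ o} ℂ)
    (h : aeval (reGerm o e hv₀ he) p ∈ orderIdeal (o := o) hv₀ he N) :
    p ∈ idealOfVars {k // k ≠ o} ℂ ^ N := by
  obtain ⟨h1, e1⟩ := aeval_germOf (fun (k : {k // k ≠ o}) y => reFun o e k y.rep)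
    (fun k => realAnalyticAt_reFun o e hv₀ he k) p
  have e2 : aeval (reGerm o e hv₀ he) p = _ := e1
  rw [e2, germOf_mem_orderIdeal] at h
  simp only [reFun_realPoint] at h
  exact mem_pow_idealOfVars_of_isBigO p N h

end Order

section Multiplicity

variable {E : Type} [NormedAddCommGroup E] [NormedSpace ℂ E] {ι : Type} [Fintype ι] {o : ι}
  [Fintype {k // k ≠ o}] {e : E ≃L[ℂ] (ι → ℂ)} {v₀ : E}

/-- The algebraic multiplicity of the intersection of the torus with its inverse image by a
unitary map whose matrix is a real matrix with row sums `1`, in terms of quadratic forms. -/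
theorem intersectionMultiplicity_torus (hv₀ : v₀ ≠ 0) (he : ∀ k, e v₀ k = 1) (u : E ≃ₗᵢ[ℂ] E)
    {ζ : ℂ} (hζ : ‖ζ‖ = 1) (K : ι → ι → ℝ) (hK : ∀ k, ∑ l, K k l = 1)
    (hu : ∀ v k, e (u v) k = ζ * ∑ l, (K k l : ℂ) * e v l)
    (hfin : ∀ Φ : {k // k ≠ o} → MvPolynomial {k // k ≠ o} ℂ,
      (∀ k, Φ k - quadPoly o (fun k l => (K k l : ℂ)) k ∈ idealOfVars {k // k ≠ o} ℂ ^ 3) →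
      ∀ N, Fintype.card {k // k ≠ o} < N → Module.finrank ℂ (MvPolynomial {k // k ≠ o} ℂ ⧸
        (Ideal.span (Set.range Φ) ⊔ idealOfVars {k // k ≠ o} ℂ ^ N)) =
          2 ^ Fintype.card {k // k ≠ o}) :
    intersectionMultiplicity (torus o e) (unitaryPreimage u (torus o e))
      (Projectivization.mk ℂ v₀ hv₀) = 2 ^ Fintype.card {k // k ≠ o} := by
  have hζ0 : ζ ≠ 0 := norm_ne_zero_iff.1 (by rw [hζ]; exact one_ne_zero)
  have huv : u v₀ = ζ • v₀ := by
    apply e.injective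
    funext k
    simp only [hu, map_smul, Pi.smul_apply, he, mul_one, smul_eq_mul]
    rw [← Complex.ofReal_sum, hK, Complex.ofReal_one, mul_one]
  have hx : projMap u (Projectivization.mk ℂ v₀ hv₀) = Projectivization.mk ℂ v₀ hv₀ := by
    rw [projMap_mk, Projectivization.mk_eq_mk_iff']
    exact ⟨ζ, huv.symm⟩
  have hb0 := apply_self_ne_zero (o := o) he
  -- The unit `φ` clears the denominator of the pulled back `modFun`: the product is the difference
  -- of the square moduli of the coordinates `k` and `o` of `u v`, divided by that of `v o`.
  set φ : E → ℂ := fun v => e (u v) o * (starRingEnd ℂ) (e (u v) o) /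
    (e v o * (starRingEnd ℂ) (e v o)) with hφ
  have hφs : ∀ c : ℂ, c ≠ 0 → ∀ v, φ (c • v) = φ v := fun c hc v => by
    have hc' : c * (starRingEnd ℂ) c ≠ 0 := mul_ne_zero hc ((map_ne_zero _).2 hc)
    simp only [hφ, map_smul, Pi.smul_apply, smul_eq_mul, map_mul]
    rw [mul_mul_mul_comm c (e (u v) o), mul_mul_mul_comm c (e v o), mul_div_mul_left _ _ hc']
  have huA : AnalyticAt ℝ (fun v => e (u v) o) v₀ :=
    (analyticAt_apply (e := e) o (u v₀)).fun_comp
      (((u.toContinuousLinearEquiv : E →L[ℂ] E).restrictScalars ℝ).analyticAt v₀)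
  have hφA : AnalyticAt ℝ φ v₀ := by
    refine AnalyticAt.div ?_ ?_ (mul_ne_zero hb0 ((map_ne_zero _).2 hb0))
    · exact huA.mul (AnalyticAt.conj huA)
    · exact (analyticAt_apply o v₀).mul (AnalyticAt.conj (analyticAt_apply o v₀))
  have hφr := realAnalyticAt_rep hφs hv₀ hφA
  have hφ0 : φ v₀ ≠ 0 := by
    simp only [hφ, huv, map_smul, Pi.smul_apply, he, smul_eq_mul, map_one, mul_one, div_one]
    exact mul_ne_zero hζ0 ((map_ne_zero _).2 hζ0)
  have hval : ∀ (s : {k // k ≠ o} → ℝ) k,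
      e (u (chart o e fun j => (s j : ℂ))) k * (starRingEnd ℂ)
        (e (u (chart o e fun j => (s j : ℂ))) k) =
      (∑ l, (K k l : ℂ) * cayley (extend o s l : ℝ)) *
        (starRingEnd ℂ) (∑ l, (K k l : ℂ) * cayley (extend o s l : ℝ)) := fun s k => by
    have hζζ : ζ * (starRingEnd ℂ) ζ = 1 := by
      rw [Complex.mul_conj, Complex.normSq_eq_norm_sq, hζ]; simp
    simp only [hu, chart_apply, ofReal_extend]
    rw [map_mul, mul_mul_mul_comm, hζζ, one_mul]
  refine LocalMultiplicity.rank_quotient_eq (reGerm o e hv₀ he) (modGerm o e hv₀ he)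
    (RingHom.ker (germValue _)) (ker_germValue_eq o e hv₀ he) ker_germValue_le_jacobson
    (fun a => ⟨_, sub_germValue_mem a⟩) _ _ (modGerm_mem hv₀ he) (orderIdeal (o := o) hv₀ he)
    (antitone_orderIdeal hv₀ he) (vanishingIdeal_le_orderIdeal hv₀ he)
    (ker_germValue_pow_le_orderIdeal hv₀ he) (mem_pow_idealOfVars_of_aeval_mem hv₀ he)
    (germPullback u hx) (map_germPullback_ker_le u hx)
    (fun x hx' => exists_germPullback_eq u hx hx')
    (fun k => germPullback_mem u hx (modGerm_mem hv₀ he k))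
    (fun _ => germOf _ hφr) (fun k => isUnit_germ ?_)
    (quadPoly o fun k l => (K k l : ℂ)) (fun k => ?_) hfin
  · rw [germValue_germOf, apply_rep hφs hv₀]
    exact hφ0
  · obtain ⟨h1, e1⟩ := aeval_germOf (fun (k : {k // k ≠ o}) y => reFun o e k y.rep)
      (fun k => realAnalyticAt_reFun o e hv₀ he k) (quadPoly o (fun k l => (K k l : ℂ)) k)
    have e2 : aeval (reGerm o e hv₀ he) (quadPoly o (fun k l => (K k l : ℂ)) k) = _ := e1
    rw [e2, ← neg_neg (germOf _ h1), ← neg_one_mul (germOf _ h1), sub_neg_eq_add,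
      ← map_one (algebraMap ℂ _), ← map_neg, algebraMap_germ, modGerm, germPullback_germOf,
      germOf_mul, germOf_mul, germOf_add, germOf_mem_orderIdeal]
    -- The constant terms of the expansions at `k` and at `o` cancel in the difference, and
    -- `quadPoly` remains.
    refine ((isBigO_sq_sub_quad K hK k.1).sub (isBigO_sq_sub_quad (o := o) K hK o)).congr' ?_
      Filter.EventuallyEq.rfl
    have hne : ∀ᶠ s : {k // k ≠ o} → ℝ in 𝓝 0, e (u (chart o e fun j => (s j : ℂ))) o ≠ 0 := by
      refine ((huA.continuousAt.tendsto.comp (tendsto_chart_ofReal (o := o) he))).eventually_ne ?_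
      simpa [huv, he] using hζ0
    filter_upwards [hne] with s hs
    simp only [Pi.add_apply, Pi.mul_apply, Function.comp_apply, reFun_realPoint, eval_quadPoly]
    rw [realPoint, projMap_mk, apply_rep hφs (chart_ne_zero _),
      apply_rep (modFun_smul _) (map_ne_zero_of_ne u (chart_ne_zero _))]
    simp only [hφ, modFun, chart_apply_self, map_one, mul_one, div_one]
    have hs' : e (u (chart o e fun j => (s j : ℂ))) o * (starRingEnd ℂ)
        (e (u (chart o e fun j => (s j : ℂ))) o) ≠ 0 := mul_ne_zero hs ((map_ne_zero _).2 hs)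
    rw [mul_sub, mul_one, mul_div_cancel₀ _ hs', hval, hval]
    push_cast
    ring

end Multiplicity
end ProjGeom

end

/-! ### Tangent spaces of tori, tangency and transversality -/

noncomputable section

namespace ProjGeom

section Tangent

variable {E : Type*} [NormedAddCommGroup E] [NormedSpace ℂ E] {ι : Type*} [Fintype ι] {o : ι}
  {e : E ≃L[ℂ] (ι → ℂ)}

variable (o e)

/-- The linear equations of the tangent space of the torus at `v`. -/
def IsTorusTangent (v ξ : E) : Prop :=
  ∀ k, ((starRingEnd ℂ) (e v k) * e ξ k).re = ((starRingEnd ℂ) (e v o) * e ξ o).re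

variable {o e}

lemma hasDerivAt_normSq {f : ℝ → ℂ} {f' : ℂ} {t : ℝ} (hf : HasDerivAt f f' t) :
    HasDerivAt (fun s => ‖f s‖ ^ 2) (2 * ((starRingEnd ℂ) (f t) * f').re) t := by
  have h := hf.norm_sq
  rw [Complex.inner, mul_comm] at h
  rw [mul_comm ((starRingEnd ℂ) (f t))]
  convert h using 1
  ring_nf

lemma tangentVectors_torus {v : E} (hv : v ≠ 0) (h : ∀ k, ‖e v k‖ = ‖e v o‖) :
    tangentVectors (torus o e) v =
      {x | ∃ ξ, IsTorusTangent o e v ξ ∧ Submodule.Quotient.mk ξ = x} := by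
  ext x
  constructor
  · rintro ⟨γ, hγ, hγ0, hT, rfl⟩
    refine ⟨_, fun k => ?_, rfl⟩
    have hd : HasDerivAt γ (deriv γ 0) 0 :=
      (hγ.differentiableAt (by simp)).hasDerivAt
    have hdk : ∀ k, HasDerivAt (fun t => e (γ t) k) (e (deriv γ 0) k) 0 := fun k =>
      (((ContinuousLinearMap.proj (R := ℂ) (φ := fun _ : ι => ℂ) k).comp
        (e : E →L[ℂ] (ι → ℂ))).restrictScalars ℝ).hasFDerivAt.comp_hasDerivAt 0 hd
    have h1 := hasDerivAt_normSq (hdk k)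
    have h2 := hasDerivAt_normSq (hdk o)
    have h3 : (fun t => ‖e (γ t) k‖ ^ 2) =ᶠ[𝓝 0] fun t => ‖e (γ t) o‖ ^ 2 := by
      filter_upwards [hT] with t ⟨ht0, ht⟩
      rw [(mk_mem_torus ht0).1 ht k]
    have h4 := (h2.congr_of_eventuallyEq h3).unique h1
    simp only [hγ0] at h4
    linarith
  · rintro ⟨ξ, hξ, rfl⟩
    have hne := apply_ne_zero_of_mem_torus hv h
    -- The moduli remain equal along this curve of velocity `ξ`, because the tangent equations say
    -- that the real part of `ξ_k / v_k` does not depend on `k`.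
    set f : ℝ → ι → ℂ := fun t k => e v k * Complex.exp ((t : ℂ) * (e ξ k / e v k)) with hf
    have hf0 : f 0 = e v := by funext k; simp [hf]
    have hfs : ContDiff ℝ ∞ f := by
      rw [contDiff_pi]
      intro k
      exact contDiff_const.mul ((Complex.ofRealCLM.contDiff.mul contDiff_const).cexp)
    have hfd : HasDerivAt f (e ξ) 0 := by
      rw [hasDerivAt_pi]
      intro k
      have h1 : HasDerivAt (fun t : ℝ => (t : ℂ) * (e ξ k / e v k)) (e ξ k / e v k) 0 := by
        simpa using (Complex.ofRealCLM.hasDerivAt (x := 0)).mul_const (e ξ k / e v k)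
      have h2 := (h1.cexp).const_mul (e v k)
      simpa [mul_div_cancel₀ _ (hne k)] using h2
    have hre : ∀ k, (e ξ k / e v k).re =
        ((starRingEnd ℂ) (e v k) * e ξ k).re / ‖e v k‖ ^ 2 := fun k => by
      rw [Complex.div_re, ← Complex.normSq_eq_norm_sq]
      simp only [Complex.mul_re, Complex.conj_re, Complex.conj_im]
      ring
    have hconst : ∀ k, (e ξ k / e v k).re = (e ξ o / e v o).re := fun k => by
      rw [hre, hre, hξ k, h k]
    have hnorm : ∀ t k, ‖f t k‖ = ‖f t o‖ := fun t k => by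
      simp only [hf, norm_mul, Complex.norm_exp, Complex.re_ofReal_mul, hconst k, h k]
    have hd : HasDerivAt (fun t => e.symm (f t)) ξ 0 := by
      have := (((e.symm : (ι → ℂ) →L[ℂ] E).restrictScalars ℝ).hasFDerivAt).comp_hasDerivAt 0 hfd
      simpa [Function.comp_def] using this
    refine ⟨fun t => e.symm (f t), ?_, by simp [hf0], Filter.Eventually.of_forall fun t => ?_, ?_⟩
    · exact (((e.symm : (ι → ℂ) →L[ℂ] E).restrictScalars ℝ).contDiff.comp hfs).contDiffAt
    · have h0 : e.symm (f t) ≠ 0 := by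
        intro h0
        have h1 : f t o = 0 := by
          have := congrArg (fun w => e w o) h0
          simpa using this
        simp only [hf, mul_eq_zero, hne o, Complex.exp_ne_zero, or_self] at h1
      refine ⟨h0, (mk_mem_torus h0).2 fun k => ?_⟩
      simp only [ContinuousLinearEquiv.apply_symm_apply, hnorm t k]
    · rw [hd.deriv]

lemma unitaryPreimage_torus (u : E ≃ₗᵢ[ℂ] E) :
    unitaryPreimage u (torus o e) = torus o (u.toContinuousLinearEquiv.trans e) := by
  ext x
  induction x using Projectivization.ind with
  | h v hv =>
    rw [mk_mem_torus]
    exact mk_mem_torus (map_ne_zero_of_ne u hv)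

/-- A common tangent vector in `E / ℂ v` has a priori two representatives, one for each torus. As
the tangent equations are invariant under `ξ ↦ ξ + c v`, a single `ξ` satisfies both systems. -/
lemma transverseAt_torus (u : E ≃ₗᵢ[ℂ] E) {x : ℙ ℂ E}
    (hx : x ∈ torus o e ∩ unitaryPreimage u (torus o e))
    (H : ∀ (v : E) (hv : v ≠ 0), Projectivization.mk ℂ v hv = x → ∀ ξ, IsTorusTangent o e v ξ →
      IsTorusTangent o e (u v) (u ξ) → ξ ∈ Submodule.span ℂ {v}) :
    TransverseAt (torus o e) (unitaryPreimage u (torus o e)) x := by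
  rintro v hv rfl
  obtain ⟨h1, h2⟩ := hx
  rw [unitaryPreimage_torus] at h2 ⊢
  rw [mk_mem_torus] at h1 h2
  rw [tangentVectors_torus hv h1, tangentVectors_torus hv h2]
  have hmem : ∀ (e' : E ≃L[ℂ] (ι → ℂ)), (∀ k, ‖e' v k‖ = ‖e' v o‖) → ∀ (c : ℂ) (ξ : E),
      IsTorusTangent o e' v ξ → IsTorusTangent o e' v (ξ + c • v) := by
    intro e' he' c ξ hξ k
    have : ∀ k, ((starRingEnd ℂ) (e' v k) * e' (ξ + c • v) k).re =
        ((starRingEnd ℂ) (e' v k) * e' ξ k).re + c.re * ‖e' v k‖ ^ 2 := fun k => by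
      have h3 : (starRingEnd ℂ) (e' v k) * e' (ξ + c • v) k =
          (starRingEnd ℂ) (e' v k) * e' ξ k + c * ((‖e' v k‖ ^ 2 : ℝ) : ℂ) := by
        rw [← Complex.normSq_eq_norm_sq, Complex.normSq_eq_conj_mul_self]
        simp only [map_add, map_smul, Pi.add_apply, Pi.smul_apply, smul_eq_mul]
        ring
      rw [h3, Complex.add_re, Complex.re_mul_ofReal]
    rw [this, this, hξ k, he' k]
  apply Set.eq_singleton_iff_unique_mem.2
  constructor
  · exact ⟨⟨0, fun k => by simp, by simp⟩, ⟨0, fun k => by simp, by simp⟩⟩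
  · rintro _ ⟨⟨ξ, hξ, rfl⟩, ⟨ξ', hξ', hh⟩⟩
    rw [Submodule.Quotient.eq, Submodule.mem_span_singleton] at hh
    obtain ⟨c, hc⟩ := hh
    rw [Submodule.Quotient.mk_eq_zero]
    refine H v hv rfl ξ hξ ?_
    have h4 := hmem _ h2 (-c) ξ' hξ'
    rw [neg_smul, hc] at h4
    rw [show ξ' + -(ξ' - ξ) = ξ by abel] at h4
    exact h4

/-- Tangency of the torus with its inverse image by a unitary map whose matrix is a real
involution with row sums `1`. -/
theorem tangentAt_torus {v₀ : E} (hv₀ : v₀ ≠ 0) (he : ∀ k, e v₀ k = 1) (u : E ≃ₗᵢ[ℂ] E)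
    {ζ : ℂ} (hζ : ‖ζ‖ = 1) (K : ι → ι → ℝ) (hK : ∀ k, ∑ l, K k l = 1)
    (hK2 : ∀ x : ι → ℝ, ∀ k, ∑ l, K k l * ∑ j, K l j * x j = x k)
    (hu : ∀ v k, e (u v) k = ζ * ∑ l, (K k l : ℂ) * e v l) :
    TangentAt (torus o e) (unitaryPreimage u (torus o e)) (Projectivization.mk ℂ v₀ hv₀) := by
  have huv : ∀ k, e (u v₀) k = ζ := fun k => by
    simp only [hu, he, mul_one]
    rw [← Complex.ofReal_sum, hK, Complex.ofReal_one, mul_one]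
  refine ⟨⟨(mk_mem_torus hv₀).2 fun k => by rw [he, he], ?_⟩, fun v hv hx => ?_⟩
  · rw [unitaryPreimage_torus, mk_mem_torus]
    intro k
    change ‖e (u v₀) k‖ = ‖e (u v₀) o‖
    rw [huv, huv]
  · rw [Projectivization.mk_eq_mk_iff'] at hx
    obtain ⟨c, rfl⟩ := hx
    have h1 : ∀ k, ‖e (c • v₀) k‖ = ‖e (c • v₀) o‖ := fun k => by simp [he]
    have h2 : ∀ k, ‖u.toContinuousLinearEquiv.trans e (c • v₀) k‖ =
        ‖u.toContinuousLinearEquiv.trans e (c • v₀) o‖ := fun k => by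
      change ‖e (u (c • v₀)) k‖ = ‖e (u (c • v₀)) o‖
      simp [huv]
    rw [unitaryPreimage_torus, tangentVectors_torus hv h1, tangentVectors_torus hv h2]
    -- With `x_k` the real part of `conj c * ξ_k`, the two systems say that `x` is constant and that
    -- `K x` is constant. They are equivalent because `K` fixes the constants and is an involution.
    have key : ∀ ξ, IsTorusTangent o e (c • v₀) ξ ↔
        IsTorusTangent o (u.toContinuousLinearEquiv.trans e) (c • v₀) ξ := by
      intro ξ
      set x : ι → ℝ := fun k => ((starRingEnd ℂ) c * e ξ k).re with hx
      have hA : IsTorusTangent o e (c • v₀) ξ ↔ ∀ k, x k = x o := by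
        simp [IsTorusTangent, he, hx]
      have hB : IsTorusTangent o (u.toContinuousLinearEquiv.trans e) (c • v₀) ξ ↔
          ∀ k, ∑ l, K k l * x l = ∑ l, K o l * x l := by
        have h3 : ∀ k, ((starRingEnd ℂ) (e (u (c • v₀)) k) * e (u ξ) k).re =
            ∑ l, K k l * x l := fun k => by
          have hζζ : (starRingEnd ℂ) ζ * ζ = 1 := by
            rw [← Complex.normSq_eq_conj_mul_self, Complex.normSq_eq_norm_sq, hζ]; simp
          have h4 : (starRingEnd ℂ) (e (u (c • v₀)) k) * e (u ξ) k =
              ∑ l, (K k l : ℂ) * ((starRingEnd ℂ) c * e ξ l) := by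
            rw [map_smul, map_smul, Pi.smul_apply, huv, hu, smul_eq_mul, map_mul]
            calc _ = ((starRingEnd ℂ) ζ * ζ) * ((starRingEnd ℂ) c * ∑ l, (K k l : ℂ) * e ξ l) := by
                  ring
              _ = _ := by
                  rw [hζζ, one_mul, Finset.mul_sum]
                  exact Finset.sum_congr rfl fun l _ => by ring
          rw [h4, Complex.re_sum]
          exact Finset.sum_congr rfl fun l _ => by rw [Complex.re_ofReal_mul]
        unfold IsTorusTangent
        change (∀ k, ((starRingEnd ℂ) (e (u (c • v₀)) k) * e (u ξ) k).re =
          ((starRingEnd ℂ) (e (u (c • v₀)) o) * e (u ξ) o).re) ↔ _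
        simp only [h3]
      rw [hA, hB]
      constructor
      · intro h k
        simp only [h, ← Finset.sum_mul, hK]
      · intro h k
        rw [← hK2 x k, ← hK2 x o]
        simp only [h, ← Finset.sum_mul, hK]
    simp only [key]

end Tangent
end ProjGeom

end

/-! ### Persistence of regular zeros and Sard's lemma -/

noncomputable section

namespace RegularZeros

section Count

variable {W : Type*} [NormedAddCommGroup W] [NormedSpace ℝ W] [FiniteDimensional ℝ W]

/-- The derivative of `f` in the direction of the first factor. -/
def partialFst (f : W × ℝ → W) (x : W × ℝ) : W →L[ℝ] W :=
  (fderiv ℝ f x).comp (ContinuousLinearMap.inl ℝ W ℝ)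

/-- The inverse function theorem is applied to `(y, σ) ↦ (f (y, σ), σ)`, so that the same `U` serves
for all small `σ`. -/
lemma exists_injOn_nhds {f : W × ℝ → W} (hf : ContDiff ℝ 1 f) {η : W}
    (h : Function.Injective (partialFst f (η, 0))) :
    ∃ U ∈ 𝓝 η, ∀ᶠ σ in 𝓝 (0 : ℝ), Set.InjOn (fun y => f (y, σ)) U := by
  have hs : HasStrictFDerivAt (fun x : W × ℝ => (f x, x.2))
      ((fderiv ℝ f (η, 0)).prod (ContinuousLinearMap.snd ℝ W ℝ)) (η, 0) :=
    (hf.contDiffAt.hasStrictFDerivAt (by simp)).prodMk hasStrictFDerivAt_snd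
  set L := (fderiv ℝ f (η, 0)).prod (ContinuousLinearMap.snd ℝ W ℝ) with hL
  have hinj : Function.Injective (L : W × ℝ →ₗ[ℝ] W × ℝ) := by
    rw [← LinearMap.ker_eq_bot, LinearMap.ker_eq_bot']
    rintro ⟨a, b⟩ hab
    have h2 : b = 0 := congrArg Prod.snd hab
    have h1 : fderiv ℝ f (η, 0) (a, b) = 0 := congrArg Prod.fst hab
    subst h2
    have h3 : partialFst f (η, 0) a = partialFst f (η, 0) 0 := by
      rw [map_zero]; exact h1
    rw [h h3]
    rfl
  set L' : (W × ℝ) ≃L[ℝ] (W × ℝ) :=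
    (LinearEquiv.ofInjectiveEndo (L : W × ℝ →ₗ[ℝ] W × ℝ) hinj).toContinuousLinearEquiv with hL'
  have hLL : (L' : W × ℝ →L[ℝ] W × ℝ) = L := by ext x <;> rfl
  rw [← hLL] at hs
  have hsrc := (hs.toOpenPartialHomeomorph _).open_source.mem_nhds hs.mem_toOpenPartialHomeomorph_source
  rw [nhds_prod_eq, Filter.mem_prod_iff] at hsrc
  obtain ⟨U, hU, V, hV, hUV⟩ := hsrc
  refine ⟨U, hU, ?_⟩
  filter_upwards [hV] with σ hσ y hy y' hy' hyy
  have := (hs.toOpenPartialHomeomorph _).injOn (hUV (Set.mk_mem_prod hy hσ))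
    (hUV (Set.mk_mem_prod hy' hσ)) (by
      simp only [HasStrictFDerivAt.toOpenPartialHomeomorph_coe, Prod.mk.injEq, and_true]
      exact hyy)
  exact congrArg Prod.fst this

/-- Persistence of the number and of the regularity of the zeros in a ball. -/
theorem eventually_encard_le {f : W × ℝ → W} (hf : ContDiff ℝ 1 f)
    (hreg : ∀ η, f (η, 0) = 0 → Function.Injective (partialFst f (η, 0)))
    (hfin : {η | f (η, 0) = 0}.Finite) (R : ℝ) :
    ∀ᶠ σ in 𝓝 (0 : ℝ), {η | ‖η‖ ≤ R ∧ f (η, σ) = 0}.encard ≤ {η | f (η, 0) = 0}.encard ∧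
      ∀ η, ‖η‖ ≤ R → f (η, σ) = 0 → Function.Injective (partialFst f (η, σ)) := by
  set Z := {η | f (η, 0) = 0} with hZ
  choose! U hU hUi using fun η (h : η ∈ Z) => exists_injOn_nhds hf (hreg η h)
  have hD : Continuous (partialFst f) :=
    (hf.continuous_fderiv (by simp)).clm_comp continuous_const
  -- Near a point of the ball, either `f` does not vanish, or its zeros are regular and confined to
  -- some `U z`; compactness makes this uniform in `σ`.
  have h1 : ∀ η₀ ∈ Metric.closedBall (0 : W) R, ∀ᶠ x : W × ℝ in 𝓝 η₀ ×ˢ 𝓝 (0 : ℝ),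
      f x = 0 → (∃ z ∈ Z, x.1 ∈ U z) ∧ Function.Injective (partialFst f x) := by
    intro η₀ _
    rw [← nhds_prod_eq]
    by_cases h0 : f (η₀, 0) = 0
    · have ha : ∀ᶠ x : W × ℝ in 𝓝 (η₀, 0), x.1 ∈ U η₀ :=
        continuous_fst.continuousAt.eventually (hU η₀ h0)
      have hb : ∀ᶠ x : W × ℝ in 𝓝 (η₀, 0), Function.Injective (partialFst f x) :=
        hD.continuousAt.eventually (ContinuousLinearMap.isOpen_injective.mem_nhds (hreg η₀ h0))
      filter_upwards [ha, hb] with x hxa hxb _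
      exact ⟨⟨η₀, h0, hxa⟩, hxb⟩
    · filter_upwards [hf.continuous.continuousAt.eventually_ne h0] with x hx hx0
      exact absurd hx0 hx
  have h2 := (isCompact_closedBall (0 : W) R).eventually_forall_of_forall_eventually
    (x₀ := (0 : ℝ)) (P := fun σ η => f (η, σ) = 0 → (∃ z ∈ Z, η ∈ U z) ∧
      Function.Injective (partialFst f (η, σ))) (fun η hη => by
        have := h1 η hη
        rw [← nhds_prod_eq] at this
        exact (continuous_swap.tendsto ((0 : ℝ), η)).eventually this)
  have h3 : ∀ᶠ σ in 𝓝 (0 : ℝ), ∀ z ∈ Z, Set.InjOn (fun y => f (y, σ)) (U z) :=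
    (Filter.eventually_all_finite hfin).2 hUi
  filter_upwards [h2, h3] with σ hσ hσ'
  refine ⟨?_, fun η hη h0 => (hσ η (by simpa using hη) h0).2⟩
  -- Each zero at parameter `σ` is attached to a zero at parameter `0`; injectivity on the sets `U
  -- z` makes this assignment injective.
  choose! g hg hgU using fun η (h : ‖η‖ ≤ R ∧ f (η, σ) = 0) => (hσ η (by simpa using h.1) h.2).1
  refine Set.encard_le_encard_of_injOn (f := g) (fun η hη => hg η hη) fun η hη η' hη' he => ?_
  refine hσ' (g η) (hg η hη) (hgU η hη) ?_ ?_
  · rw [he]; exact hgU η' hη'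
  · simp only [hη.2, hη'.2]

end Count

/-- By Sard's lemma there are pairs of opposite regular values. -/
theorem exists_regular {J : Type*} [Fintype J] [Nonempty J] {q : (J → ℝ) → (J → ℝ)}
    (hq : Differentiable ℝ q) :
    ∃ c ≠ 0, ∀ η, q η = c ∨ q η = -c → Function.Injective (fderiv ℝ q η) := by
  classical
  set S := q '' {η | (fderiv ℝ q η).det = 0} with hS
  have h0 : MeasureTheory.volume S = 0 :=
    MeasureTheory.addHaar_image_eq_zero_of_det_fderivWithin_eq_zero MeasureTheory.volume
      (fun x _ => (hq x).hasFDerivAt.hasFDerivWithinAt) fun x hx => hx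
  have h1 : MeasureTheory.volume (-S) = 0 := by
    rw [MeasureTheory.Measure.measure_neg, h0]
  have h2 : MeasureTheory.volume ({0} : Set (J → ℝ)) = 0 := MeasureTheory.measure_singleton 0
  have h3 : MeasureTheory.volume ((S ∪ -S) ∪ {0}) = 0 :=
    MeasureTheory.measure_union_null (MeasureTheory.measure_union_null h0 h1) h2
  -- Both signs are avoided because the choice between `c` and `-c` is made later, by counting.
  obtain ⟨c, hc⟩ : ((S ∪ -S) ∪ {0})ᶜ.Nonempty := by
    rw [Set.nonempty_compl]
    intro h
    rw [h] at h3
    exact NeZero.ne (MeasureTheory.volume : MeasureTheory.Measure (J → ℝ))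
      (MeasureTheory.Measure.measure_univ_eq_zero.1 h3)
  simp only [Set.mem_compl_iff, Set.mem_union, Set.mem_singleton_iff, not_or, Set.mem_neg] at hc
  refine ⟨c, hc.2, fun η hη => ?_⟩
  have hdet : (fderiv ℝ q η).det ≠ 0 := by
    intro hd
    rcases hη with hη | hη
    · exact hc.1.1 ⟨η, hd, hη⟩
    · exact hc.1.2 ⟨η, hd, hη⟩
  exact (LinearMap.equivOfDetNeZero (fderiv ℝ q η : (J → ℝ) →ₗ[ℝ] (J → ℝ)) hdet).injective

end RegularZeros

end

/-! ### Real fibres of the quadratic map -/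

noncomputable section

namespace ProjGeom

open MvPolynomial Asymptotics

section QuadMap

variable {ι : Type*} [Fintype ι] {o : ι} [Fintype {k // k ≠ o}]

variable (o) in
/-- The differences of the quadratic forms `quad`. -/
def quadMap (K : ι → ι → ℝ) (s : {k // k ≠ o} → ℝ) (k : {k // k ≠ o}) : ℝ :=
  quad o K s k - quad o K s o

lemma extend_smul (t : ℝ) (s : {k // k ≠ o} → ℝ) (l : ι) :
    extend o (t • s) l = t * extend o s l := by
  by_cases h : l = o <;> simp [extend, h]

lemma quadMap_smul (K : ι → ι → ℝ) (t : ℝ) (s : {k // k ≠ o} → ℝ) :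
    quadMap o K (t • s) = t ^ 2 • quadMap o K s := by
  have h : ∀ k, quad o K (t • s) k = t ^ 2 * quad o K s k := fun k => by
    simp only [quad, extend_smul, mul_pow, mul_left_comm _ t, mul_left_comm _ (t ^ 2),
      ← Finset.mul_sum]
    ring
  funext k
  simp only [quadMap, h, Pi.smul_apply, smul_eq_mul]
  ring

lemma contDiff_extend (l : ι) {n : ℕ∞} :
    ContDiff ℝ n fun s : {k // k ≠ o} → ℝ => extend o s l := by
  by_cases h : l = o
  · subst h
    simp only [extend_self]
    exact contDiff_const
  · have : (fun s : {k // k ≠ o} → ℝ => extend o s l) = fun s => s ⟨l, h⟩ :=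
      funext fun s => extend_coe s ⟨l, h⟩
    rw [this]
    exact contDiff_apply ℝ ℝ _

lemma contDiff_quadMap (K : ι → ι → ℝ) : ContDiff ℝ 1 (quadMap o K) := by
  have h : ∀ k, ContDiff ℝ 1 fun s => quad o K s k := fun k => by
    unfold quad
    exact ((ContDiff.sum fun l _ => contDiff_const.mul (contDiff_extend l)).pow 2).sub
      (ContDiff.sum fun l _ => contDiff_const.mul ((contDiff_extend l).pow 2))
  rw [contDiff_pi]
  exact fun k => (h k).sub (h o)

lemma eval_quadPoly_I_mul (K : ι → ι → ℂ) (z : {k // k ≠ o} → ℂ) (k : {k // k ≠ o}) :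
    eval (fun j => Complex.I * z j) (quadPoly o K k) = - eval z (quadPoly o K k) := by
  have h : ∀ k, eval (fun j => Complex.I * z j) (quadForm o K k) = - eval z (quadForm o K k) :=
    fun k => by
      simp only [quadForm, map_sub, map_pow, map_sum, map_mul, eval_C, eval_X, mul_pow,
        mul_left_comm _ Complex.I, ← Finset.mul_sum, Complex.I_sq, neg_one_mul, mul_neg,
        Finset.sum_neg_distrib]
      ring
  simp only [quadPoly, map_sub, h]
  ring

variable {K : ι → ι → ℝ} (hfib : ∀ (c : {k // k ≠ o} → ℂ) (Z : Finset ({k // k ≠ o} → ℂ)),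
    (∀ z ∈ Z, ∀ k, eval z (quadPoly o (fun k l => (K k l : ℂ)) k) = c k) →
      Z.card ≤ 2 ^ Fintype.card {k // k ≠ o})

include hfib

/-- The real points over `c`, and `i` times the real points over `-c`, belong to the complex fibre
over `c`. They could only meet at the origin, which is excluded by `c ≠ 0`. -/
lemma encard_fibre_add_le {c : {k // k ≠ o} → ℝ} (hc : c ≠ 0) :
    {s | quadMap o K s = c}.encard + {s | quadMap o K s = -c}.encard ≤
      2 ^ Fintype.card {k // k ≠ o} := by
  classical
  set Z : Set ({k // k ≠ o} → ℂ) :=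
    {z | ∀ k, eval z (quadPoly o (fun k l => (K k l : ℂ)) k) = (c k : ℂ)} with hZ
  have hZc : Z.encard ≤ 2 ^ Fintype.card {k // k ≠ o} := by
    by_contra! h
    obtain ⟨t, htZ, ht⟩ := Set.exists_subset_encard_eq
      (Order.add_one_le_of_lt h)
    have hfin : t.Finite := Set.finite_of_encard_eq_coe
      (k := 2 ^ Fintype.card {k // k ≠ o} + 1) (by rw [ht]; norm_cast)
    have h1 := hfib (fun k => c k) hfin.toFinset fun z hz => htZ (by simpa using hz)
    have h2 : (hfin.toFinset.card : ℕ∞) = 2 ^ Fintype.card {k // k ≠ o} + 1 := by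
      rw [← hfin.encard_eq_coe_toFinset_card, ht]
    have h3 : hfin.toFinset.card = 2 ^ Fintype.card {k // k ≠ o} + 1 := by exact_mod_cast h2
    omega
  set f : ({k // k ≠ o} → ℝ) → ({k // k ≠ o} → ℂ) := fun s j => (s j : ℂ) with hf
  set g : ({k // k ≠ o} → ℝ) → ({k // k ≠ o} → ℂ) := fun s j => Complex.I * (s j : ℂ) with hg
  have hfi : Function.Injective f := fun s s' h => funext fun j =>
    Complex.ofReal_injective (congrFun h j)
  have hgi : Function.Injective g := fun s s' h => funext fun j =>
    Complex.ofReal_injective (mul_left_cancel₀ Complex.I_ne_zero (congrFun h j))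
  rw [← hfi.encard_image, ← hgi.encard_image, ← Set.encard_union_eq]
  · refine (Set.encard_le_encard ?_).trans hZc
    rintro _ (⟨s, hs, rfl⟩ | ⟨s, hs, rfl⟩) k
    · rw [hf, eval_quadPoly]
      exact congrArg _ (congrFun hs k)
    · rw [hg, eval_quadPoly_I_mul, eval_quadPoly]
      have := congrFun hs k
      rw [quadMap] at this
      rw [this]
      simp
  · rw [Set.disjoint_left]
    rintro _ ⟨s, hs, rfl⟩ ⟨s', hs', h⟩
    have h0 : s = 0 := by
      funext j
      have := congrArg Complex.re (congrFun h j)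
      simpa [hf, hg] using this.symm
    apply hc
    have hs : quadMap o K s = c := hs
    rw [← hs, h0]
    have := quadMap_smul K 0 (0 : {k // k ≠ o} → ℝ)
    simpa using this

/-- The multiples of a nonzero zero would give more points than allowed in the fibre over `0`. -/
lemma eq_zero_of_quadMap_eq_zero {s : {k // k ≠ o} → ℝ} (hs : quadMap o K s = 0) : s = 0 := by
  by_contra hs0
  obtain ⟨j, hj⟩ := Function.ne_iff.1 hs0
  set f : ℕ → ({k // k ≠ o} → ℂ) := fun n i => (((n : ℝ) • s) i : ℝ) with hf
  have hfi : Function.Injective f := fun a b h => by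
    have h1 := Complex.ofReal_injective (congrFun h j)
    simp only [Pi.smul_apply, smul_eq_mul] at h1
    exact_mod_cast mul_right_cancel₀ hj h1
  have := hfib 0 ((Finset.range (2 ^ Fintype.card {k // k ≠ o} + 1)).map ⟨f, hfi⟩) (by
    intro z hz k
    obtain ⟨n, -, rfl⟩ := Finset.mem_map.1 hz
    change eval (fun i => ((((n : ℝ) • s) i : ℝ) : ℂ)) _ = _
    rw [eval_quadPoly]
    have h2 : quadMap o K ((n : ℝ) • s) k = 0 := by rw [quadMap_smul, hs, smul_zero]; rfl
    rw [quadMap] at h2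
    rw [h2]
    simp)
  simp at this

/-- `μ` is the minimum on the unit sphere, positive by the preceding lemma; homogeneity of degree
two extends the bound. -/
lemma exists_quadMap_bound : ∃ μ > 0, ∀ s, μ * ‖s‖ ^ 2 ≤ ‖quadMap o K s‖ := by
  rcases isEmpty_or_nonempty {k // k ≠ o} with h | h
  · exact ⟨1, one_pos, fun s => by simp [Subsingleton.elim s 0]⟩
  obtain ⟨s₀, hs₀, hmin⟩ := (isCompact_sphere (0 : {k // k ≠ o} → ℝ) 1).exists_isMinOn
    (NormedSpace.sphere_nonempty.2 zero_le_one) (contDiff_quadMap K).continuous.norm.continuousOn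
  refine ⟨‖quadMap o K s₀‖, ?_, fun s => ?_⟩
  · rw [gt_iff_lt, norm_pos_iff]
    intro h0
    rw [eq_zero_of_quadMap_eq_zero hfib h0] at hs₀
    simp at hs₀
  · by_cases hs : s = 0
    · simp [hs]
    · have hn : ‖s‖ ≠ 0 := norm_ne_zero_iff.2 hs
      have h1 : ‖s‖⁻¹ • s ∈ Metric.sphere (0 : {k // k ≠ o} → ℝ) 1 := by
        simp [norm_smul, hn]
      have h2 := hmin h1
      simp only [Set.mem_ofPred_eq, quadMap_smul, norm_smul, norm_pow, norm_inv, norm_norm] at h2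
      calc _ ≤ ((‖s‖⁻¹) ^ 2 * ‖quadMap o K s‖) * ‖s‖ ^ 2 := by gcongr
        _ = _ := by field_simp

/-- There is a regular value with few real preimages. -/
lemma exists_regular_value [Nonempty {k // k ≠ o}] : ∃ c : {k // k ≠ o} → ℝ,
    (∀ s, quadMap o K s = c → Function.Injective (fderiv ℝ (quadMap o K) s)) ∧
      {s | quadMap o K s = c}.encard ≤ 2 ^ (Fintype.card {k // k ≠ o} - 1) := by
  obtain ⟨c, hc, hreg⟩ := RegularZeros.exists_regular 
    ((contDiff_quadMap (o := o) K).differentiable (by simp))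
  have h1 := encard_fibre_add_le hfib hc
  have h2 : (2 : ℕ∞) ^ Fintype.card {k // k ≠ o} =
      2 ^ (Fintype.card {k // k ≠ o} - 1) + 2 ^ (Fintype.card {k // k ≠ o} - 1) := by
    rw [← two_mul, ← pow_succ', Nat.sub_add_cancel Fintype.card_pos]
  rw [h2] at h1
  by_cases h : {s | quadMap o K s = c}.encard ≤ 2 ^ (Fintype.card {k // k ≠ o} - 1)
  · exact ⟨c, fun s hs => hreg s (Or.inl hs), h⟩
  · refine ⟨-c, fun s hs => hreg s (Or.inr hs), ?_⟩
    by_contra h'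
    push Not at h h'
    exact absurd h1 (not_le.2 (ENat.add_lt_add h h'))

end QuadMap
end ProjGeom

end

/-! ### Rescaled equations of the perturbed intersection -/

noncomputable section

namespace ProjGeom

open MvPolynomial Asymptotics

section BlowUp

variable {ι : Type*} [Fintype ι] {o : ι} [Fintype {k // k ≠ o}]

/-- The coefficient of a rank one Cayley transform. -/
def cayleyCoeff (N τ : ℝ) : ℂ := 2 * Complex.I * τ / (1 - Complex.I * τ * N)

lemma one_sub_I_mul_ne_zero (x : ℝ) : 1 - Complex.I * (x : ℂ) ≠ 0 := by
  intro h
  have := congrArg Complex.re h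
  simp at this

lemma one_sub_I_mul_mul_ne_zero (x y : ℝ) : 1 - Complex.I * (x : ℂ) * y ≠ 0 := by
  rw [mul_assoc, ← Complex.ofReal_mul]
  exact one_sub_I_mul_ne_zero _

lemma norm_cayleyCoeff_le (N τ : ℝ) : ‖cayleyCoeff N τ‖ ≤ 2 * |τ| := by
  have h : 1 ≤ ‖1 - Complex.I * (τ : ℂ) * N‖ := by
    refine le_trans ?_ (Complex.abs_re_le_norm _)
    simp
  rw [cayleyCoeff, norm_div, norm_mul, norm_mul, Complex.norm_I, Complex.norm_real]
  simp only [Complex.norm_ofNat, mul_one, Real.norm_eq_abs]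
  exact div_le_self (by positivity) h

/-- The remainder in the second order expansion of the Cayley transform. -/
def cayleyRem (x : ℝ) : ℂ := (1 - Complex.I * x / 2)⁻¹

lemma cayley_eq_rem (x : ℝ) : cayley x = 1 + Complex.I * x - x ^ 2 / 2 * cayleyRem x := by
  have h := one_sub_ne_zero_of_real x
  rw [cayley, cayleyRem, div_eq_iff h, sub_mul, mul_assoc, inv_mul_cancel₀ h]
  linear_combination (x : ℂ) ^ 2 / 2 * Complex.I_sq

lemma contDiff_ofReal_mul {X : Type*} [NormedAddCommGroup X] [NormedSpace ℝ X] {f : X → ℝ}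
    (hf : ContDiff ℝ 1 f) : ContDiff ℝ 1 fun x => (f x : ℂ) :=
  Complex.ofRealCLM.contDiff.comp hf

lemma contDiff_cayleyRem : ContDiff ℝ 1 cayleyRem := by
  unfold cayleyRem
  refine ContDiff.inv ?_ one_sub_ne_zero_of_real
  exact contDiff_const.sub ((contDiff_const.mul (contDiff_ofReal_mul contDiff_id)).div_const 2)

lemma contDiff_cayley_ofReal : ContDiff ℝ 1 fun x : ℝ => cayley x := by
  simp only [cayley_eq_rem]
  exact (contDiff_const.add (contDiff_const.mul (contDiff_ofReal_mul contDiff_id))).sub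
    (((contDiff_ofReal_mul contDiff_id).pow 2).div_const 2 |>.mul contDiff_cayleyRem)

variable (K : ι → ι → ℝ) (b a : ι → ℂ) (N : ℝ)

/-- The coordinates of the image of a point of the torus by a rank one perturbation of `K`. -/
def pertVal (θ : {k // k ≠ o} → ℝ) (τ : ℝ) (k : ι) : ℂ :=
  ∑ l, (K k l : ℂ) * cayley (extend o θ l : ℝ) +
    cayleyCoeff N τ * (∑ l, b l * cayley (extend o θ l : ℝ)) * a k

/-- The second order part of `pertVal`, rescaled. -/
def blowRem (x : ({k // k ≠ o} → ℝ) × ℝ) (k : ι) : ℂ :=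
  2 * Complex.I / (1 - Complex.I * (x.2 ^ 2 : ℝ) * N) *
      (∑ l, b l * cayley (x.2 * extend o x.1 l : ℝ)) * a k -
    (∑ l, (K k l : ℂ) * ((extend o x.1 l ^ 2 : ℝ) * cayleyRem (x.2 * extend o x.1 l))) / 2

/-- The square modulus of `pertVal`, rescaled. -/
def blowSq (x : ({k // k ≠ o} → ℝ) × ℝ) (k : ι) : ℝ :=
  2 * (blowRem K b a N x k).re + (x.2 * (blowRem K b a N x k).re) ^ 2 +
    ((∑ l, K k l * extend o x.1 l) + x.2 * (blowRem K b a N x k).im) ^ 2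

variable (o) in
/-- The equations of the intersection of tori, rescaled. -/
def blowMap (x : ({k // k ≠ o} → ℝ) × ℝ) (k : {k // k ≠ o}) : ℝ :=
  blowSq K b a N x k - blowSq K b a N x o

variable {K b a N}

lemma contDiff_blowMap : ContDiff ℝ 1 (blowMap o K b a N) := by
  have hext : ∀ l, ContDiff ℝ 1 fun x : ({k // k ≠ o} → ℝ) × ℝ => extend o x.1 l := fun l =>
    (contDiff_extend l).comp contDiff_fst
  have hmul : ∀ l, ContDiff ℝ 1 fun x : ({k // k ≠ o} → ℝ) × ℝ => x.2 * extend o x.1 l := fun l =>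
    contDiff_snd.mul (hext l)
  have h1 : ∀ k, ContDiff ℝ 1 fun x : ({k // k ≠ o} → ℝ) × ℝ => blowRem K b a N x k := fun k => by
    simp only [blowRem, div_eq_mul_inv (2 * Complex.I)]
    refine ContDiff.sub (ContDiff.mul (ContDiff.mul (contDiff_const.mul (ContDiff.inv ?_ ?_)) ?_)
      contDiff_const) (ContDiff.div_const (ContDiff.sum fun l _ => ?_) 2)
    · exact contDiff_const.sub ((contDiff_const.mul
        (contDiff_ofReal_mul (contDiff_snd.pow 2))).mul contDiff_const)
    · exact fun x => one_sub_I_mul_mul_ne_zero _ _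
    · exact ContDiff.sum fun l _ => contDiff_const.mul (contDiff_cayley_ofReal.comp (hmul l))
    · exact contDiff_const.mul ((contDiff_ofReal_mul ((hext l).pow 2)).mul
        (contDiff_cayleyRem.comp (hmul l)))
  have h2 : ∀ k, ContDiff ℝ 1 fun x : ({k // k ≠ o} → ℝ) × ℝ => blowSq K b a N x k := fun k => by
    have hre : ContDiff ℝ 1 fun x : ({k // k ≠ o} → ℝ) × ℝ => (blowRem K b a N x k).re :=
      Complex.reCLM.contDiff.comp (h1 k)
    have him : ContDiff ℝ 1 fun x : ({k // k ≠ o} → ℝ) × ℝ => (blowRem K b a N x k).im :=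
      Complex.imCLM.contDiff.comp (h1 k)
    unfold blowSq
    exact ((contDiff_const.mul hre).add ((contDiff_snd.mul hre).pow 2)).add
      (((ContDiff.sum fun l _ => contDiff_const.mul (hext l)).add (contDiff_snd.mul him)).pow 2)
  rw [contDiff_pi]
  exact fun k => (h2 k).sub (h2 o)

/-- For `θ = σ η` and `τ = σ ^ 2` the term of order one in `σ` is imaginary, so that it only
contributes to the square modulus at order two, where the perturbation also enters. -/
lemma normSq_pertVal (hK : ∀ k, ∑ l, K k l = 1) (η : {k // k ≠ o} → ℝ) (σ : ℝ) (k : ι) :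
    ‖pertVal K b a N (σ • η) (σ ^ 2) k‖ ^ 2 = 1 + σ ^ 2 * blowSq K b a N (η, σ) k := by
  have h1 : pertVal K b a N (σ • η) (σ ^ 2) k =
      1 + Complex.I * ((σ * ∑ l, K k l * extend o η l : ℝ) : ℂ) +
        ((σ ^ 2 : ℝ) : ℂ) * blowRem K b a N (η, σ) k := by
    have h2 : ∑ l, (K k l : ℂ) * cayley (extend o (σ • η) l : ℝ) =
        1 + Complex.I * ((σ * ∑ l, K k l * extend o η l : ℝ) : ℂ) - ((σ ^ 2 : ℝ) : ℂ) *
          ((∑ l, (K k l : ℂ) * ((extend o η l ^ 2 : ℝ) * cayleyRem (σ * extend o η l))) / 2) := by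
      have h3 : (1 : ℂ) = ∑ l, (K k l : ℂ) := by rw [← Complex.ofReal_sum, hK, Complex.ofReal_one]
      simp only [extend_smul, cayley_eq_rem, mul_sub, mul_add, mul_one, Finset.sum_sub_distrib,
        Finset.sum_add_distrib, ← h3]
      push_cast
      simp only [Finset.mul_sum, Finset.sum_div]
      congr 1
      · congr 1
        exact Finset.sum_congr rfl fun l _ => by ring
      · exact Finset.sum_congr rfl fun l _ => by ring
    rw [pertVal, h2, blowRem, cayleyCoeff]
    simp only [extend_smul]
    ring
  have h4 : pertVal K b a N (σ • η) (σ ^ 2) k =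
      ((1 + σ ^ 2 * (blowRem K b a N (η, σ) k).re : ℝ) : ℂ) +
      ((σ * (∑ l, K k l * extend o η l) + σ ^ 2 * (blowRem K b a N (η, σ) k).im : ℝ) : ℂ) *
        Complex.I := by
    rw [h1]
    conv_lhs => rw [← Complex.re_add_im (blowRem K b a N (η, σ) k)]
    push_cast
    ring
  rw [h4, ← Complex.normSq_eq_norm_sq, Complex.normSq_add_mul_I, blowSq]
  ring

lemma blowMap_eq (hK : ∀ k, ∑ l, K k l = 1) (η : {k // k ≠ o} → ℝ) (σ : ℝ) (k : {k // k ≠ o}) :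
    σ ^ 2 * blowMap o K b a N (η, σ) k =
      ‖pertVal K b a N (σ • η) (σ ^ 2) k‖ ^ 2 - ‖pertVal K b a N (σ • η) (σ ^ 2) o‖ ^ 2 := by
  rw [normSq_pertVal hK, normSq_pertVal hK, blowMap]
  ring

/-- At `σ = 0` the real part of `blowRem` contains `-2 Re(∑ b) c_k`, which is doubled in `blowSq`.
The contribution of `Im(∑ b)` does not depend on `k` and disappears in the difference. -/
lemma blowMap_zero {c : {k // k ≠ o} → ℝ} (ha : ∀ k, a k = 1 + Complex.I * (extend o c k : ℝ))
    (η : {k // k ≠ o} → ℝ) :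
    blowMap o K b a N (η, 0) = quadMap o K η - (4 * (∑ l, b l).re) • c := by
  have h1 : ∀ k, (blowRem K b a N (η, 0) k).re = -2 * (∑ l, b l).im -
      2 * (∑ l, b l).re * extend o c k - (∑ l, K k l * extend o η l ^ 2) / 2 := fun k => by
    have : blowRem K b a N (η, 0) k = 2 * Complex.I * (∑ l, b l) *
        (1 + Complex.I * (extend o c k : ℝ)) - ((∑ l, K k l * extend o η l ^ 2 : ℝ) : ℂ) / 2 := by
      simp [blowRem, cayley_zero, cayleyRem, ha]
    rw [this]
    generalize ∑ l, K k l * extend o η l ^ 2 = S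
    simp
  funext k
  simp only [blowMap, blowSq, h1, quadMap, quad, Pi.sub_apply, Pi.smul_apply, smul_eq_mul,
    extend_self, extend_coe]
  ring

/-- A priori bound on the solutions near the origin. -/
lemma exists_bound (hK : ∀ k, ∑ l, K k l = 1) {μ : ℝ} (hμ : 0 < μ)
    (hq : ∀ s : {k // k ≠ o} → ℝ, μ * ‖s‖ ^ 2 ≤ ‖quadMap o K s‖) :
    ∃ δ > 0, ∃ R : ℝ, ∀ (θ : {k // k ≠ o} → ℝ) (τ : ℝ), ‖θ‖ < δ → 0 ≤ τ → τ ≤ 1 →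
      (∀ k, ‖pertVal K b a N θ τ k‖ = ‖pertVal K b a N θ τ o‖) → ‖θ‖ ^ 2 ≤ R * τ := by
  set H : ({k // k ≠ o} → ℝ) → ι → ℂ := fun θ k => ∑ l, (K k l : ℂ) * cayley (extend o θ l : ℝ)
    with hH
  -- The perturbation displaces the square moduli by at most a multiple of `τ`, uniformly on the
  -- torus.
  have h1 : ∀ k, ∃ C : ℝ, ∀ (θ : {k // k ≠ o} → ℝ) (τ : ℝ), 0 ≤ τ → τ ≤ 1 →
      |‖pertVal K b a N θ τ k‖ ^ 2 - ‖H θ k‖ ^ 2| ≤ C * τ := fun k => by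
    set P := 2 * (∑ l, ‖b l‖) * ‖a k‖ with hP
    set Q := ∑ l, |K k l| with hQ
    refine ⟨P * (P + 2 * Q), fun θ τ h0 h1 => ?_⟩
    have hPn : 0 ≤ P := by positivity
    have hQn : 0 ≤ Q := by positivity
    have hHQ : ‖H θ k‖ ≤ Q := by
      refine (norm_sum_le _ _).trans (Finset.sum_le_sum fun l _ => ?_)
      rw [norm_mul, norm_cayley_ofReal, mul_one, Complex.norm_real, Real.norm_eq_abs]
    have hD : ‖pertVal K b a N θ τ k - H θ k‖ ≤ P * τ := by
      rw [pertVal, hH, add_sub_cancel_left, norm_mul, norm_mul]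
      have h2 : ‖∑ l, b l * cayley (extend o θ l : ℝ)‖ ≤ ∑ l, ‖b l‖ := by
        refine (norm_sum_le _ _).trans (Finset.sum_le_sum fun l _ => ?_)
        rw [norm_mul, norm_cayley_ofReal, mul_one]
      have h3 := norm_cayleyCoeff_le N τ
      rw [abs_of_nonneg h0] at h3
      calc _ ≤ (2 * τ) * (∑ l, ‖b l‖) * ‖a k‖ := by gcongr
        _ = _ := by rw [hP]; ring
    have h4 : |‖pertVal K b a N θ τ k‖ - ‖H θ k‖| ≤ P * τ := (abs_norm_sub_norm_le _ _).trans hD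
    have h5 : ‖pertVal K b a N θ τ k‖ + ‖H θ k‖ ≤ P + 2 * Q := by
      have := (abs_le.1 h4).2
      nlinarith
    rw [sq_sub_sq, abs_mul, abs_of_nonneg (by positivity), mul_comm P, mul_assoc]
    exact mul_le_mul h5 h4 (abs_nonneg _) (by positivity)
  choose C hC using h1
  have h2 : ∀ k, ∃ D : ℝ, ∀ᶠ θ : {k // k ≠ o} → ℝ in 𝓝 0,
      |‖H θ k‖ ^ 2 - 1 - quad o K θ k| ≤ D * ‖θ‖ ^ 3 := fun k => by
    obtain ⟨D, hD⟩ := (isBigO_sq_sub_quad (o := o) K hK k).bound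
    refine ⟨D, hD.mono fun θ hθ => ?_⟩
    rw [Complex.mul_conj, Complex.normSq_eq_norm_sq] at hθ
    have e : ((‖H θ k‖ ^ 2 : ℝ) : ℂ) - 1 - (quad o K θ k : ℂ) =
        ((‖H θ k‖ ^ 2 - 1 - quad o K θ k : ℝ) : ℂ) := by push_cast; ring
    rw [e, Complex.norm_real] at hθ
    simpa using hθ
  choose D hD using h2
  have hD' := Filter.eventually_all.2 hD
  obtain ⟨δ, hδ, hball⟩ := Metric.eventually_nhds_iff.1 hD'
  set C₀ := ∑ k, |C k| with hC0
  set D₀ := ∑ k, |D k| with hD0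
  have hCle : ∀ k, C k ≤ C₀ := fun k => (le_abs_self _).trans
    (Finset.single_le_sum (f := fun k => |C k|) (fun k _ => abs_nonneg _) (Finset.mem_univ k))
  have hDle : ∀ k, D k ≤ D₀ := fun k => (le_abs_self _).trans
    (Finset.single_le_sum (f := fun k => |D k|) (fun k _ => abs_nonneg _) (Finset.mem_univ k))
  have hC0n : 0 ≤ C₀ := by positivity
  have hD0n : 0 ≤ D₀ := by positivity
  -- Subtracting the equation at `o` doubles the errors, whence `μ ‖θ‖ ^ 2 ≤ 2 (D₀ ‖θ‖ ^ 3 + C₀ τ)`.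
  -- This choice makes the cubic term at most `μ / 2 * ‖θ‖ ^ 2`, which leaves the constant `4 C₀ /
  -- μ`.
  refine ⟨min δ (μ / (4 * (D₀ + 1))), by positivity, 4 * C₀ / μ, fun θ τ hθ h0 h1 hp => ?_⟩
  have hθ1 : ‖θ‖ < δ := hθ.trans_le (min_le_left _ _)
  have hθ2 : ‖θ‖ < μ / (4 * (D₀ + 1)) := hθ.trans_le (min_le_right _ _)
  rw [lt_div_iff₀ (by positivity)] at hθ2
  have hb := hball (y := θ) (by simpa using hθ1)
  have hqb : ‖quadMap o K θ‖ ≤ 2 * (D₀ * ‖θ‖ ^ 3 + C₀ * τ) := by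
    rw [pi_norm_le_iff_of_nonneg (by positivity)]
    intro k
    have a1 := (hb k).trans (mul_le_mul_of_nonneg_right (hDle k) (by positivity))
    have a2 := (hb o).trans (mul_le_mul_of_nonneg_right (hDle o) (by positivity))
    have a3 := (hC k θ τ h0 h1).trans (mul_le_mul_of_nonneg_right (hCle k) h0)
    have a4 := (hC o θ τ h0 h1).trans (mul_le_mul_of_nonneg_right (hCle o) h0)
    rw [hp k] at a3
    rw [abs_le] at a1 a2 a3 a4
    rw [Real.norm_eq_abs, quadMap, abs_le]
    constructor <;> linarith [a1.1, a1.2, a2.1, a2.2, a3.1, a3.2, a4.1, a4.2]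
  have h3 := (hq θ).trans hqb
  have h4 : D₀ * ‖θ‖ ^ 3 ≤ μ / 4 * ‖θ‖ ^ 2 := by
    have : D₀ * ‖θ‖ ≤ μ / 4 := by nlinarith [norm_nonneg θ]
    calc D₀ * ‖θ‖ ^ 3 = (D₀ * ‖θ‖) * ‖θ‖ ^ 2 := by ring
      _ ≤ _ := by gcongr
  rw [div_mul_eq_mul_div, le_div_iff₀ hμ]
  linarith

end BlowUp
end ProjGeom

end

noncomputable section

namespace ProjGeom

open MvPolynomial

/-! ## Rank one Cayley transforms -/

section RankOne

variable {E : Type*} [NormedAddCommGroup E] [InnerProductSpace ℂ E]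

lemma conj_cayleyCoeff (N τ : ℝ) : (starRingEnd ℂ) (cayleyCoeff N τ) = cayleyCoeff N (-τ) := by
  simp [cayleyCoeff, map_ofNat]

/-- When `P ^ 2 = N P`, this identity expresses that `1 + c(τ) P` and `1 + c(-τ) P` are inverse to
each other. Together with `conj_cayleyCoeff` it yields unitarity. -/
lemma cayleyCoeff_add (N τ : ℝ) : cayleyCoeff N τ + cayleyCoeff N (-τ) +
    cayleyCoeff N τ * cayleyCoeff N (-τ) * N = 0 := by
  have h1 := one_sub_I_mul_mul_ne_zero τ N
  have h2 := one_sub_I_mul_mul_ne_zero (-τ) N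
  simp only [cayleyCoeff]
  push_cast at h2 ⊢
  rw [div_add_div _ _ h1 h2, div_mul_div_comm, div_mul_eq_mul_div, ← add_div, div_eq_zero_iff]
  left
  ring

/-- The operator `x ↦ ⟪w, x⟫ w`. -/
def rankOne (w : E) : E →L[ℂ] E := (innerSL ℂ w).smulRight w

lemma rankOne_apply (w x : E) : rankOne w x = (inner ℂ w x : ℂ) • w := rfl

lemma rankOne_mul_self (w x : E) : rankOne w (rankOne w x) = ((‖w‖ ^ 2 : ℝ) : ℂ) • rankOne w x := by
  simp only [rankOne_apply, inner_smul_right, inner_self_eq_norm_sq_to_K, smul_smul]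
  rw [mul_comm]
  norm_cast

/-- The unitary Cayley transform of a rank one operator. -/
def cayleyIso (w : E) (τ : ℝ) : E ≃ₗᵢ[ℂ] E where
  toLinearEquiv := LinearEquiv.ofLinearMap
    (LinearMap.id + cayleyCoeff (‖w‖ ^ 2) τ • (rankOne w : E →ₗ[ℂ] E))
    (LinearMap.id + cayleyCoeff (‖w‖ ^ 2) (-τ) • (rankOne w : E →ₗ[ℂ] E))
    (by
      ext x
      have h := cayleyCoeff_add (‖w‖ ^ 2) τ
      simp only [LinearMap.comp_apply, LinearMap.add_apply, LinearMap.id_apply,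
        LinearMap.smul_apply, ContinuousLinearMap.coe_coe, map_add, map_smul, rankOne_mul_self]
      rw [smul_smul, add_assoc, smul_add, smul_smul, ← add_smul, ← add_assoc, add_assoc x, ← add_smul,
        add_eq_left]
      convert zero_smul ℂ _ using 2
      linear_combination h)
    (by
      ext x
      have h := cayleyCoeff_add (‖w‖ ^ 2) τ
      simp only [LinearMap.comp_apply, LinearMap.add_apply, LinearMap.id_apply,
        LinearMap.smul_apply, ContinuousLinearMap.coe_coe, map_add, map_smul, rankOne_mul_self]
      rw [smul_smul, add_assoc, smul_add, smul_smul, ← add_smul, ← add_assoc, add_assoc x, ← add_smul,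
        add_eq_left]
      convert zero_smul ℂ _ using 2
      linear_combination h)
  norm_map' x := by
    have h := cayleyCoeff_add (‖w‖ ^ 2) τ
    have h1 : (inner ℂ (x + cayleyCoeff (‖w‖ ^ 2) τ • rankOne w x)
        (x + cayleyCoeff (‖w‖ ^ 2) τ • rankOne w x) : ℂ) = inner ℂ x x := by
      have h2 : (inner ℂ w w : ℂ) = ((‖w‖ ^ 2 : ℝ) : ℂ) := by
        rw [inner_self_eq_norm_sq_to_K]; norm_cast
      have h3 : (starRingEnd ℂ) (inner ℂ w x : ℂ) = inner ℂ x w := inner_conj_symm x w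
      simp only [rankOne_apply, inner_add_left, inner_add_right, inner_smul_left, inner_smul_right,
        h2, h3, conj_cayleyCoeff]
      linear_combination (inner ℂ w x * inner ℂ x w : ℂ) * h
    rw [inner_self_eq_norm_sq_to_K, inner_self_eq_norm_sq_to_K] at h1
    have h4 : ‖x + cayleyCoeff (‖w‖ ^ 2) τ • rankOne w x‖ ^ 2 = ‖x‖ ^ 2 := by exact_mod_cast h1
    exact (sq_eq_sq₀ (norm_nonneg _) (norm_nonneg _)).1 h4

lemma cayleyIso_apply (w : E) (τ : ℝ) (x : E) :
    cayleyIso w τ x = x + cayleyCoeff (‖w‖ ^ 2) τ • rankOne w x := rfl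

lemma continuous_cayleyCoeff (N : ℝ) : Continuous (cayleyCoeff N) := by
  unfold cayleyCoeff
  exact Continuous.div (by fun_prop) (by fun_prop) fun τ => one_sub_I_mul_mul_ne_zero τ N

lemma continuous_trans_cayleyIso (u : E ≃ₗᵢ[ℂ] E) (w : E) {τ : ℝ → ℝ} (hτ : Continuous τ) :
    Continuous fun t => ((u.trans (cayleyIso w (τ t))).toContinuousLinearEquiv : E →L[ℂ] E) := by
  have h : ∀ t, ((u.trans (cayleyIso w (τ t))).toContinuousLinearEquiv : E →L[ℂ] E) =
      (u.toContinuousLinearEquiv : E →L[ℂ] E) + cayleyCoeff (‖w‖ ^ 2) (τ t) •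
        ((rankOne w).comp (u.toContinuousLinearEquiv : E →L[ℂ] E)) := fun t => by
    ext x
    rfl
  simp only [h]
  exact continuous_const.add (((continuous_cayleyCoeff _).comp hτ).smul continuous_const)

end RankOne

/-! ## Derivatives along the torus -/

lemma hasDerivAt_cayley (x x' : ℝ) : HasDerivAt (fun y : ℝ => cayley ((x + y * x' : ℝ) : ℂ))
    (Complex.I * cayley x * ((x' / (1 + x ^ 2 / 4) : ℝ) : ℂ)) 0 := by
  have h0 : HasDerivAt (fun y : ℝ => ((x + y * x' : ℝ) : ℂ)) (x' : ℂ) 0 := by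
    have : HasDerivAt (fun y : ℝ => x + y * x') x' 0 := by
      simpa using ((hasDerivAt_id (0 : ℝ)).mul_const x').const_add x
    exact this.ofReal_comp
  have hn : HasDerivAt (fun y : ℝ => 1 + Complex.I * ((x + y * x' : ℝ) : ℂ) / 2)
      (Complex.I * x' / 2) 0 := ((h0.const_mul Complex.I).div_const 2).const_add 1
  have hd : HasDerivAt (fun y : ℝ => 1 - Complex.I * ((x + y * x' : ℝ) : ℂ) / 2)
      (-(Complex.I * x' / 2)) 0 := ((h0.const_mul Complex.I).div_const 2).const_sub 1
  have hne := one_sub_ne_zero_of_real x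
  have h2 : (1 + (x : ℂ) ^ 2 / 4) ≠ 0 := by
    have : (1 + x ^ 2 / 4 : ℝ) ≠ 0 := by positivity
    exact_mod_cast this
  refine (hn.div hd (one_sub_ne_zero_of_real _)).congr_deriv ?_
  simp only [zero_mul, add_zero, cayley]
  push_cast
  rw [div_eq_iff (pow_ne_zero 2 hne)]
  have h3 : (1 + Complex.I * (x : ℂ) / 2) * (1 - Complex.I * x / 2) = 1 + (x : ℂ) ^ 2 / 4 := by
    linear_combination (-(x : ℂ) ^ 2 / 4) * Complex.I_sq
  rw [← h3] at h2 ⊢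
  have h4 : 1 + Complex.I * (x : ℂ) / 2 ≠ 0 := left_ne_zero_of_mul h2
  have h5 : 1 + Complex.I * (x : ℂ) / 2 = 2 - (1 - Complex.I * x / 2) := by ring
  generalize 1 - Complex.I * (x : ℂ) / 2 = B at *
  generalize 1 + Complex.I * (x : ℂ) / 2 = A at *
  field_simp
  linear_combination (x' : ℂ) * h5

end ProjGeom

end

/-! ### Infinitesimal solutions of the perturbed equations -/

noncomputable section

namespace ProjGeom

open MvPolynomial RegularZeros

section Perturbation

variable {ι : Type*} [Fintype ι] {o : ι} [Fintype {k // k ≠ o}]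

/-- The derivative of `pertVal` along the torus. -/
def pertDeriv (K : ι → ι → ℝ) (b a : ι → ℂ) (N : ℝ) (θ : {k // k ≠ o} → ℝ) (τ : ℝ) (s : ι → ℝ)
    (k : ι) : ℂ :=
  ∑ l, (K k l : ℂ) * (Complex.I * cayley (extend o θ l : ℝ) * (s l : ℝ)) +
    cayleyCoeff N τ * (∑ l, b l * (Complex.I * cayley (extend o θ l : ℝ) * (s l : ℝ))) * a k

lemma extend_add_smul (θ θ' : {k // k ≠ o} → ℝ) (y : ℝ) (l : ι) :
    extend o (θ + y • θ') l = extend o θ l + y * extend o θ' l := by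
  by_cases h : l = o <;> simp [extend, h]

lemma hasDerivAt_pertVal (K : ι → ι → ℝ) (b a : ι → ℂ) (N : ℝ) (θ θ' : {k // k ≠ o} → ℝ) (τ : ℝ)
    (k : ι) : HasDerivAt (fun y : ℝ => pertVal K b a N (θ + y • θ') τ k)
      (pertDeriv K b a N θ τ (fun l => extend o θ' l / (1 + extend o θ l ^ 2 / 4)) k) 0 := by
  unfold pertVal pertDeriv
  simp only [extend_add_smul]
  refine HasDerivAt.add ?_ (HasDerivAt.mul_const (HasDerivAt.const_mul _ ?_) _)
  · exact HasDerivAt.fun_sum fun l _ => (hasDerivAt_cayley _ _).const_mul _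
  · exact HasDerivAt.fun_sum fun l _ => (hasDerivAt_cayley _ _).const_mul _

/-- If the rescaled equations are regular, the only infinitesimal solution is trivial. -/
lemma eq_zero_of_pertDeriv {K : ι → ι → ℝ} {b a : ι → ℂ} {N : ℝ} (hK : ∀ k, ∑ l, K k l = 1)
    {η : {k // k ≠ o} → ℝ} {σ : ℝ} (hσ : σ ≠ 0)
    (hinj : Function.Injective (partialFst (blowMap o K b a N) (η, σ))) {s : ι → ℝ} (hs : s o = 0)
    (h : ∀ k, ((starRingEnd ℂ) (pertVal K b a N (σ • η) (σ ^ 2) k) *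
        pertDeriv K b a N (σ • η) (σ ^ 2) s k).re =
      ((starRingEnd ℂ) (pertVal K b a N (σ • η) (σ ^ 2) o) *
        pertDeriv K b a N (σ • η) (σ ^ 2) s o).re) : s = 0 := by
  set θ := σ • η with hθ
  -- The argument of `cayley x` moves at speed `1 / (1 + x ^ 2 / 4)`; `θ'` is the velocity in the
  -- chart for which the arguments have velocity `s`.
  set θ' : {k // k ≠ o} → ℝ := fun k => s k * (1 + extend o θ k ^ 2 / 4) with hθ'
  have hpos : ∀ x : ℝ, (1 + x ^ 2 / 4) ≠ 0 := fun x => by positivity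
  have hext : (fun l => extend o θ' l / (1 + extend o θ l ^ 2 / 4)) = s := by
    funext l
    by_cases hl : l = o
    · subst hl; rw [extend_self, hs, zero_div]
    · rw [show extend o θ' l = θ' ⟨l, hl⟩ from extend_coe θ' ⟨l, hl⟩, hθ']
      exact mul_div_cancel_right₀ _ (hpos _)
  have hd : ∀ k, HasDerivAt (fun y : ℝ => ‖pertVal K b a N (θ + y • θ') (σ ^ 2) k‖ ^ 2)
      (2 * ((starRingEnd ℂ) (pertVal K b a N θ (σ ^ 2) k) *
        pertDeriv K b a N θ (σ ^ 2) s k).re) 0 := fun k => by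
    have h1 := hasDerivAt_normSq (hasDerivAt_pertVal K b a N θ θ' (σ ^ 2) k)
    rw [hext] at h1
    simpa using h1
  have hline : HasDerivAt (fun y : ℝ => (η + y • (σ⁻¹ • θ'), σ)) (σ⁻¹ • θ', (0 : ℝ)) 0 := by
    refine HasDerivAt.prodMk ?_ (hasDerivAt_const _ _)
    simpa using ((hasDerivAt_id (0 : ℝ)).smul_const (σ⁻¹ • θ')).const_add η
  have hf : HasFDerivAt (blowMap o K b a N) (fderiv ℝ (blowMap o K b a N) (η, σ))
      (η + (0 : ℝ) • (σ⁻¹ • θ'), σ) := by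
    rw [zero_smul, add_zero]
    exact (contDiff_blowMap.differentiable (by simp) _).hasFDerivAt
  have hcomp := hf.comp_hasDerivAt 0 hline
  have hz : partialFst (blowMap o K b a N) (η, σ) (σ⁻¹ • θ') = 0 := by
    funext k
    have h2 := (hasDerivAt_pi.1 hcomp k).const_mul (σ ^ 2)
    have h3 : (fun y : ℝ => σ ^ 2 * (blowMap o K b a N ∘ fun y : ℝ => (η + y • (σ⁻¹ • θ'), σ)) y k) =
        fun y => ‖pertVal K b a N (θ + y • θ') (σ ^ 2) k‖ ^ 2 -
          ‖pertVal K b a N (θ + y • θ') (σ ^ 2) o‖ ^ 2 := by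
      funext y
      rw [Function.comp_apply, blowMap_eq hK, smul_add, smul_comm σ y, smul_inv_smul₀ hσ]
    rw [h3] at h2
    have h4 := h2.unique ((hd k).sub (hd o))
    rw [h k, sub_self] at h4
    exact (mul_eq_zero.1 h4).resolve_left (pow_ne_zero 2 hσ)
  have h5 : σ⁻¹ • θ' = 0 := hinj (hz.trans (map_zero _).symm)
  have h6 : θ' = 0 := (smul_eq_zero.1 h5).resolve_left (inv_ne_zero hσ)
  funext k
  rw [← hext, h6, extend_zero]
  simp

end Perturbation

section Family

variable {E : Type*} [NormedAddCommGroup E] [NormedSpace ℂ E] {ι : Type*} [Fintype ι] {o : ι}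
  [Fintype {k // k ≠ o}] {e : E ≃L[ℂ] (ι → ℂ)} {v₀ : E}

/-- Near the base point every line is in the image of the Cayley chart, and the coordinates of a
line of the torus are real. -/
lemma exists_realPoint (hv₀ : v₀ ≠ 0) (he : ∀ k, e v₀ k = 1) {δ : ℝ} (hδ : 0 < δ) :
    ∃ Ω ∈ 𝓝 (Projectivization.mk ℂ v₀ hv₀), ∀ x ∈ Ω, x ∈ torus o e →
      ∃ θ : {k // k ≠ o} → ℝ, ‖θ‖ < δ ∧ realPoint o e θ = x := by
  refine ⟨{x | e x.rep o ≠ 0 ∧ (∀ k, e x.rep k + e x.rep o ≠ 0) ∧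
    ‖fun k : {k // k ≠ o} => (coord o e x.rep k).re‖ < δ}, ?_, ?_⟩
  · have h1 : ∀ᶠ v in 𝓝 v₀, e v o ≠ 0 :=
      (analyticAt_apply o v₀).continuousAt.eventually_ne (apply_self_ne_zero he)
    have h2 : ∀ᶠ v in 𝓝 v₀, ∀ k, e v k + e v o ≠ 0 := Filter.eventually_all.2 fun k =>
      ((analyticAt_apply k v₀).add (analyticAt_apply o v₀)).continuousAt.eventually_ne
        (ne_zero_of_base he k)
    have h3 : ∀ᶠ v in 𝓝 v₀, ‖fun k : {k // k ≠ o} => (coord o e v k).re‖ < δ := by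
      have hc : ContinuousAt (fun v => fun k : {k // k ≠ o} => (coord o e v k).re) v₀ :=
        continuousAt_pi.2 fun k => Complex.continuous_re.continuousAt.comp
          (analyticAt_coord k.1 (ne_zero_of_base he k)).continuousAt
      refine hc.norm.eventually_lt continuousAt_const ?_
      have : (fun k : {k // k ≠ o} => (coord o e v₀ k).re) = 0 :=
        funext fun k => by rw [coord_base he]; rfl
      rw [this, norm_zero]
      exact hδ
    refine (eventually_nhds_mk hv₀).2 ?_
    filter_upwards [h1, h2, h3] with v hv1 hv2 hv3 hv
    obtain ⟨c, hc⟩ := Projectivization.exists_smul_eq_mk_rep ℂ v hv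
    rw [Units.smul_def] at hc
    simp only [← hc, coord_smul c.ne_zero, map_smul, Pi.smul_apply, smul_eq_mul,
      ← mul_add, ne_eq, mul_eq_zero, c.ne_zero, false_or]
    exact ⟨hv1, hv2, hv3⟩
  · rintro x ⟨h1, h2, h3⟩ hx
    refine ⟨_, h3, ?_⟩
    have h4 := mk_chart_coord x.rep_nonzero h1 h2
    rw [x.mk_rep] at h4
    rw [realPoint]
    refine Eq.trans ?_ h4
    congr 2
    funext k
    exact Complex.ext (by simp) (by simp [im_coord_of_mem_torus hx h1 k (h2 k)])

end Family

end ProjGeom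

end

/-! ### The family of perturbed unitary maps -/

noncomputable section

namespace ProjGeom

open MvPolynomial RegularZeros

section Family

variable {E : Type*} [NormedAddCommGroup E] [InnerProductSpace ℂ E] {ι : Type*} [Fintype ι] {o : ι}
  [Fintype {k // k ≠ o}] {e : E ≃L[ℂ] (ι → ℂ)} {v₀ : E}

/-- Write `ξ_k = v_k z_k`. Tangency to the torus makes the real part of `z_k` constant; modulo `ℂ v`
there remains `i s_k v_k` with `s` real and `s o = 0`. Tangency to the second torus is the
linearized equation for `s`, and regularity forces `s = 0`. -/
lemma mem_span_of_isTorusTangent {u : E ≃ₗᵢ[ℂ] E} {ζ : ℂ} (hζ : ‖ζ‖ = 1) {K : ι → ι → ℝ}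
    (hK : ∀ k, ∑ l, K k l = 1) {b a : ι → ℂ} {N σ : ℝ} (hσ : σ ≠ 0)
    (hu : ∀ v k, e (u v) k = ζ * (∑ l, (K k l : ℂ) * e v l +
      cayleyCoeff N (σ ^ 2) * (∑ l, b l * e v l) * a k))
    {η : {k // k ≠ o} → ℝ}
    (hinj : Function.Injective (partialFst (blowMap o K b a N) (η, σ)))
    (hmod : ∀ k, ‖pertVal K b a N (σ • η) (σ ^ 2) k‖ = ‖pertVal K b a N (σ • η) (σ ^ 2) o‖)
    {v ξ : E} (hv : v ≠ 0) (hx : Projectivization.mk ℂ v hv = realPoint o e (σ • η))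
    (h1 : IsTorusTangent o e v ξ) (h2 : IsTorusTangent o e (u v) (u ξ)) :
    ξ ∈ Submodule.span ℂ {v} := by
  rw [realPoint, Projectivization.mk_eq_mk_iff'] at hx
  obtain ⟨d, rfl⟩ := hx
  have hd : d ≠ 0 := by rintro rfl; simp at hv
  set θ := σ • η with hθ
  set X : ι → ℂ := fun k => cayley (extend o θ k : ℝ) with hX
  have hX1 : ∀ k, ‖X k‖ = 1 := fun k => norm_cayley_ofReal _
  have hX0 : ∀ k, X k ≠ 0 := fun k => norm_ne_zero_iff.1 (by rw [hX1]; exact one_ne_zero)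
  have hev : ∀ k, e (d • chart o e fun j => (θ j : ℂ)) k = d * X k := fun k => by
    rw [map_smul, Pi.smul_apply, chart_apply, smul_eq_mul, ← ofReal_extend]
  set z : ι → ℂ := fun k => e ξ k / (d * X k) with hz
  have heξ : ∀ k, e ξ k = d * X k * z k := fun k =>
    (mul_div_cancel₀ _ (mul_ne_zero hd (hX0 k))).symm
  have hzre : ∀ k, (z k).re = (z o).re := fun k => by
    have h3 : ∀ k, ((starRingEnd ℂ) (d * X k) * e ξ k).re = ‖d‖ ^ 2 * (z k).re := fun k => by
      have : (starRingEnd ℂ) (d * X k) * e ξ k = ((‖d‖ ^ 2 : ℝ) : ℂ) * z k := by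
        rw [heξ, ← mul_assoc, ← Complex.normSq_eq_conj_mul_self, Complex.normSq_eq_norm_sq, norm_mul,
          hX1, mul_one]
      rw [this, Complex.re_ofReal_mul]
    have h4 := h1 k
    rw [hev, hev, h3, h3] at h4
    exact mul_left_cancel₀ (pow_ne_zero 2 (norm_ne_zero_iff.2 hd)) h4
  set s : ι → ℝ := fun k => (z k).im - (z o).im with hs
  have hzs : ∀ k, z k = z o + Complex.I * s k := fun k => by
    apply Complex.ext <;> simp [hs, hzre k]
  have hFv : ∀ k, e (u (d • chart o e fun j => (θ j : ℂ))) k =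
      d * ζ * pertVal K b a N θ (σ ^ 2) k := fun k => by
    rw [hu, pertVal]
    simp only [hev, mul_left_comm _ d, ← Finset.mul_sum]
    ring
  have hFξ : ∀ k, e (u ξ) k =
      d * ζ * (z o * pertVal K b a N θ (σ ^ 2) k + pertDeriv K b a N θ (σ ^ 2) s k) := fun k => by
    rw [hu, pertVal, pertDeriv]
    have h5 : ∀ c : ι → ℂ, ∑ l, c l * e ξ l = d * (z o * ∑ l, c l * X l +
        ∑ l, c l * (Complex.I * X l * s l)) := fun c => by
      rw [Finset.mul_sum, ← Finset.sum_add_distrib, Finset.mul_sum]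
      refine Finset.sum_congr rfl fun l _ => ?_
      rw [heξ, hzs l]
      ring
    rw [h5, h5]
    ring
  have hs0 : s = 0 := by
    refine eq_zero_of_pertDeriv hK hσ hinj (by simp [hs]) fun k => ?_
    have h6 : ∀ k, ((starRingEnd ℂ) (e (u (d • chart o e fun j => (θ j : ℂ))) k) * e (u ξ) k).re =
        ‖d‖ ^ 2 * (‖pertVal K b a N θ (σ ^ 2) o‖ ^ 2 * (z o).re +
          ((starRingEnd ℂ) (pertVal K b a N θ (σ ^ 2) k) * pertDeriv K b a N θ (σ ^ 2) s k).re) :=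
      fun k => by
        have h7 : (starRingEnd ℂ) (e (u (d • chart o e fun j => (θ j : ℂ))) k) * e (u ξ) k =
            ((‖d‖ ^ 2 : ℝ) : ℂ) * (((‖pertVal K b a N θ (σ ^ 2) o‖ ^ 2 : ℝ) : ℂ) * z o +
              (starRingEnd ℂ) (pertVal K b a N θ (σ ^ 2) k) *
                pertDeriv K b a N θ (σ ^ 2) s k) := by
          have h8 : ((‖d‖ ^ 2 : ℝ) : ℂ) = (starRingEnd ℂ) (d * ζ) * (d * ζ) := by
            rw [← Complex.normSq_eq_conj_mul_self, Complex.normSq_eq_norm_sq, norm_mul, hζ, mul_one]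
          rw [hFv, hFξ, h8, ← hmod k, ← Complex.normSq_eq_norm_sq, Complex.normSq_eq_conj_mul_self,
            map_mul _ (d * ζ)]
          ring
        rw [h7, Complex.re_ofReal_mul, Complex.add_re, Complex.re_ofReal_mul]
    have h9 := h2 k
    rw [h6, h6] at h9
    have h10 := mul_left_cancel₀ (pow_ne_zero 2 (norm_ne_zero_iff.2 hd)) h9
    exact add_left_cancel h10
  rw [Submodule.mem_span_singleton]
  refine ⟨z o, e.injective (funext fun k => ?_)⟩
  rw [map_smul, Pi.smul_apply, hev, heξ, hzs k, hs0, smul_eq_mul]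
  simp only [Pi.zero_apply, Complex.ofReal_zero, mul_zero, add_zero]
  ring

/-- A unitary map whose matrix is real with row sums `1` and whose quadratic part has small fibres
can be perturbed so that its torus becomes transverse to the original one, with few
intersection points. -/
theorem exists_perturbation [Nonempty {k // k ≠ o}] (hv₀ : v₀ ≠ 0) (he : ∀ k, e v₀ k = 1)
    (hreal : ∀ x : ι → ℝ, (inner ℂ (e.symm fun k => (x k : ℂ)) v₀ : ℂ).im = 0) (u : E ≃ₗᵢ[ℂ] E)
    {ζ : ℂ} (hζ : ‖ζ‖ = 1) (K : ι → ι → ℝ) (hK : ∀ k, ∑ l, K k l = 1)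
    (hu : ∀ v k, e (u v) k = ζ * ∑ l, (K k l : ℂ) * e v l)
    (hfib : ∀ (c : {k // k ≠ o} → ℂ) (Z : Finset ({k // k ≠ o} → ℂ)),
      (∀ z ∈ Z, ∀ k, eval z (quadPoly o (fun k l => (K k l : ℂ)) k) = c k) →
        Z.card ≤ 2 ^ Fintype.card {k // k ≠ o}) :
    ∃ Ω ∈ 𝓝 (Projectivization.mk ℂ v₀ hv₀), ∃ F : ℝ → (E ≃ₗᵢ[ℂ] E),
      Continuous (fun t => ((F t).toContinuousLinearEquiv : E →L[ℂ] E)) ∧ F 0 = u ∧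
      ∀ t ∈ Set.Ioo (0 : ℝ) 1,
        (∀ x ∈ Ω ∩ (torus o e ∩ unitaryPreimage (F t) (torus o e)),
          TransverseAt (torus o e) (unitaryPreimage (F t) (torus o e)) x) ∧
        (Ω ∩ (torus o e ∩ unitaryPreimage (F t) (torus o e))).encard ≤
          2 ^ (Fintype.card {k // k ≠ o} - 1) := by
  classical
  have hζ0 : ζ ≠ 0 := norm_ne_zero_iff.1 (by rw [hζ]; exact one_ne_zero)
  obtain ⟨c, hreg, hcard⟩ := exists_regular_value hfib
  obtain ⟨μ, hμ, hq⟩ := exists_quadMap_bound hfib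
  have hA : (4 * ‖v₀‖ ^ 2) ≠ 0 := by
    have := norm_ne_zero_iff.2 hv₀
    positivity
  -- The normalization compensates the factor `4 * (∑ l, b l).re` of `blowMap_zero`, which equals `4
  -- * ‖v₀‖ ^ 2` by `hbre`. The vectors `w` and `b` are such that the perturbed map has coordinates
  -- `ζ * pertVal` on the torus.
  set c' := (4 * ‖v₀‖ ^ 2)⁻¹ • c with hc'
  set a : ι → ℂ := fun k => 1 + Complex.I * (extend o c' k : ℝ) with ha
  set w : E := e.symm a with hw
  set N : ℝ := ‖w‖ ^ 2 with hN
  set b : ι → ℂ := fun l => ζ⁻¹ * inner ℂ w (u (e.symm (Pi.single l 1))) with hb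
  have hbsum : ∀ v, ∑ l, b l * e v l = ζ⁻¹ * inner ℂ w (u v) := fun v => by
    have hv : v = ∑ l, e v l • e.symm (Pi.single l (1 : ℂ)) := by
      apply e.injective
      funext k
      simp [Finset.sum_apply, Pi.single_apply]
    conv_rhs => rw [hv, map_sum, inner_sum, Finset.mul_sum]
    refine Finset.sum_congr rfl fun l _ => ?_
    rw [map_smul, inner_smul_right]
    ring
  have huv : u v₀ = ζ • v₀ := by
    apply e.injective
    funext k
    simp only [hu, map_smul, Pi.smul_apply, he, mul_one, smul_eq_mul]
    rw [← Complex.ofReal_sum, hK, Complex.ofReal_one, mul_one]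
  -- Here `w` is `v₀` plus `i` times a vector with real coordinates, whose inner product with `v₀`
  -- is real by `hreal`; the cross term is therefore imaginary.
  have hbre : (∑ l, b l).re = ‖v₀‖ ^ 2 := by
    have h1 := hbsum v₀
    simp only [he, mul_one] at h1
    have hw' : w = v₀ + Complex.I • e.symm fun k => ((extend o c' k : ℝ) : ℂ) := by
      apply e.injective
      funext k
      simp [hw, ha, he]
    rw [h1, huv, inner_smul_right, inv_mul_cancel_left₀ hζ0, hw', inner_add_left, inner_smul_left,
      inner_self_eq_norm_sq_to_K, Complex.add_re, Complex.mul_re, hreal]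
    simp only [Complex.conj_I, Complex.neg_re, Complex.I_re, neg_zero, zero_mul, mul_zero, sub_zero,
      add_zero]
    norm_cast
  have hf0 : ∀ η, blowMap o K b a N (η, 0) = quadMap o K η - c := fun η => by
    rw [blowMap_zero (fun k => rfl), hbre, hc', smul_inv_smul₀ hA]
  have hzero : {η | blowMap o K b a N (η, 0) = 0} = {η | quadMap o K η = c} := by
    ext η
    simp only [Set.mem_ofPred_eq, hf0, sub_eq_zero]
  have hpart : ∀ η, partialFst (blowMap o K b a N) (η, 0) = fderiv ℝ (quadMap o K) η := fun η => by
    have h1 : HasFDerivAt (fun η => blowMap o K b a N (η, 0))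
        (partialFst (blowMap o K b a N) (η, 0)) η :=
      HasFDerivAt.comp η (contDiff_blowMap.differentiable (by simp) _).hasFDerivAt
        (hasFDerivAt_prodMk_left η 0)
    have h2 : HasFDerivAt (fun η => blowMap o K b a N (η, 0)) (fderiv ℝ (quadMap o K) η) η := by
      simp only [hf0]
      exact ((contDiff_quadMap K).differentiable (by simp) η).hasFDerivAt.sub_const c
    exact h1.unique h2
  obtain ⟨δ, hδ, R, hR⟩ := exists_bound (b := b) (a := a) (N := N) hK hμ hq
  have hev := eventually_encard_le (f := blowMap o K b a N) contDiff_blowMap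
    (fun η hη => by
      rw [hpart]
      exact hreg η (sub_eq_zero.1 ((hf0 η).symm.trans hη)))
    (by
      rw [hzero, ← Set.encard_lt_top_iff]
      refine hcard.trans_lt ?_
      exact_mod_cast ENat.natCast_lt_top (2 ^ (Fintype.card {k // k ≠ o} - 1)))
    (Real.sqrt R)
  obtain ⟨ε, hε, hball⟩ := Metric.eventually_nhds_iff.1 hev
  obtain ⟨Ω, hΩ, hΩθ⟩ := exists_realPoint (o := o) (e := e) hv₀ he hδ
  -- The parameter of the Cayley transform is `τ = σ₀ ^ 2 * t = σ ^ 2` with `σ = σ₀ √t`. It is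
  -- continuous in `t`, zero at `t = 0`, and for `t` in `(0, 1)` it satisfies `σ < ε` and `τ ≤ 1`.
  set σ₀ : ℝ := min 1 (ε / 2) with hσ₀
  have hσ₀0 : 0 < σ₀ := by positivity
  have hσ₀1 : σ₀ ≤ 1 := min_le_left _ _
  have hσ₀ε : σ₀ < ε := (min_le_right _ _).trans_lt (by linarith)
  refine ⟨Ω, hΩ, fun t => u.trans (cayleyIso w (σ₀ ^ 2 * t)),
    continuous_trans_cayleyIso u w (by fun_prop), ?_, fun t ht => ?_⟩
  · ext x
    simp [cayleyIso_apply, cayleyCoeff]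
  set σ := σ₀ * Real.sqrt t with hσ
  have hσ2 : σ ^ 2 = σ₀ ^ 2 * t := by rw [hσ, mul_pow, Real.sq_sqrt ht.1.le]
  have hσpos : 0 < σ := mul_pos hσ₀0 (Real.sqrt_pos.2 ht.1)
  have hσle : σ ≤ σ₀ := mul_le_of_le_one_right hσ₀0.le (Real.sqrt_le_one.2 ht.2.le)
  obtain ⟨hcount, hinj⟩ := hball (y := σ) (by
    rw [Real.dist_eq, sub_zero, abs_of_pos hσpos]; linarith)
  set U := u.trans (cayleyIso w (σ₀ ^ 2 * t)) with hU
  have hUe : ∀ v k, e (U v) k = ζ * (∑ l, (K k l : ℂ) * e v l +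
      cayleyCoeff N (σ ^ 2) * (∑ l, b l * e v l) * a k) := fun v k => by
    rw [hU, LinearIsometryEquiv.trans_apply, cayleyIso_apply, rankOne_apply, hbsum, ← hσ2]
    simp only [map_add, map_smul, Pi.add_apply, Pi.smul_apply, smul_eq_mul, hu, ← hN]
    have : e w k = a k := by rw [hw, ContinuousLinearEquiv.apply_symm_apply]
    rw [this]
    field_simp
  have hpert : ∀ θ : {k // k ≠ o} → ℝ, ∀ k, e (U (chart o e fun j => (θ j : ℂ))) k =
      ζ * pertVal K b a N θ (σ ^ 2) k := fun θ k => by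
    rw [hUe, pertVal]
    simp only [chart_apply, ofReal_extend]
  -- By the a priori bound, the rescaled coordinates of every intersection point in `Ω` lie in the
  -- ball of radius `√R` on which the zeros have been counted.
  have hpoint : ∀ x ∈ Ω ∩ (torus o e ∩ unitaryPreimage U (torus o e)),
      ∃ η : {k // k ≠ o} → ℝ, ‖η‖ ≤ Real.sqrt R ∧ blowMap o K b a N (η, σ) = 0 ∧
        (∀ k, ‖pertVal K b a N (σ • η) (σ ^ 2) k‖ = ‖pertVal K b a N (σ • η) (σ ^ 2) o‖) ∧
        realPoint o e (σ • η) = x := by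
    rintro x ⟨hxΩ, hxT, hxU⟩
    obtain ⟨θ, hθδ, rfl⟩ := hΩθ x hxΩ hxT
    have hmod : ∀ k, ‖pertVal K b a N θ (σ ^ 2) k‖ = ‖pertVal K b a N θ (σ ^ 2) o‖ := fun k => by
      have h1 := (mk_mem_torus (map_ne_zero_of_ne U (chart_ne_zero _))).1 hxU k
      rw [hpert, hpert, norm_mul, norm_mul, hζ, one_mul, one_mul] at h1
      exact h1
    have hb := hR θ (σ ^ 2) hθδ (by positivity) (by nlinarith) hmod
    have hθσ : σ • (σ⁻¹ • θ) = θ := smul_inv_smul₀ hσpos.ne' θ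
    refine ⟨σ⁻¹ • θ, ?_, ?_, by rwa [hθσ], by rw [hθσ]⟩
    · refine Real.le_sqrt_of_sq_le ?_
      rw [norm_smul, norm_inv, Real.norm_of_nonneg hσpos.le, mul_pow, inv_pow,
        inv_mul_le_iff₀ (by positivity), mul_comm]
      exact hb
    · funext k
      have h2 := blowMap_eq (b := b) (a := a) (N := N) hK (σ⁻¹ • θ) σ k
      rw [hθσ, hmod k, sub_self] at h2
      exact (mul_eq_zero.1 h2).resolve_left (by positivity)
  constructor
  · intro x hx
    obtain ⟨η, hη, h0, hmod, hxη⟩ := hpoint x hx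
    refine transverseAt_torus U hx.2 fun v hv hvx ξ h1 h2 => ?_
    exact mem_span_of_isTorusTangent hζ hK hσpos.ne' hUe (hinj η hη h0) hmod hv
      (hvx.trans hxη.symm) h1 h2
  · have hsub : Ω ∩ (torus o e ∩ unitaryPreimage U (torus o e)) ⊆
        (fun η : {k // k ≠ o} → ℝ => realPoint o e (σ • η)) ''
          {η | ‖η‖ ≤ Real.sqrt R ∧ blowMap o K b a N (η, σ) = 0} := by
      intro x hx
      obtain ⟨η, hη, h0, -, hxη⟩ := hpoint x hx
      exact ⟨η, ⟨hη, h0⟩, hxη⟩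
    calc _ ≤ _ := Set.encard_le_encard hsub
      _ ≤ _ := Set.encard_image_le _ _
      _ ≤ _ := hcount
      _ ≤ _ := by rw [hzero]; exact hcard

end Family

end ProjGeom

end

noncomputable section

namespace OddFun

/-! ## The matrix of the Fourier transform on odd functions -/

variable {p : ℕ} [Fact p.Prime]

lemma quadraticChar_neg (h4 : p % 4 = 3) (k : ZMod p) :
    quadraticChar (ZMod p) (-k) = - quadraticChar (ZMod p) k := by
  have hp : ringChar (ZMod p) ≠ 2 := by rw [ZMod.ringChar_zmod_n]; omega
  have h1 : quadraticChar (ZMod p) (-1) = -1 := by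
    rw [quadraticChar_neg_one hp, ZMod.card]
    exact ZMod.χ₄_nat_three_mod_four h4
  rw [← neg_one_mul, map_mul, h1, neg_one_mul]

variable (p) in
/-- The nonzero squares modulo `p`. -/
abbrev Sq : Type := {k : ZMod p // quadraticChar (ZMod p) k = 1}

lemma Sq.ne_zero (k : Sq p) : (k : ZMod p) ≠ 0 := fun h => by
  have := k.2
  rw [h, MulChar.map_zero] at this
  exact zero_ne_one this

lemma Sq.neg_ne (h4 : p % 4 = 3) (k l : Sq p) : -(k : ZMod p) ≠ l := fun h => by
  have := l.2
  rw [← h, quadraticChar_neg h4, k.2] at this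
  norm_num at this

instance : One (Sq p) := ⟨⟨1, map_one _⟩⟩

instance : Mul (Sq p) := ⟨fun k l => ⟨k * l, by rw [map_mul, k.2, l.2, one_mul]⟩⟩

lemma Sq.coe_mul (k l : Sq p) : ((k * l : Sq p) : ZMod p) = k * l := rfl

/-- As `-1` is not a square, each nonzero class is `l` or `-l` for exactly one square `l`. -/
lemma sum_eq_sum_sq (h4 : p % 4 = 3) {A : Type*} [AddCommMonoid A] (g : ZMod p → A) :
    ∑ l, g l = g 0 + ∑ l : Sq p, (g l + g (-l)) := by
  have h1 : ∀ l, g l = (if l = 0 then g l else 0) +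
      ((if quadraticChar (ZMod p) l = 1 then g l else 0) +
        (if quadraticChar (ZMod p) (-l) = 1 then g l else 0)) := fun l => by
    by_cases hl : l = 0
    · subst hl; simp
    · rcases quadraticChar_dichotomy hl with h | h
      · simp [hl, h, quadraticChar_neg h4]
      · simp [hl, h, quadraticChar_neg h4]
  have h2 : ∀ f : ZMod p → A, ∑ l, (if quadraticChar (ZMod p) l = 1 then f l else 0) =
      ∑ l : Sq p, f l := fun f => by
    rw [← Finset.sum_filter]
    exact Finset.sum_subtype _ (by simp) f
  rw [Finset.sum_congr rfl fun l _ => h1 l, Finset.sum_add_distrib, Finset.sum_add_distrib,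
    Finset.sum_ite_eq' Finset.univ (0 : ZMod p) g, if_pos (Finset.mem_univ _),
    Finset.sum_add_distrib, h2]
  congr 2
  rw [← Equiv.sum_comp (Equiv.neg (ZMod p))]
  simp only [Equiv.neg_apply, neg_neg]
  exact h2 fun l => g (-l)

lemma card_sq (h4 : p % 4 = 3) : Fintype.card (Sq p) = (p - 1) / 2 := by
  have h := sum_eq_sum_sq h4 fun _ => (1 : ℕ)
  simp only [Finset.sum_const, Finset.card_univ, ZMod.card, smul_eq_mul, mul_one] at h
  omega

variable (p) in
/-- The quadratic Gauss sum. -/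
def gauss : ℂ :=
  gaussSum ((quadraticChar (ZMod p)).ringHomComp (Int.castRingHom ℂ)) (ZMod.stdAddChar (N := p))

lemma gauss_sq (h4 : p % 4 = 3) : gauss p ^ 2 = -p := by
  have hp : ringChar (ZMod p) ≠ 2 := by rw [ZMod.ringChar_zmod_n]; omega
  have h1 : (quadraticChar (ZMod p)).ringHomComp (Int.castRingHom ℂ) ≠ 1 := by
    obtain ⟨a, ha⟩ := quadraticChar_exists_neg_one' hp
    intro h
    have := congrArg (fun χ : MulChar (ZMod p) ℂ => χ a) h
    rw [MulChar.ringHomComp_apply, ha, MulChar.one_apply_coe] at this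
    norm_num at this
  rw [gauss, gaussSum_sq h1 ((quadraticChar_isQuadratic _).comp _) (ZMod.isPrimitive_stdAddChar p),
    MulChar.ringHomComp_apply, quadraticChar_neg h4, map_one, ZMod.card]
  simp

lemma gauss_ne_zero (h4 : p % 4 = 3) : gauss p ≠ 0 := fun h => by
  have h1 := gauss_sq h4
  rw [h] at h1
  have hp : (p : ℂ) ≠ 0 := Nat.cast_ne_zero.2 (Fact.out : p.Prime).ne_zero
  apply hp
  linear_combination h1

lemma norm_gauss (h4 : p % 4 = 3) : ‖gauss p‖ = Real.sqrt p := by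
  have h1 := congrArg norm (gauss_sq h4)
  rw [norm_pow, norm_neg, Complex.norm_natCast] at h1
  rw [← h1, Real.sqrt_sq (norm_nonneg _)]

/-- Both `gauss p * conj (gauss p) = p` and `gauss p ^ 2 = -p` hold, so the Gauss sum is imaginary;
this is why `sinChar` is real. -/
lemma conj_gauss (h4 : p % 4 = 3) : (starRingEnd ℂ) (gauss p) = - gauss p := by
  have h1 : gauss p * (starRingEnd ℂ) (gauss p) = p := by
    rw [Complex.mul_conj, Complex.normSq_eq_norm_sq, norm_gauss h4, Real.sq_sqrt (Nat.cast_nonneg p)]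
    simp
  apply mul_left_cancel₀ (gauss_ne_zero h4)
  rw [h1]
  linear_combination gauss_sq h4

/-- The normalized sine `(e(x) - e(-x)) / τ`. -/
def sinChar (x : ZMod p) : ℂ := (ZMod.stdAddChar x - ZMod.stdAddChar (-x)) / gauss p

lemma conj_sinChar (h4 : p % 4 = 3) (x : ZMod p) : (starRingEnd ℂ) (sinChar x) = sinChar x := by
  rw [sinChar, map_div₀, map_sub, conj_gauss h4, ← AddChar.map_neg_eq_conj,
    ← AddChar.map_neg_eq_conj, neg_neg, div_neg, ← neg_div, neg_sub]

/-- The matrix of the Fourier transform on odd functions, up to a scalar. -/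
def sinMatrix (k l : Sq p) : ℝ := (sinChar ((k : ZMod p) * (l : ZMod p))).re

lemma ofReal_sinMatrix (h4 : p % 4 = 3) (k l : Sq p) :
    (sinMatrix k l : ℂ) = sinChar ((k : ZMod p) * (l : ZMod p)) :=
  Complex.conj_eq_iff_re.1 (conj_sinChar h4 _)

/-- The Gauss sum twisted by a square `k` does not change; in other words the Legendre character is
an eigenvector of the Fourier transform. -/
lemma sum_sinMatrix (h4 : p % 4 = 3) (k : Sq p) : ∑ l, sinMatrix k l = 1 := by
  have h1 := gaussSum_mulShift ((quadraticChar (ZMod p)).ringHomComp (Int.castRingHom ℂ))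
    (ZMod.stdAddChar (N := p)) (Units.mk0 (k : ZMod p) k.ne_zero)
  rw [Units.val_mk0, MulChar.ringHomComp_apply, k.2, map_one, one_mul, gaussSum,
    sum_eq_sum_sq h4] at h1
  simp only [MulChar.ringHomComp_apply, MulChar.map_zero, zero_mul, zero_add,
    quadraticChar_neg h4, AddChar.mulShift_apply] at h1
  apply Complex.ofReal_injective
  rw [Complex.ofReal_sum, Complex.ofReal_one]
  simp only [ofReal_sinMatrix h4, sinChar]
  rw [← Finset.sum_div, div_eq_one_iff_eq (gauss_ne_zero h4), gauss, ← h1]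
  refine Finset.sum_congr rfl fun l _ => ?_
  rw [l.2]
  simp [sub_eq_add_neg]

/-- Orthogonality of characters. The frequency `k + j` never vanishes for squares, only `j - k` can,
and the sign is absorbed by `gauss p ^ 2 = -p`. -/
lemma sinMatrix_mul_sinMatrix (h4 : p % 4 = 3) (k j : Sq p) :
    ∑ l, sinMatrix k l * sinMatrix l j = if k = j then 1 else 0 := by
  have hψ := fun b : ZMod p => AddChar.sum_mulShift b (ZMod.isPrimitive_stdAddChar p)
  have h1 := sum_eq_sum_sq h4 fun l : ZMod p =>
    (ZMod.stdAddChar ((k : ZMod p) * l) - ZMod.stdAddChar (-((k : ZMod p) * l)) : ℂ) *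
      ZMod.stdAddChar (l * (j : ZMod p))
  have h2 : ∑ l : ZMod p, (ZMod.stdAddChar ((k : ZMod p) * l) -
      ZMod.stdAddChar (-((k : ZMod p) * l)) : ℂ) * ZMod.stdAddChar (l * (j : ZMod p)) =
      - (if k = j then (p : ℂ) else 0) := by
    have e1 : ∀ l : ZMod p, (ZMod.stdAddChar ((k : ZMod p) * l) -
      ZMod.stdAddChar (-((k : ZMod p) * l)) : ℂ) * ZMod.stdAddChar (l * (j : ZMod p)) =
      ZMod.stdAddChar (l * (k + j : ZMod p)) - ZMod.stdAddChar (l * (j - k : ZMod p)) := fun l => by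
      rw [sub_mul, ← AddChar.map_add_eq_mul, ← AddChar.map_add_eq_mul]
      congr 2 <;> ring
    have h3 : (k : ZMod p) + j ≠ 0 := fun h => Sq.neg_ne h4 k j (neg_eq_of_add_eq_zero_right h)
    have h5 : (j : ZMod p) - k = 0 ↔ k = j := by
      rw [sub_eq_zero, Subtype.coe_inj, eq_comm]
    rw [Finset.sum_congr rfl fun l _ => e1 l, Finset.sum_sub_distrib, hψ, hψ, if_neg h3, ZMod.card]
    simp only [h5]
    split_ifs <;> simp
  apply Complex.ofReal_injective
  have hp : (p : ℂ) ≠ 0 := Nat.cast_ne_zero.2 (Fact.out : p.Prime).ne_zero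
  have h6 : ∑ l : Sq p, ((sinMatrix k l * sinMatrix l j : ℝ) : ℂ) * (-p) =
      - (if k = j then (p : ℂ) else 0) := by
    rw [← h2, h1]
    simp only [mul_zero, neg_zero, sub_self, zero_mul, zero_add]
    refine Finset.sum_congr rfl fun l _ => ?_
    rw [Complex.ofReal_mul, ofReal_sinMatrix h4, ofReal_sinMatrix h4, sinChar, sinChar,
      ← gauss_sq h4, div_mul_div_comm, ← sq, div_mul_cancel₀ _ (pow_ne_zero 2 (gauss_ne_zero h4))]
    simp only [mul_neg, neg_mul, neg_neg]
    ring
  rw [← Finset.sum_mul, ← Complex.ofReal_sum] at h6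
  apply mul_right_cancel₀ (neg_ne_zero.2 hp)
  rw [h6]
  split_ifs <;> simp

lemma sinMatrix_involutive (h4 : p % 4 = 3) (x : Sq p → ℝ) (k : Sq p) :
    ∑ l, sinMatrix k l * ∑ j, sinMatrix l j * x j = x k := by
  simp only [Finset.mul_sum, ← mul_assoc]
  rw [Finset.sum_comm]
  simp only [← Finset.sum_mul, sinMatrix_mul_sinMatrix h4]
  simp

/-! ## Coordinates on odd functions -/

/-- An odd function is determined by its restriction to the squares. -/
def restrictEquiv (h4 : p % 4 = 3) : oddSpace p ≃ₗ[ℂ] (Sq p → ℂ) where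
  toFun f k := f.1 k
  map_add' f g := rfl
  map_smul' c f := rfl
  invFun x := ⟨WithLp.toLp 2 fun k => if h : quadraticChar (ZMod p) k = 1 then x ⟨k, h⟩ else
      if h : quadraticChar (ZMod p) (-k) = 1 then - x ⟨-k, h⟩ else 0, fun k => by
    by_cases h : quadraticChar (ZMod p) k = 1
    · have h' : quadraticChar (ZMod p) (-k) ≠ 1 := by rw [quadraticChar_neg h4, h]; norm_num
      simp [h, h', -quadraticChar_apply]
    · by_cases h' : quadraticChar (ZMod p) (-k) = 1 <;> simp [h, h', -quadraticChar_apply]⟩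
  left_inv f := by
    ext k
    by_cases h : quadraticChar (ZMod p) k = 1
    · simp [h, -quadraticChar_apply]
    · by_cases h' : quadraticChar (ZMod p) (-k) = 1
      · simp [h, h', f.2 k, -quadraticChar_apply]
      · have hk : k = 0 := by
          by_contra hk
          rcases quadraticChar_dichotomy hk with h1 | h1
          · exact h h1
          · exact h' (by rw [quadraticChar_neg h4, h1, neg_neg])
        subst hk
        have h0 := f.2 0
        rw [neg_zero] at h0
        simp only [MulChar.map_zero, zero_ne_one, neg_zero, dite_false]
        exact (self_eq_neg.1 h0).symm
  right_inv x := by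
    funext k
    simp [k.2]

/-- `restrictEquiv` as a continuous linear equivalence. -/
def restrictCLE (h4 : p % 4 = 3) : oddSpace p ≃L[ℂ] (Sq p → ℂ) :=
  (restrictEquiv h4).toContinuousLinearEquiv

lemma restrictCLE_apply (h4 : p % 4 = 3) (f : oddSpace p) (k : Sq p) :
    restrictCLE h4 f k = f.1 k := rfl

lemma restrictCLE_legendre (h4 : p % 4 = 3) (k : Sq p) : restrictCLE h4 (legendre h4) k = 1 := by
  rw [restrictCLE_apply]
  change ((quadraticChar (ZMod p) k : ℤ) : ℂ) = 1
  rw [k.2, Int.cast_one]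

lemma apply_zero (f : oddSpace p) : f.1 0 = 0 := by
  have h0 := f.2 0
  rw [neg_zero] at h0
  exact self_eq_neg.1 h0

lemma restrictCLE_fourierV (h4 : p % 4 = 3) (f : oddSpace p) (k : Sq p) :
    restrictCLE h4 (fourierV p f) k = (gauss p / (Real.sqrt p : ℝ)) *
      ∑ l, (sinMatrix k l : ℂ) * restrictCLE h4 f l := by
  rw [restrictCLE_apply, fourierV_apply, sum_eq_sum_sq h4, apply_zero, mul_zero, zero_add,
    div_eq_inv_mul, mul_assoc]
  congr 1
  rw [Finset.mul_sum]
  refine Finset.sum_congr rfl fun l _ => ?_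
  rw [ofReal_sinMatrix h4, sinChar, restrictCLE_apply, f.2, ← mul_assoc,
    mul_div_cancel₀ _ (gauss_ne_zero h4), mul_neg, sub_mul, mul_neg, sub_eq_add_neg]

lemma norm_gauss_div (h4 : p % 4 = 3) : ‖gauss p / (Real.sqrt p : ℝ)‖ = 1 := by
  have hp : 0 < Real.sqrt p := Real.sqrt_pos.2 (Nat.cast_pos.2 (Fact.out : p.Prime).pos)
  rw [norm_div, norm_gauss h4, Complex.norm_real, Real.norm_of_nonneg hp.le, div_self hp.ne']

lemma cliffordTorus_eq (h4 : p % 4 = 3) :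
    cliffordTorus p = ProjGeom.torus (1 : Sq p) (restrictCLE h4) := by
  ext x
  constructor
  · intro h k
    exact h k k.ne_zero
  · intro h k hk
    rcases quadraticChar_dichotomy hk with h1 | h1
    · exact h ⟨k, h1⟩
    · have h2 := h ⟨-k, by rw [quadraticChar_neg h4, h1, neg_neg]⟩
      rw [restrictCLE_apply, restrictCLE_apply, x.rep.2, norm_neg] at h2
      exact h2

lemma inner_legendre_im (h4 : p % 4 = 3) (x : Sq p → ℝ) :
    (inner ℂ ((restrictCLE h4).symm fun k => (x k : ℂ)) (legendre h4) : ℂ).im = 0 := by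
  rw [Submodule.coe_inner, PiLp.inner_apply, Complex.im_sum]
  refine Finset.sum_eq_zero fun k _ => ?_
  have h1 : ((((restrictCLE h4).symm fun k => (x k : ℂ)).1 k)).im = 0 := by
    change (if h : quadraticChar (ZMod p) k = 1 then ((x ⟨k, h⟩ : ℝ) : ℂ) else
      if h : quadraticChar (ZMod p) (-k) = 1 then - ((x ⟨-k, h⟩ : ℝ) : ℂ) else 0).im = 0
    split_ifs <;> simp
  have h2 : ((legendre h4).1 k).im = 0 := by
    change ((quadraticChar (ZMod p) k : ℤ) : ℂ).im = 0
    simp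
  simp [RCLike.inner_apply, Complex.mul_im, h1, h2]

end OddFun

end

noncomputable section

namespace OddFun

open MvPolynomial ProjGeom

/-! ## Reduction modulo two -/

/-- The ideal generated by `2` in `ℤ` is proper, hence its elements are nonunits of some valuation
subring of `ℂ` containing `ℤ`. -/
lemma exists_dyadic : ∃ O : ValuationSubring ℂ, (2 : ℂ) ∈ O.nonunits := by
  set A := (Int.castRingHom ℂ).range with hA
  have hI : Ideal.span {(2 : A)} ≠ ⊤ := by
    rw [Ne, Ideal.span_singleton_eq_top]
    intro h
    obtain ⟨⟨_, n, rfl⟩, ha⟩ := h.exists_right_inv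
    have h1 := congrArg (Subtype.val : A → ℂ) ha
    have h2 : (2 : ℂ) * (n : ℂ) = 1 := h1
    have h3 : (2 : ℤ) * n = 1 := by exact_mod_cast h2
    omega
  obtain ⟨B, -, hB⟩ := Ideal.image_subset_nonunits_valuationSubring _ hI
  exact ⟨B, hB ⟨2, Ideal.subset_span rfl, rfl⟩⟩

lemma mem_of_isIntegral (O : ValuationSubring ℂ) {x : ℂ} (hx : IsIntegral ℤ x) : x ∈ O := by
  have h : IsIntegral O x := hx.tower_top
  obtain ⟨y, rfl⟩ := IsIntegrallyClosed.algebraMap_eq_of_integral h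
  exact y.2

variable {p : ℕ} [Fact p.Prime]

lemma stdAddChar_mem (O : ValuationSubring ℂ) (x : ZMod p) : (ZMod.stdAddChar x : ℂ) ∈ O := by
  refine mem_of_isIntegral O (IsIntegral.of_pow (n := p) (Fact.out : p.Prime).pos ?_)
  rw [← AddChar.map_nsmul_eq_pow]
  simp [isIntegral_one]

lemma gauss_mem (O : ValuationSubring ℂ) : gauss p ∈ O := by
  rw [gauss, gaussSum]
  refine sum_mem fun x _ => mul_mem ?_ (stdAddChar_mem O x)
  rw [MulChar.ringHomComp_apply]
  exact intCast_mem O _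

/-- The reductions of the entries of `sinMatrix` modulo two. -/
structure DyadicReduction (h4 : p % 4 = 3) (O : ValuationSubring ℂ) where
  /-- The lift of `sinChar`. -/
  lift : ZMod p → O
  coe_lift : ∀ x, ((lift x : O) : ℂ) = sinChar x
  sq_residue : ∀ x, IsLocalRing.residue O (lift x) ^ 2 = IsLocalRing.residue O (lift (2 * x))
  neg_residue : ∀ x, IsLocalRing.residue O (lift (-x)) = IsLocalRing.residue O (lift x)

lemma two_eq_zero {O : ValuationSubring ℂ} (hO : (2 : ℂ) ∈ O.nonunits) :
    (2 : IsLocalRing.ResidueField O) = 0 := by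
  obtain ⟨h, h'⟩ := O.mem_nonunits_iff_exists_mem_maximalIdeal.1 hO
  have : (IsLocalRing.residue O (⟨2, h⟩ : O)) = 0 := (IsLocalRing.residue_eq_zero_iff _).2 h'
  have h2 : (⟨2, h⟩ : O) = 2 := rfl
  rwa [h2, map_ofNat] at this

/-- Since `τ ^ 2 = -p` with `p` odd, the Gauss sum `τ` reduces to `1` and is a unit of `O`. Thus
`sinChar x` is integral and reduces to `ψ x + ψ (-x)`, whose square in characteristic two is `ψ (2
x) + ψ (-2 x)`. -/
lemma nonempty_dyadicReduction (h4 : p % 4 = 3) {O : ValuationSubring ℂ}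
    (hO : (2 : ℂ) ∈ O.nonunits) : Nonempty (DyadicReduction h4 O) := by
  have h2 := two_eq_zero hO
  have hchar : CharP (IsLocalRing.ResidueField O) 2 := CharTwo.of_one_ne_zero_of_two_eq_zero one_ne_zero h2
  set r := IsLocalRing.residue O
  set τ : O := ⟨gauss p, gauss_mem O⟩ with hτ
  set ψ : ZMod p → O := fun x => ⟨ZMod.stdAddChar x, stdAddChar_mem O x⟩ with hψ
  have hτ2 : τ ^ 2 = -(p : O) := Subtype.ext (by
    change gauss p ^ 2 = _
    rw [gauss_sq h4]
    simp)
  have hp : (p : IsLocalRing.ResidueField O) = 1 := by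
    obtain ⟨j, hj⟩ : ∃ j, p = 2 * j + 1 := ⟨p / 2, by omega⟩
    rw [hj]
    push_cast
    rw [h2]
    ring
  have hrτ2 : r τ ^ 2 = 1 := by
    rw [← map_pow, hτ2, map_neg, map_natCast, hp, CharTwo.neg_eq]
  have hrτ : r τ = 1 := by
    have : (r τ - 1) ^ 2 = 0 := by
      linear_combination hrτ2 - (r τ - 1) * h2
    exact sub_eq_zero.1 (pow_eq_zero_iff two_ne_zero |>.1 this)
  have hτu : IsUnit τ := by
    rw [← IsLocalRing.residue_ne_zero_iff_isUnit]
    change r τ ≠ 0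
    rw [hrτ]
    exact one_ne_zero
  obtain ⟨v, hv⟩ := hτu.exists_right_inv
  have hrv : r v = 1 := by
    have := congrArg r hv
    rwa [map_mul, hrτ, one_mul, map_one] at this
  have hψ1 : ∀ x, ψ x * ψ (-x) = 1 := fun x => Subtype.ext (by
    change (ZMod.stdAddChar x : ℂ) * ZMod.stdAddChar (-x) = 1
    rw [← AddChar.map_add_eq_mul]; simp)
  have hψ2 : ∀ x, ψ (2 * x) = ψ x ^ 2 := fun x => Subtype.ext (by
    change (ZMod.stdAddChar (2 * x) : ℂ) = ZMod.stdAddChar x ^ 2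
    rw [two_mul, AddChar.map_add_eq_mul, sq])
  refine ⟨⟨fun x => (ψ x - ψ (-x)) * v, fun x => ?_, fun x => ?_, fun x => ?_⟩⟩
  · have hv' : gauss p * (v : ℂ) = 1 := congrArg Subtype.val hv
    change ((ZMod.stdAddChar x : ℂ) - ZMod.stdAddChar (-x)) * (v : ℂ) = _
    rw [sinChar, eq_div_iff (gauss_ne_zero h4), mul_assoc, mul_comm (v : ℂ), hv', mul_one]
  · have h3 := congrArg r (hψ1 x)
    rw [map_mul, map_one] at h3
    change r ((ψ x - ψ (-x)) * v) ^ 2 = r ((ψ (2 * x) - ψ (-(2 * x))) * v)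
    simp only [map_mul, map_sub, hrv, mul_one]
    rw [show -(2 * x) = 2 * -x by ring, hψ2, hψ2, map_pow, map_pow]
    linear_combination (r (ψ (-x)) ^ 2 - r (ψ x) * r (ψ (-x))) * h2
  · change r ((ψ (-x) - ψ (- -x)) * v) = r ((ψ x - ψ (-x)) * v)
    simp only [map_mul, map_sub, hrv, mul_one, neg_neg]
    linear_combination (r (ψ (-x)) - r (ψ x)) * h2

/-! ### Cyclicity of the squares -/

/-- `2` or `-2` is a square. -/
def twist (h4 : p % 4 = 3) (h7 : 7 ≤ p) : Sq p :=
  if h : quadraticChar (ZMod p) 2 = 1 then ⟨2, h⟩ else ⟨-2, by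
    have h2 : (2 : ZMod p) ≠ 0 := by
      have : ((2 : ℕ) : ZMod p) ≠ 0 := by
        rw [Ne, ZMod.natCast_eq_zero_iff]
        exact fun h => absurd (Nat.le_of_dvd two_pos h) (by omega)
      exact_mod_cast this
    rw [quadraticChar_neg h4, (quadraticChar_dichotomy h2).resolve_left h, neg_neg]⟩

lemma twist_eq (h4 : p % 4 = 3) (h7 : 7 ≤ p) :
    (twist h4 h7 : ZMod p) = 2 ∨ (twist h4 h7 : ZMod p) = -2 := by
  unfold twist
  split_ifs
  · exact Or.inl rfl
  · exact Or.inr rfl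

lemma twist_ne_one (h4 : p % 4 = 3) (h7 : 7 ≤ p) : (twist h4 h7 : ZMod p) ≠ 1 := by
  intro h
  have h1 : ((1 : ℕ) : ZMod p) ≠ 0 := by simp
  have h3 : ((3 : ℕ) : ZMod p) ≠ 0 := by
    rw [Ne, ZMod.natCast_eq_zero_iff]
    exact fun h => absurd (Nat.le_of_dvd (by norm_num) h) (by omega)
  rcases twist_eq h4 h7 with h' | h'
  · apply h1
    push_cast
    linear_combination h - h'
  · apply h3
    push_cast
    linear_combination h' - h

/-- The group of squares has prime order `(p - 1) / 2`, so each of its elements other than `1`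
generates it. The primality of `(p - 1) / 2` is essential at this point. -/
lemma sq_eq_pow (h4 : p % 4 = 3) (hsafe : ((p - 1) / 2).Prime) {s : Sq p} (hs : (s : ZMod p) ≠ 1)
    (k : Sq p) : ∃ j : ℕ, (k : ZMod p) = (s : ZMod p) ^ j := by
  classical
  have hord : orderOf (s : ZMod p) = (p - 1) / 2 := by
    have hp : ringChar (ZMod p) ≠ 2 := by rw [ZMod.ringChar_zmod_n]; omega
    have h1 : (s : ZMod p) ^ ((p - 1) / 2) = 1 := by
      have := quadraticChar_eq_pow_of_char_ne_two' hp (s : ZMod p)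
      rw [s.2, ZMod.card, Int.cast_one] at this
      rw [this]
      congr 1
      omega
    rcases (Nat.dvd_prime hsafe).1 (orderOf_dvd_of_pow_eq_one h1) with h | h
    · exact absurd (orderOf_eq_one_iff.1 h) hs
    · exact h
  have hχ : ∀ j : ℕ, quadraticChar (ZMod p) ((s : ZMod p) ^ j) = 1 := fun j => by
    rw [map_pow, s.2, one_pow]
  set f : Fin ((p - 1) / 2) → Sq p := fun j => ⟨(s : ZMod p) ^ (j : ℕ), hχ j⟩ with hf
  have hfi : Function.Injective f := fun i j hij => by
    have h1 : (s : ZMod p) ^ (i : ℕ) = (s : ZMod p) ^ (j : ℕ) := congrArg Subtype.val hij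
    exact Fin.ext (pow_injOn_Iio_orderOf (by simp [hord]) (by simp [hord]) h1)
  have hfs : Function.Surjective f :=
    ((Fintype.bijective_iff_injective_and_card f).2 ⟨hfi, by
      rw [Fintype.card_fin, card_sq h4]⟩).2
  obtain ⟨j, hj⟩ := hfs k
  exact ⟨j, (congrArg Subtype.val hj).symm⟩

lemma eq_of_mul_invariant (h4 : p % 4 = 3) (hsafe : ((p - 1) / 2).Prime) {s : Sq p}
    (hs : (s : ZMod p) ≠ 1) {A : Type*} {y : Sq p → A} (hy : ∀ l, y (s * l) = y l) (k : Sq p) :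
    y k = y 1 := by
  obtain ⟨j, hj⟩ := sq_eq_pow h4 hsafe hs k
  induction j generalizing k with
  | zero =>
    have : k = 1 := Subtype.ext (by rw [hj, pow_zero]; rfl)
    rw [this]
  | succ j ih =>
    set k' : Sq p := ⟨(s : ZMod p) ^ j, by rw [map_pow, s.2, one_pow]⟩ with hk'
    have : k = s * k' := Subtype.ext (by rw [hj, pow_succ', Sq.coe_mul])
    rw [this, hy]
    exact ih k' rfl

lemma mulLeft_bijective (s : Sq p) : Function.Bijective fun l : Sq p => s * l := by
  refine Finite.injective_iff_bijective.1 fun a b h => Subtype.ext ?_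
  have h1 : (s : ZMod p) * a = s * b := congrArg Subtype.val h
  exact mul_left_cancel₀ s.ne_zero h1

/-! ### The residual quadratic forms -/

section Reduction

variable {h4 : p % 4 = 3} {O : ValuationSubring ℂ} (D : DyadicReduction h4 O)

/-- The lift of `sinMatrix`. -/
def liftMatrix (k l : Sq p) : O := D.lift ((k : ZMod p) * (l : ZMod p))

lemma coe_liftMatrix (k l : Sq p) : ((liftMatrix D k l : O) : ℂ) = sinMatrix k l := by
  rw [liftMatrix, D.coe_lift, ofReal_sinMatrix h4]

lemma sum_liftMatrix (k : Sq p) : ∑ l, liftMatrix D k l = 1 := by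
  apply Subtype.coe_injective
  have h := congrArg (Complex.ofReal) (sum_sinMatrix h4 k)
  rw [Complex.ofReal_sum] at h
  simp only [← coe_liftMatrix D] at h
  push_cast
  rw [h, Complex.ofReal_one]

lemma liftMatrix_mul (k j : Sq p) :
    ∑ l, liftMatrix D k l * liftMatrix D l j = if k = j then 1 else 0 := by
  apply Subtype.coe_injective
  have h := congrArg (Complex.ofReal) (sinMatrix_mul_sinMatrix h4 k j)
  simp only [Complex.ofReal_sum, Complex.ofReal_mul, ← coe_liftMatrix D] at h
  push_cast
  rw [h]
  split_ifs <;> simp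

/-- The matrix of the residual diagonal quadratic forms. -/
def residualMatrix : Matrix {k : Sq p // k ≠ 1} {k : Sq p // k ≠ 1} O := fun k l =>
  liftMatrix D k l ^ 2 - liftMatrix D k l - (liftMatrix D 1 l ^ 2 - liftMatrix D 1 l)

/-- In characteristic two the square of a sum is the sum of the squares: the cross terms disappear
and the forms become diagonal. -/
lemma map_residue_quadPoly (hO : (2 : ℂ) ∈ O.nonunits) (k : {k : Sq p // k ≠ 1}) :
    map (IsLocalRing.residue O) (quadPoly 1 (liftMatrix D) k) =
      ∑ l, C (IsLocalRing.residue O (residualMatrix D k l)) * X l ^ 2 := by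
  have hchar : CharP (IsLocalRing.ResidueField O) 2 :=
    CharTwo.of_one_ne_zero_of_two_eq_zero one_ne_zero (two_eq_zero hO)
  have h : ∀ k : Sq p, map (IsLocalRing.residue O) (quadForm 1 (liftMatrix D) k) =
      ∑ l : {k : Sq p // k ≠ 1}, C (IsLocalRing.residue O (liftMatrix D k l ^ 2 - liftMatrix D k l)) *
        X l ^ 2 := fun k => by
    simp only [quadForm, map_sub, map_pow, map_sum, map_mul, map_C, map_X, sub_mul,
      Finset.sum_sub_distrib]
    rw [CharTwo.sum_sq]
    simp only [mul_pow]
  rw [quadPoly, map_sub, h, h, ← Finset.sum_sub_distrib]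
  refine Finset.sum_congr rfl fun l _ => ?_
  rw [residualMatrix, map_sub _ (liftMatrix D k l ^ 2 - liftMatrix D k l), C_sub, sub_mul]

/-- Let `Y` be a residual kernel vector, extended by `0` at `1`. Modulo two, `K k l ^ 2 = K k (s *
l)` with `s = ±2` a square, so `K` applied to `Z = Y ∘ s⁻¹ - Y` is a constant `b`. As `K` is an
involution fixing the constants, `Z = b`. Summing over the squares gives `n b = 0` with `n` odd,
hence `b = 0`, and `Y` is invariant under `s`. Since `s` generates the squares, `Y` is constant,
equal to its value `0` at `1`. -/
lemma isUnit_det_residualMatrix (hO : (2 : ℂ) ∈ O.nonunits) (h7 : 7 ≤ p)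
    (hsafe : ((p - 1) / 2).Prime) : IsUnit (residualMatrix D).det := by
  classical
  have h2 := two_eq_zero hO
  have hchar : CharP (IsLocalRing.ResidueField O) 2 :=
    CharTwo.of_one_ne_zero_of_two_eq_zero one_ne_zero h2
  set r := IsLocalRing.residue O with hr
  rw [← IsLocalRing.residue_ne_zero_iff_isUnit, RingHom.map_det]
  intro hdet
  obtain ⟨y, hy0, hy⟩ := Matrix.exists_mulVec_eq_zero_iff.2 hdet
  apply hy0
  set Y : Sq p → IsLocalRing.ResidueField O := extend 1 y with hY
  set s := twist h4 h7 with hs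
  have hsq : ∀ k l : Sq p, r (liftMatrix D k l) ^ 2 = r (liftMatrix D k (s * l)) := fun k l => by
    rw [liftMatrix, D.sq_residue, liftMatrix, Sq.coe_mul]
    rcases twist_eq h4 h7 with h | h
    · rw [hs, h]; congr 2; ring
    · rw [hs, h, ← D.neg_residue]; congr 2; ring
  set b := ∑ l, r (liftMatrix D 1 (s * l) - liftMatrix D 1 l) * Y l with hb
  have hconst : ∀ k : Sq p, ∑ l, r (liftMatrix D k (s * l) - liftMatrix D k l) * Y l = b := by
    intro k
    by_cases hk : k = 1
    · rw [hk]
    · have h3 := congrFun hy ⟨k, hk⟩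
      simp only [Matrix.mulVec, dotProduct, Pi.zero_apply] at h3
      rw [hb, ← sub_eq_zero, ← Finset.sum_sub_distrib, ← h3]
      simp only [← sub_mul]
      rw [hY, sum_mul_extend]
      refine Finset.sum_congr rfl fun l _ => ?_
      change _ = r (residualMatrix D ⟨k, hk⟩ l) * y l
      rw [residualMatrix]
      simp only [map_sub, map_pow, hsq]
  obtain ⟨t, ht⟩ : ∃ t : Sq p ≃ Sq p, ∀ l, t l = s * l :=
    ⟨Equiv.ofBijective _ (mulLeft_bijective s), fun l => rfl⟩
  -- Moving the multiplication by `s` from the matrix to the vector by a change of index turns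
  -- `hconst` into `K Z = b`.
  set Z : Sq p → IsLocalRing.ResidueField O := fun l => Y (t.symm l) - Y l with hZ
  have hKZ : ∀ k, ∑ l, r (liftMatrix D k l) * Z l = b := fun k => by
    rw [← hconst k]
    simp only [hZ, mul_sub, map_sub, sub_mul, Finset.sum_sub_distrib]
    congr 1
    rw [← Equiv.sum_comp t]
    simp only [Equiv.symm_apply_apply]
    simp only [ht]
  have hZb : ∀ k, Z k = b := fun k => by
    have h5 : ∀ k j, ∑ l, r (liftMatrix D k l) * r (liftMatrix D l j) = if k = j then 1 else 0 :=
      fun k j => by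
        have := congrArg r (liftMatrix_mul D k j)
        rw [map_sum] at this
        simp only [map_mul] at this
        rw [this]
        split_ifs <;> simp
    have h6 : ∑ l, r (liftMatrix D k l) = 1 := by
      rw [← map_sum, sum_liftMatrix, map_one]
    have h7 : ∑ l, r (liftMatrix D k l) * ∑ j, r (liftMatrix D l j) * Z j = Z k := by
      simp only [Finset.mul_sum, ← mul_assoc]
      rw [Finset.sum_comm]
      simp only [← Finset.sum_mul, h5]
      simp
    rw [← h7]
    simp only [hKZ]
    rw [← Finset.sum_mul, h6, one_mul]
  have hb0 : b = 0 := by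
    have h8 : ∑ k, Z k = 0 := by
      simp only [hZ, Finset.sum_sub_distrib]
      rw [Equiv.sum_comp t.symm, sub_self]
    simp only [hZb, Finset.sum_const, Finset.card_univ, card_sq h4, nsmul_eq_mul] at h8
    obtain ⟨j, hj⟩ : ∃ j, (p - 1) / 2 = 2 * j + 1 := ⟨(p - 1) / 2 / 2, by omega⟩
    rw [hj] at h8
    push_cast at h8
    rw [h2] at h8
    linear_combination h8
  have hinv : ∀ l, Y (s * l) = Y l := fun l => by
    have h9 := hZb (t l)
    rw [hb0, hZ] at h9
    simp only [Equiv.symm_apply_apply] at h9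
    rw [← ht, ← sub_eq_zero, ← neg_sub, h9, neg_zero]
  funext k
  have h10 := eq_of_mul_invariant h4 hsafe (twist_ne_one h4 h7) hinv k
  rw [hY, extend_coe, extend_self] at h10
  exact h10

end Reduction

end OddFun

end

/-! ### The quadrics of the Fourier matrix, and conclusion -/

noncomputable section

namespace OddFun

open MvPolynomial ProjGeom

variable {p : ℕ} [Fact p.Prime]

lemma card_sq_ne_one (h4 : p % 4 = 3) :
    Fintype.card {k : Sq p // k ≠ 1} = (p - 1) / 2 - 1 := by
  rw [Fintype.card_subtype_compl, Fintype.card_subtype_eq, card_sq h4]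

/-- This gathers the dyadic data in the form required by `finrank_quotient_eq` and `card_fibre_le`;
the element `2` serves as the nonzero element of the maximal ideal. -/
lemma exists_quadPoly_lift (h4 : p % 4 = 3) (h7 : 7 ≤ p) (hsafe : ((p - 1) / 2).Prime) :
    ∃ (O : ValuationSubring ℂ) (κ : Sq p → Sq p → O)
      (M : Matrix {k : Sq p // k ≠ 1} {k : Sq p // k ≠ 1} O),
      (2 : O) ∈ IsLocalRing.maximalIdeal O ∧ IsUnit M.det ∧
      (∀ k, map (IsLocalRing.residue O) (quadPoly 1 κ k) =
        ∑ l, C (IsLocalRing.residue O (M k l)) * X l ^ 2) ∧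
      ∀ k, map (algebraMap O ℂ) (quadPoly 1 κ k) =
        quadPoly (1 : Sq p) (fun k l => (sinMatrix k l : ℂ)) k := by
  obtain ⟨O, hO⟩ := exists_dyadic
  obtain ⟨D⟩ := nonempty_dyadicReduction h4 hO
  refine ⟨O, liftMatrix D, residualMatrix D, ?_, isUnit_det_residualMatrix D hO h7 hsafe,
    map_residue_quadPoly D hO, fun k => ?_⟩
  · obtain ⟨h, h'⟩ := O.mem_nonunits_iff_exists_mem_maximalIdeal.1 hO
    exact h'
  · rw [map_quadPoly]
    congr 1
    funext k l
    exact coe_liftMatrix D k l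

lemma finrank_quotient_sinMatrix (h4 : p % 4 = 3) (h7 : 7 ≤ p) (hsafe : ((p - 1) / 2).Prime)
    (Φ : {k : Sq p // k ≠ 1} → MvPolynomial {k : Sq p // k ≠ 1} ℂ)
    (hΦ : ∀ k, Φ k - quadPoly (1 : Sq p) (fun k l => (sinMatrix k l : ℂ)) k ∈
      idealOfVars {k : Sq p // k ≠ 1} ℂ ^ 3) (N : ℕ)
    (hN : Fintype.card {k : Sq p // k ≠ 1} < N) :
    Module.finrank ℂ (MvPolynomial {k : Sq p // k ≠ 1} ℂ ⧸
        (Ideal.span (Set.range Φ) ⊔ idealOfVars {k : Sq p // k ≠ 1} ℂ ^ N)) =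
          2 ^ Fintype.card {k : Sq p // k ≠ 1} := by
  obtain ⟨O, κ, M, h2, hM, hres, hmap⟩ := exists_quadPoly_lift h4 h7 hsafe
  simp only [← hmap] at hΦ
  rw [← Nat.card_eq_fintype_card] at hN ⊢
  exact SquareDeformation.finrank_quotient_eq (isHomogeneous_quadPoly 1 κ) hM hres h2
    two_ne_zero hΦ hN

lemma card_fibre_sinMatrix_le (h4 : p % 4 = 3) (h7 : 7 ≤ p) (hsafe : ((p - 1) / 2).Prime)
    (c : {k : Sq p // k ≠ 1} → ℂ) (Z : Finset ({k : Sq p // k ≠ 1} → ℂ))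
    (hZ : ∀ z ∈ Z, ∀ k, eval z (quadPoly (1 : Sq p) (fun k l => (sinMatrix k l : ℂ)) k) = c k) :
    Z.card ≤ 2 ^ Fintype.card {k : Sq p // k ≠ 1} := by
  obtain ⟨O, κ, M, h2, hM, hres, hmap⟩ := exists_quadPoly_lift h4 h7 hsafe
  simp only [← hmap] at hZ
  rw [← Nat.card_eq_fintype_card]
  exact SquareDeformation.card_fibre_le (isHomogeneous_quadPoly 1 κ) hM hres h2
    two_ne_zero c Z hZ

end OddFun

end

open ProjGeom OddFun
theorem proposition5p2 (p : ℕ) [Fact p.Prime] (h7 : 7 ≤ p) (hsafe : ((p - 1) / 2).Prime) :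
    (TangentAt (cliffordTorus p) (unitaryPreimage (fourierV p) (cliffordTorus p))
        (legendrePoint (safe_mod_four h7 hsafe)) ∧
      intersectionMultiplicity (cliffordTorus p) (unitaryPreimage (fourierV p) (cliffordTorus p))
        (legendrePoint (safe_mod_four h7 hsafe)) = 2 ^ ((p - 1) / 2 - 1)) ∧
    ∃ Ω ∈ nhds (legendrePoint (safe_mod_four h7 hsafe)),
      ∃ F : ℝ → (oddSpace p ≃ₗᵢ[ℂ] oddSpace p),
        Continuous (fun t => ((F t).toContinuousLinearEquiv : oddSpace p →L[ℂ] oddSpace p)) ∧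
        F 0 = fourierV p ∧
        ∀ t ∈ Set.Ioo (0 : ℝ) 1,
          (∀ x ∈ Ω ∩ (cliffordTorus p ∩ unitaryPreimage (F t) (cliffordTorus p)),
            TransverseAt (cliffordTorus p) (unitaryPreimage (F t) (cliffordTorus p)) x) ∧
          (Ω ∩ (cliffordTorus p ∩ unitaryPreimage (F t) (cliffordTorus p))).encard
            ≤ 2 ^ ((p - 1) / 2 - 2) := by
  have h4 := safe_mod_four h7 hsafe
  have hcard := card_sq_ne_one h4
  have : Nonempty {k : Sq p // k ≠ 1} := Fintype.card_pos_iff.1 (by omega)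
  rw [cliffordTorus_eq h4]
  refine ⟨⟨?_, ?_⟩, ?_⟩
  · exact tangentAt_torus (legendre_ne_zero h4) (restrictCLE_legendre h4) (fourierV p)
      (norm_gauss_div h4) sinMatrix (sum_sinMatrix h4) (sinMatrix_involutive h4)
      (restrictCLE_fourierV h4)
  · rw [← hcard]
    exact intersectionMultiplicity_torus (legendre_ne_zero h4) (restrictCLE_legendre h4)
      (fourierV p) (norm_gauss_div h4) sinMatrix (sum_sinMatrix h4) (restrictCLE_fourierV h4)
      (finrank_quotient_sinMatrix h4 h7 hsafe)
  · rw [show (p - 1) / 2 - 2 = Fintype.card {k : Sq p // k ≠ 1} - 1 by rw [hcard, Nat.sub_sub]]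
    have hreal := inner_legendre_im h4
    have h := @exists_perturbation (oddSpace p) _ _ (Sq p) _ 1 _ (restrictCLE h4) (legendre h4) _
      (legendre_ne_zero h4) (restrictCLE_legendre h4)
    exact h hreal (fourierV p) (norm_gauss_div h4) sinMatrix (sum_sinMatrix h4)
      (restrictCLE_fourierV h4) (card_fibre_sinMatrix_le h4 h7 hsafe)
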